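/- **Model.** $M$ players face $K$ arms, $1\le M\le K$. If player $m$ pulls arm $k=A^m(t)$ in round $t=1,\dots,T$, she receives $R^m(t)=Y^m_{k,t}$ if no other player pulls arm $k$ in this round, and $R^m(t)=0$ otherwise (a collision); she observes only $R^m(t)$ and whether she collided. The utilities $Y^m_{k,t}\in[0,1]$ are independent across rounds, and for each $(m,k)$ the law of $Y^m_{k,t}$ does not depend on $t$; its mean is $\mu^m_k$. A matching is an injective map $\pi:[M]\to[K]$, with utility $U(\pi)=\sum_m\mu^m_{\pi(m)}$. Let $U^\star=\max_\pi U(\pi)$; a matching of utility $U^\star$ is called maximum. Let $\Delta=\min\{U^\star-U(\pi): U(\pi)<U^\star\}$, with $\Delta=\infty$ if all matchings have the same utility. The regret is $R_T=TU^\star-\mathbb E\big[\sum_{t\le T}\sum_{m}R^m(t)\big]$. **Algorithm.** All players run the same program, M-ETC-Elim with parameter $c\in\{1,2,\dots\}$, which is given $K$, $T$ and $c$ (but neither $M$ nor the identity of the player) and has access to private randomness. *Initialization.* For $\lceil K\ln(K^2T)\rceil$ rounds, each player pulls independent uniformly random arms until she pulls one without a collision, which she then keeps pulling. Next, the player that occupies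 arm $k$ pulls arm $k$ for $2k-2$ rounds, then the arms $k+1,\dots,K$ once each, then arm $1$ for $K-k$ rounds. Her rank is $1$ plus her number of collisions in the first of these three stages, and her value for $M$ is $1$ plus her number of collisions in the first two stages. The player of rank $1$ is the leader and the other players are followers; players are identified with their ranks below. The initial communication arms are the ranks. *Epochs.* The leader keeps a set $\mathcal E$ of candidate edges, initially $[M]\times[K]$, and estimates $\widetilde\mu^m_k$, initially $0$. Let $\varepsilon_p=\sqrt{\ln(2/\delta)/2^{1+p^c}}$ for $p\ge 0$, with $\delta=1/(M^2KT^2)$. In epoch $p=1,2,\dots$: 1. The leader computes a matching $\pi_1$ that maximizes $\sum_n\widetilde\mu^n_{\pi(n)}$ and, for each edge $(m,k)\in\mathcal E$, a matching $\pi$ that maximizes this sum among the matchings with $\pi(m)=k$ (ties are broken by a fixed enumeration). If $\sum_n\big(\widetilde\mu^n_{\pi_1(n)}-\widetilde\mu^n_{\pi(n)}\big)\le 4M\varepsilon_{p-1}$, then $\pi$ is put in the list $\mathcal C$ of distinct candidate matchings; otherwise $(m,k)$ is removed from $\mathcal E$. 2. The leader sends to each follower in turn the size of $\mathcal C$, and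 then to each follower $m$ in turn her arms in the matchings of $\mathcal C$ and the arms $\pi_1(1)$ and $\pi_1(m)$. To transmit a bit $1$ the sender pulls the communication arm of the receiver, and for a bit $0$ her own; all the other players pull their own communication arms. After that, $\pi_1$ gives the new communication arms. 3. If $\mathcal C$ has exactly one element, all players pull their arms in this matching for the rest of the game. 4. Otherwise, for each matching of $\mathcal C$ in turn, all players pull their arms in this matching $2^{p^c}$ times. Each player computes the average reward she got from each arm in this epoch ($0$ for the arms that she did not pull). Each follower sends to the leader these $K$ averages, truncated to their $\lceil (p^c+1)/2\rceil$ most significant bits. These numbers, with the leader's own averages, are the new estimates $\widetilde\mu^m_k$. For $c=1$, consider also the variant in which the threshold $4M\varepsilon_{p-1}$ in step 1 is replaced by $4M\varepsilon_p$. **Theorem.** (a) For every integer $c\ge1$ there is a constant $C_c$, depending on $c$ only, such that for all $1\le M\le K$, all $T\ge2$ and all utility laws as above, the regret of M-ETC-Elim with parameter $c$ satisfies $$R_T\le C_c\,MK\Big(\frac{M^2\ln T}{\Delta}\Big)^{1+1/c}\quad\text{if }\Delta\ne\infty,$$ $$R_T\le C_c\Big(M^3K\ln K\sqrt{\ln T}+M^2K(\ln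 T)^{1+1/c}\Big)\quad\text{if }\Delta=\infty.$$ (b) There is an absolute constant $C$ such that for all $1\le M\le K$ there is $T_0=T_0(M,K)$ with the following property: for all $T\ge T_0$ and all utility laws for which the maximum matching is unique, M-ETC-Elim with $c=1$ satisfies $$R_T\le C\,\frac{M^3K\ln T}{\Delta}.$$ (c) There is an absolute constant $C$ such that for all $1\le M\le K$ there is $T_0=T_0(M,K)$ with the following property: for all $T\ge T_0$ and all utility laws, whether or not the maximum matching is unique, M-ETC-Elim with $c=1$ satisfies $$R_T\le C\,M^{3/2}\sqrt{KT\ln T}.$$ For $c=1$, all these bounds hold for both variants of the algorithm, with the same constants. -/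

import Mathlib

open MeasureTheory ProbabilityTheory
open scoped ENNReal

/-!
# Heterogeneous multiplayer bandits with collisions, and the M-ETC-Elim algorithm

Players, arms, ranks and rounds are numbered from `0`; epochs are numbered from `1`.
-/

namespace MultiplayerBandit

/-! ## Programs run by a single player

A program interacts with the world by pulling arms only.  After each pull it is told the
reward received by the player and whether there was a collision on the arm pulled, and nothing
else. -/

/-- A program for one player facing `K` arms, ending with a result of type `α`.
`pull k next` pulls arm `k`; `pullUnif next` pulls an arm drawn uniformly at random with the
player's private randomness.  In both cases the program goes on with `next`, which is given
(the arm drawn,) the reward and the collision indicator. -/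
inductive Prog (K : ℕ) (α : Type) : Type
  | ret (a : α) : Prog K α
  | pull (k : Fin K) (next : ℝ → Bool → Prog K α) : Prog K α
  | pullUnif (next : Fin K → ℝ → Bool → Prog K α) : Prog K α

namespace Prog

variable {K : ℕ} {α β : Type}

/-- Sequential composition. -/
def bind : Prog K α → (α → Prog K β) → Prog K β
  | ret a, g => g a
  | pull k next, g => pull k fun r b => (next r b).bind g
  | pullUnif next, g => pullUnif fun i r b => (next i r b).bind g

instance : Monad (Prog K) where
  pure := ret
  bind := bind

/-- The arm pulled in the current round, `u` being the arm drawn by the private randomness of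
the player in that round.  A program that has ended pulls arm `0`. -/
def arm [NeZero K] : Prog K α → Fin K → Fin K
  | ret _, _ => 0
  | pull k _, _ => k
  | pullUnif _, u => u

/-- What is left of the program after a round in which the private draw was `u`, the reward
was `r` and the collision indicator was `b`. -/
def step : Prog K α → Fin K → ℝ → Bool → Prog K α
  | ret a, _, _, _ => ret a
  | pull _ next, _, r, b => next r b
  | pullUnif next, u, r, b => next u r b

end Prog

/-- Pull the arms of a list one after the other; the result is the list of observations. -/
def pulls {K : ℕ} : List (Fin K) → Prog K (List (ℝ × Bool))
  | [] => Prog.ret []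
  | a :: l => Prog.pull a fun r b => (pulls l).bind fun os => Prog.ret ((r, b) :: os)

/-! ## Initialization -/

section Init

variable {K : ℕ}

/-- The musical chairs procedure for the given number of rounds; the second argument is the arm
occupied so far, if any. -/
def musicalChairs : ℕ → Option (Fin K) → Prog K (Option (Fin K))
  | 0, k => Prog.ret k
  | s + 1, some k => Prog.pull k fun _ _ => musicalChairs s (some k)
  | s + 1, none => Prog.pullUnif fun i _ b => musicalChairs s (if b then none else some i)

/-- Number of collisions in a list of observations. -/
def collisions (os : List (ℝ × Bool)) : ℕ := (os.map Prod.snd).count true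

/-- The procedure `Init(K, δ₀)`: musical chairs for `⌈K ln (K / δ₀)⌉` rounds, then sequential
hopping for `2K - 2` rounds.  The result is the rank of the player (from `0`) and the number of
the other players.  (A player that has not occupied any arm proceeds as if it had occupied
arm `0`.) -/
noncomputable def init (K : ℕ) [NeZero K] (δ₀ : ℝ) : Prog K (ℕ × ℕ) := do
  let k' ← musicalChairs ⌈(K : ℝ) * Real.log (K / δ₀)⌉₊ none
  let k : Fin K := k'.getD 0
  let o₁ ← pulls (List.replicate (2 * k.val) k)
  let o₂ ← pulls ((List.range (K - 1 - k.val)).map fun i => Fin.ofNat K (k.val + 1 + i))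
  let _ ← pulls (List.replicate (K - 1 - k.val) 0)
  Prog.ret (collisions o₁, collisions o₁ + collisions o₂)

end Init

/-! ## Communication protocol and estimates -/

/-- The `len` lowest bits of `x`, lowest first. -/
def encode (len x : ℕ) : List Bool := (List.range len).map x.testBit

/-- The number with the given bits, lowest first. -/
def decode (l : List Bool) : ℕ := l.foldr (fun b a => b.toNat + 2 * a) 0

/-- The number coded by the `i`-th block of `b` bits of the list `l`. -/
def decodeBlock (b i : ℕ) (l : List Bool) : ℕ := decode ((l.drop (i * b)).take b)

/-- The arms pulled by a player with communication arm `own` that sends the given bits to a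
player with communication arm `target`: a `1` is sent by a collision. -/
def sendArms {K : ℕ} (own target : Fin K) (bits : List Bool) : List (Fin K) :=
  bits.map fun b => if b then target else own

/-- Number of bits used to send the number of an arm, `⌈lg K⌉`. -/
def armBits (K : ℕ) : ℕ := Nat.clog 2 K

/-- Number of bits used to send the size of a list of at most `n * K` matchings. -/
def sizeBits (n K : ℕ) : ℕ := Nat.size (n * K)

/-- Number of bits used to send an estimate in epoch `p`, `⌈(p ^ c + 1) / 2⌉`. -/
def valueBits (c p : ℕ) : ℕ := (p ^ c + 2) / 2

/-- The `b` most significant bits of a number `x ∈ [0, 1]`, as an integer in `[0, 2 ^ b - 1]`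
(the number `1` is written `0.111…`). -/
noncomputable def quantize (b : ℕ) (x : ℝ) : ℕ := min ⌊(2 : ℝ) ^ b * x⌋₊ (2 ^ b - 1)

/-- Average of the rewards obtained on arm `k`, when the arms in the list `as` have been pulled
and the observations are `os`; it is `0` if arm `k` has not been pulled. -/
noncomputable def empMean {K : ℕ} (as : List (Fin K)) (os : List (ℝ × Bool)) (k : Fin K) : ℝ :=
  let rs := ((as.zip os).filter fun x => x.1 = k).map fun x => x.2.1
  rs.sum / rs.length

/-- The exploration schedule in epoch `p`: each arm of the list is pulled `2 ^ (p ^ c)` times. -/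
def exploreArms {K : ℕ} (c p : ℕ) (as : List (Fin K)) : List (Fin K) :=
  as.flatMap (List.replicate (2 ^ p ^ c))

/-- `ε_p = √(ln (2 / δ) / 2 ^ (1 + p ^ c))` with `δ = 1 / (n² K T²)`, `n` being the number of
players. -/
noncomputable def eps (n K T c p : ℕ) : ℝ :=
  Real.sqrt (Real.log (2 / (1 / ((n : ℝ) ^ 2 * K * (T : ℝ) ^ 2))) / 2 ^ (1 + p ^ c))

/-! ## The leader -/

section Leader

variable {K : ℕ}

/-- Weight of an assignment. -/
def weight {n : ℕ} (w : Fin n → Fin K → ℝ) (π : Fin n → Fin K) : ℝ := ∑ m, w m (π m)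

open Classical in
/-- A matching of maximum weight among those that satisfy `Q`; ties are broken by a fixed
enumeration of all the assignments. -/
noncomputable def bestMatching [NeZero K] {n : ℕ} (w : Fin n → Fin K → ℝ)
    (Q : (Fin n → Fin K) → Prop) : Fin n → Fin K :=
  (((Finset.univ : Finset (Fin n → Fin K)).toList.filter
    fun π => Function.Injective π ∧ Q π).argmax (weight w)).getD fun _ => 0

/-- The epochs `p, p + 1, …` of the leader, among `N + 1` players.  The arguments are a bound on
the number of epochs, `p`, the set of candidate edges, the estimated weights, and the
communication arms of all the players.  An edge is removed when the estimated weight of its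
associated matching is more than `4 (N + 1) ε_{p - lag}` below the maximum.

The leader first sends the size of the list of candidate matchings to each of the followers,
and then to each of them its arms in these matchings, the new communication arm of the leader
and the new communication arm of this follower. -/
noncomputable def leaderLoop [NeZero K] (T c lag N : ℕ) : ℕ → ℕ →
    Finset (Fin (N + 1) × Fin K) → (Fin (N + 1) → Fin K → ℝ) → (Fin (N + 1) → Fin K) →
    Prog K Unit
  | 0, _, _, _, _ => Prog.ret ()
  | s + 1, p, E, w, κ => do
    let π₁ := bestMatching w fun _ => True
    let assoc : Fin (N + 1) × Fin K → Fin (N + 1) → Fin K :=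
      fun e => bestMatching w fun π => π e.1 = e.2
    let E' := E.filter fun e =>
      weight w π₁ - weight w (assoc e) ≤ 4 * ((N + 1 : ℕ) : ℝ) * eps (N + 1) K T c (p - lag)
    let C := (E'.toList.map assoc).dedup
    let _ ← pulls ((List.finRange N).flatMap fun m =>
      sendArms (κ 0) (κ m.succ) (encode (sizeBits (N + 1) K) C.length))
    let _ ← pulls ((List.finRange N).flatMap fun m =>
      sendArms (κ 0) (κ m.succ)
        ((C.map (fun π => π m.succ) ++ [π₁ 0, π₁ m.succ]).flatMap
          fun a => encode (armBits K) a.val))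
    if C.length = 1 then
      let _ ← pulls (List.replicate T ((C.headD π₁) 0))
      Prog.ret ()
    else
      let as := exploreArms c p (C.map fun π => π 0)
      let os ← pulls as
      let b := valueBits c p
      let msg ← pulls (List.replicate (N * (K * b)) (π₁ 0))
      let bits := msg.map Prod.snd
      let w' : Fin (N + 1) → Fin K → ℝ := Fin.cases (empMean as os)
        fun m k => (decodeBlock b (m.val * K + k.val) bits : ℝ) / 2 ^ b
      leaderLoop T c lag N s (p + 1) E' w' π₁

/-- The algorithm of the leader, among `N + 1` players.  At first all the edges are candidates,
all the estimates are `0`, and the communication arms are given by the ranks.  (There is room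
for at most `T` epochs in `T` rounds.) -/
noncomputable def leader [NeZero K] (T c lag N : ℕ) : Prog K Unit :=
  leaderLoop T c lag N T 1 Finset.univ (fun _ _ => 0) fun i => Fin.ofNat K i.val

end Leader

/-! ## The followers -/

section Follower

variable {K : ℕ}

/-- The follower of rank `R` listens on its communication arm `own` to a phase in which the
leader sends `len` bits to each of the `N` followers in turn, and gets the bits meant for it. -/
def listen (N R len : ℕ) (own : Fin K) : Prog K (List Bool) := do
  let _ ← pulls (List.replicate ((R - 1) * len) own)
  let os ← pulls (List.replicate len own)
  let _ ← pulls (List.replicate ((N - R) * len) own)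
  Prog.ret (os.map Prod.snd)

/-- The epochs `p, p + 1, …` of the follower of rank `R`, among `N + 1` players.  The arguments
are a bound on the number of epochs, `p`, and the communication arm of this follower. -/
noncomputable def followerLoop [NeZero K] (T c N R : ℕ) : ℕ → ℕ → Fin K → Prog K Unit
  | 0, _, _ => Prog.ret ()
  | s + 1, p, own => do
    let sizeMsg ← listen N R (sizeBits (N + 1) K) own
    let size := decode sizeMsg
    let msg ← listen N R ((size + 2) * armBits K) own
    let armAt : ℕ → Fin K := fun i => Fin.ofNat K (decodeBlock (armBits K) i msg)
    let armL := armAt size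
    let own' := armAt (size + 1)
    if size = 1 then
      let _ ← pulls (List.replicate T (armAt 0))
      Prog.ret ()
    else
      let as := exploreArms c p ((List.range size).map armAt)
      let os ← pulls as
      let b := valueBits c p
      let bits := (List.finRange K).flatMap fun k => encode b (quantize b (empMean as os k))
      let _ ← pulls (List.replicate ((R - 1) * (K * b)) own')
      let _ ← pulls (sendArms own' armL bits)
      let _ ← pulls (List.replicate ((N - R) * (K * b)) own')
      followerLoop T c N R s (p + 1) own'

/-- The algorithm of the follower of rank `R`, among `N + 1` players. -/
noncomputable def follower [NeZero K] (T c N R : ℕ) : Prog K Unit :=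
  followerLoop T c N R T 1 (Fin.ofNat K R)

end Follower

/-- The algorithm M-ETC-Elim with parameter `c` for `K` arms and horizon `T`, executed by each
player.  In epoch `p` the elimination threshold is `4 M ε_{p - lag}`. -/
noncomputable def metcElim (K : ℕ) [NeZero K] (T c lag : ℕ) : Prog K Unit := do
  let (R, N) ← init K (1 / ((K : ℝ) * T))
  if R = 0 then leader T c lag N else follower T c N R

/-! ## The multiplayer bandit with collisions -/

section Dynamics

variable {M K : ℕ}

/-- Players collide when at least one other player pulls the same arm. -/
def collides (a : Fin M → Fin K) (m : Fin M) : Bool := decide (∃ m', m' ≠ m ∧ a m' = a m)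

/-- The rewards of the players when they pull the arms `a` and the utilities are `y`. -/
def rewards (y : Fin M → Fin K → ℝ) (a : Fin M → Fin K) (m : Fin M) : ℝ :=
  y m (a m) * if collides a m then 0 else 1

variable [NeZero K]

/-- What is left of the programs of the players at the beginning of round `t`, when all of them
execute `prog`, the utilities are `y` and the private random draws are `u`. -/
def programs (prog : Prog K Unit) (y : ℕ → Fin M → Fin K → ℝ) (u : ℕ → Fin M → Fin K) :
    ℕ → Fin M → Prog K Unit
  | 0 => fun _ => prog
  | t + 1 => fun m =>
    let q := programs prog y u t
    let a : Fin M → Fin K := fun m' => (q m').arm (u t m')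
    (q m).step (u t m) (rewards (y t) a m) (collides a m)

/-- The arms pulled in round `t`. -/
def arms (prog : Prog K Unit) (y : ℕ → Fin M → Fin K → ℝ) (u : ℕ → Fin M → Fin K) (t : ℕ)
    (m : Fin M) : Fin K :=
  (programs prog y u t m).arm (u t m)

end Dynamics

/-- The random environment: `Y t ω m k` is the utility of arm `k` for player `m` in round `t`,
and `U t ω m` is the private draw of player `m` in round `t`, uniform over the arms.  Rounds are
independent, utilities take values in `[0, 1]` and their laws do not depend on the round.
Nothing is assumed on the dependence between the utilities of one and the same round. -/
structure Environment (M K : ℕ) {Ω : Type*} [MeasurableSpace Ω] (P : Measure Ω) where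
  Y : ℕ → Ω → Fin M → Fin K → ℝ
  U : ℕ → Ω → Fin M → Fin K
  measurable_Y : ∀ t, Measurable (Y t)
  measurable_U : ∀ t, Measurable (U t)
  mem_Icc : ∀ t ω m k, Y t ω m k ∈ Set.Icc (0 : ℝ) 1
  identDistrib : ∀ t m k, IdentDistrib (fun ω => Y t ω m k) (fun ω => Y 0 ω m k) P P
  uniform_U : ∀ t (a : Fin M → Fin K), P (U t ⁻¹' {a}) = ((K : ℝ≥0∞) ^ M)⁻¹
  indep_Y_U : ∀ t, IndepFun (Y t) (U t) P
  indep_rounds : iIndepFun (fun t ω => (Y t ω, U t ω)) P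

namespace Environment

variable {M K : ℕ} {Ω : Type*} [MeasurableSpace Ω] {P : Measure Ω} (B : Environment M K P)

/-- The mean utility of arm `k` for player `m`. -/
noncomputable def mean (m : Fin M) (k : Fin K) : ℝ := ∫ ω, B.Y 0 ω m k ∂P

/-- The utility of a matching. -/
noncomputable def utility (π : Fin M ↪ Fin K) : ℝ := ∑ m, B.mean m (π m)

/-- The maximum utility `U⋆`. -/
noncomputable def maxUtility : ℝ := ⨆ π : Fin M ↪ Fin K, B.utility π

/-- Maximum matchings. -/
def IsOptimal (π : Fin M ↪ Fin K) : Prop := B.utility π = B.maxUtility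

/-- The gap `Δ`, the least positive value of `U⋆ - U(π)`; it is `∞` if there is none. -/
noncomputable def gap : ℝ≥0∞ :=
  ⨅ (π : Fin M ↪ Fin K) (_ : 0 < B.maxUtility - B.utility π),
    ENNReal.ofReal (B.maxUtility - B.utility π)

/-- The expected regret after `T` rounds when all the players execute `prog`. -/
noncomputable def regret [NeZero K] (prog : Prog K Unit) (T : ℕ) : ℝ :=
  T * B.maxUtility -
    ∫ ω, ∑ t ∈ Finset.range T, ∑ m,
      rewards (B.Y t ω) (arms prog (fun s => B.Y s ω) (fun s => B.U s ω) t) m ∂P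

end Environment

end MultiplayerBandit

open MultiplayerBandit

open MeasureTheory ProbabilityTheory
open scoped ENNReal

namespace MultiplayerBandit


/-! ## Joint runs of several programs -/

namespace Prog

variable {K : ℕ} {α β γ : Type}

/-! The proof turns a statement about expectations into a deterministic estimate. The arms pulled in
a round are determined by the earlier rounds and by the private draws of that round, and the
utilities of the round are independent of both. Utilities may therefore be replaced by their means,
and the regret is the expected pseudo-regret (`Environment.regret_eq`).

Outside an exceptional event, two things hold. Every player obtains an arm in the musical chairs,
because an unsettled player succeeds with probability at least `1 / K` in each round
(`measureReal_exists_chairs_le`). And every average over sufficiently many pulls in a window has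
precision `ε p` (`measure_not_wellEstimated_le`). Exploration is adaptive, so its position and the
numbers of pulls are random; an exponential supermartingale deals with the numbers of pulls and a
union bound over all windows with the position. The exceptional event contributes only `O(M K ln T)`
to the regret.

On the good event the game can be followed round by round. Hopping produces distinct ranks, and as
the communication arms are distinct, every bit is received correctly. The induction over epochs
(`tailCost_epochState_le`) carries the one-sided information of `EpochInv`: all estimates are at
most mean plus radius, while lower bounds are claimed only for the edges of maximum matchings. This
suffices (`EpochInv.candidates`): edges of maximum matchings are never removed, and each candidate
of epoch `p` loses at most `8 M ε (p - 1)`. A single remaining candidate is thus a maximum matching.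
Sending a bit costs at most `2` plus the loss of the matching formed by the communication arms.

What remains is summation, starting from one bound with free parameters (`regret_metcElim_le`). For
(a), losses vanish once `8 M ε` is below the gap. Exploration then costs a sum of terms `2 ^ ((r +
1) ^ c - r ^ c / 2)` over the epochs with `2 ^ r ^ c ≤ x`, where `x` is of order `M² ln T / Δ²`;
this is of order `x ^ ((1 + 1 / c) / 2)`. Bits cost `2` until the horizon, and `O(M)` only while the
gap is unresolved. For (b), uniqueness stops the elimination as soon as the gap is resolved, so
there are few epochs and their communication is negligible for large `T`. For (c), losses below `8 M
ε m` are accepted throughout the horizon, with `2 ^ m` of order `T / (M K)`; this balances them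
against the exploration of the earlier epochs. -/

theorem bind_assoc (p : Prog K α) (f : α → Prog K β) (g : β → Prog K γ) :
    (p.bind f).bind g = p.bind fun a => (f a).bind g := by
  induction p with
  | ret a => rfl
  | pull k next ih => simp only [bind, ih]
  | pullUnif next ih => simp only [bind, ih]

end Prog

section Runs

variable {M K : ℕ}

/-- Players cut the same rounds into blocks differently: the leader sends to all followers in turn
while a follower waits, listens and waits again. Merging the blocks makes all programs comparable
with one joint schedule. -/
theorem pulls_append_bind {β : Type} (l₁ l₂ : List (Fin K))
    (g : List (ℝ × Bool) → List (ℝ × Bool) → Prog K β) :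
    ((pulls l₁).bind fun o₁ => (pulls l₂).bind (g o₁)) =
      (pulls (l₁ ++ l₂)).bind fun os => g (os.take l₁.length) (os.drop l₁.length) := by
  induction l₁ generalizing g with
  | nil => simp [pulls, Prog.bind]
  | cons a l ih =>
    simp only [List.cons_append, pulls, Prog.bind, Prog.bind_assoc, List.length_cons,
      List.take_succ_cons, List.drop_succ_cons]
    congr 1
    funext r b
    exact ih fun o₁ o₂ => g ((r, b) :: o₁) o₂

/-- `Q t m` is the program of player `m` at the beginning of round `t`, when the utilities are
`y` and the private draws are `u`. -/
def IsRun [NeZero K] (y : ℕ → Fin M → Fin K → ℝ) (u : ℕ → Fin M → Fin K)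
    (Q : ℕ → Fin M → Prog K Unit) : Prop :=
  ∀ t m, Q (t + 1) m = (Q t m).step (u t m)
    (rewards (y t) (fun m' => (Q t m').arm (u t m')) m)
    (collides (fun m' => (Q t m').arm (u t m')) m)

/-- The arms pulled in round `t` of a run. -/
def runArms [NeZero K] (u : ℕ → Fin M → Fin K) (Q : ℕ → Fin M → Prog K Unit) (t : ℕ) :
    Fin M → Fin K :=
  fun m => (Q t m).arm (u t m)

theorem isRun_programs [NeZero K] (prog : Prog K Unit) (y : ℕ → Fin M → Fin K → ℝ)
    (u : ℕ → Fin M → Fin K) : IsRun y u (programs prog y u) := fun _ _ => rfl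

theorem collides_comp_equiv (a : Fin M → Fin K) (σ : Equiv.Perm (Fin M)) (r : Fin M) :
    collides (fun r' => a (σ r')) r = collides a (σ r) := by
  unfold collides
  congr 1
  apply propext
  constructor
  · rintro ⟨m', h, h'⟩
    exact ⟨σ m', fun e => h (σ.injective e), h'⟩
  · rintro ⟨m', h, h'⟩
    exact ⟨σ.symm m', fun e => h (by rw [← e]; simp), by simpa using h'⟩

theorem collides_eq_false_of_injective {a : Fin M → Fin K} (ha : Function.Injective a)
    (m : Fin M) : collides a m = false := by
  simp only [collides, decide_eq_false_iff_not]
  rintro ⟨m', h, h'⟩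
  exact h (ha h')

theorem rewards_of_injective (y : Fin M → Fin K → ℝ) {a : Fin M → Fin K}
    (ha : Function.Injective a) (m : Fin M) : rewards y a m = y m (a m) := by
  simp [rewards, collides_eq_false_of_injective ha]

/-- Renaming the players. -/
theorem IsRun.relabel [NeZero K] {y : ℕ → Fin M → Fin K → ℝ} {u : ℕ → Fin M → Fin K}
    {Q : ℕ → Fin M → Prog K Unit} (h : IsRun y u Q) (σ : Equiv.Perm (Fin M)) :
    IsRun (fun t r => y t (σ r)) (fun t r => u t (σ r)) (fun t r => Q t (σ r)) := by
  intro t m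
  have hc := collides_comp_equiv (fun m' => (Q t m').arm (u t m')) σ m
  simp only [rewards, hc]
  exact h t (σ m)

/-- The observations of player `m` when the players pull arms according to the given schedule
from round `t` on. -/
def observations (y : ℕ → Fin M → Fin K → ℝ) :
    ℕ → List (Fin M → Fin K) → Fin M → List (ℝ × Bool)
  | _, [], _ => []
  | t, a :: l, m => (rewards (y t) a m, collides a m) :: observations y (t + 1) l m

theorem observations_map_snd (y : ℕ → Fin M → Fin K → ℝ) (t : ℕ)
    (l : List (Fin M → Fin K)) (m : Fin M) :
    (observations y t l m).map Prod.snd = l.map fun a => collides a m := by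
  induction l generalizing t with
  | nil => rfl
  | cons a l ih => simp [observations, ih]

/-- While every program is a fixed list of pulls, no observation influences an arm, so the players
follow the joint schedule; the continuations `g` see the observations only afterwards. -/
theorem IsRun.block [NeZero K] {y : ℕ → Fin M → Fin K → ℝ} {u : ℕ → Fin M → Fin K}
    {Q : ℕ → Fin M → Prog K Unit} (h : IsRun y u Q) (sched : List (Fin M → Fin K))
    (g : Fin M → List (ℝ × Bool) → Prog K Unit) (t : ℕ)
    (hQ : ∀ m, Q t m = (pulls (sched.map fun a => a m)).bind (g m)) :
    (∀ m, Q (t + sched.length) m = g m (observations y t sched m)) ∧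
      ∀ i (hi : i < sched.length), runArms u Q (t + i) = sched[i] := by
  induction sched generalizing t g with
  | nil => exact ⟨fun m => by simpa [pulls, Prog.bind, observations] using hQ m, fun i hi => by simp at hi⟩
  | cons a l ih =>
    have ha : runArms u Q t = a := by
      funext m
      simp [runArms, hQ, pulls, Prog.bind, Prog.arm]
    have hstep : ∀ m, Q (t + 1) m = (pulls (l.map fun a => a m)).bind
        (fun os => g m ((rewards (y t) a m, collides a m) :: os)) := by
      intro m
      rw [h t m]
      change (Q t m).step (u t m) (rewards (y t) (runArms u Q t) m)
        (collides (runArms u Q t) m) = _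
      rw [ha, hQ m]
      simp [pulls, Prog.bind, Prog.step, Prog.bind_assoc]
    obtain ⟨h1, h2⟩ := ih _ (t + 1) hstep
    refine ⟨fun m => ?_, fun i hi => ?_⟩
    · have := h1 m
      rw [List.length_cons, show t + (l.length + 1) = t + 1 + l.length by omega, this]
      rfl
    · cases i with
      | zero => simpa using ha
      | succ i =>
        have := h2 i (by simpa using hi)
        rw [show t + (i + 1) = t + 1 + i by omega, this]
        simp

/-- The cost of the rounds from `t` on, up to round `T`. -/
noncomputable def tailCost [NeZero K] (f : (Fin M → Fin K) → ℝ) (u : ℕ → Fin M → Fin K)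
    (Q : ℕ → Fin M → Prog K Unit) (T t : ℕ) : ℝ :=
  ∑ s ∈ Finset.Ico t T, f (runArms u Q s)

theorem tailCost_of_le [NeZero K] (f : (Fin M → Fin K) → ℝ) (u : ℕ → Fin M → Fin K)
    (Q : ℕ → Fin M → Prog K Unit) {T t : ℕ} (h : T ≤ t) : tailCost f u Q T t = 0 := by
  simp [tailCost, Finset.Ico_eq_empty_of_le h]

/-- The block may run past the horizon, in which case only some of its `n` rounds count; hence the
condition `0 ≤ b`. -/
theorem tailCost_le_add [NeZero K] (f : (Fin M → Fin K) → ℝ) (u : ℕ → Fin M → Fin K)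
    (Q : ℕ → Fin M → Prog K Unit) (T t n : ℕ) {b : ℝ} (hb : 0 ≤ b)
    (h : ∀ i < n, f (runArms u Q (t + i)) ≤ b) :
    tailCost f u Q T t ≤ n * b + tailCost f u Q T (t + n) := by
  have key : ∀ t' ≤ t + n, ∑ s ∈ Finset.Ico t t', f (runArms u Q s) ≤ n * b := by
    intro t' ht'
    calc ∑ s ∈ Finset.Ico t t', f (runArms u Q s) ≤ ∑ s ∈ Finset.Ico t t', b := by
          refine Finset.sum_le_sum fun s hs => ?_
          rw [Finset.mem_Ico] at hs
          have := h (s - t) (by omega)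
          rwa [show t + (s - t) = s by omega] at this
      _ = ((t' - t : ℕ) : ℝ) * b := by simp
      _ ≤ n * b := by gcongr; omega
  rcases le_total T (t + n) with hT | hT
  · rw [tailCost_of_le f u Q hT, add_zero]
    exact key T hT
  · unfold tailCost
    rw [← Finset.sum_Ico_consecutive _ (Nat.le_add_right t n) hT]
    linarith [key (t + n) le_rfl]

theorem IsRun.tailCost_block [NeZero K] {y : ℕ → Fin M → Fin K → ℝ} {u : ℕ → Fin M → Fin K}
    {Q : ℕ → Fin M → Prog K Unit} (h : IsRun y u Q) (sched : List (Fin M → Fin K))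
    (g : Fin M → List (ℝ × Bool) → Prog K Unit) (t : ℕ)
    (hQ : ∀ m, Q t m = (pulls (sched.map fun a => a m)).bind (g m))
    (f : (Fin M → Fin K) → ℝ) (T : ℕ) {b : ℝ} (hb : 0 ≤ b) (hf : ∀ a ∈ sched, f a ≤ b) :
    tailCost f u Q T t ≤ sched.length * b + tailCost f u Q T (t + sched.length) := by
  refine tailCost_le_add f u Q T t _ hb fun i hi => ?_
  rw [(h.block sched g t hQ).2 i hi]
  exact hf _ (List.getElem_mem _)

end Runs


/-! ## Measurability of programs -/

section MeasurableProg

variable {M K : ℕ}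

/-- Families of programs that depend on a parameter in a measurable way. -/
inductive MeasurableProg {K : ℕ} : ∀ {X : Type} [MeasurableSpace X], (X → Prog K Unit) → Prop
  | ret {X : Type} [MeasurableSpace X] : MeasurableProg fun _ : X => Prog.ret ()
  | pull {X : Type} [MeasurableSpace X] (k : Fin K) (next : X → ℝ → Bool → Prog K Unit)
      (h : MeasurableProg fun z : X × ℝ × Bool => next z.1 z.2.1 z.2.2) :
      MeasurableProg fun x => Prog.pull k (next x)
  | pullUnif {X : Type} [MeasurableSpace X] (next : X → Fin K → ℝ → Bool → Prog K Unit)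
      (h : MeasurableProg fun z : X × Fin K × ℝ × Bool => next z.1 z.2.1 z.2.2.1 z.2.2.2) :
      MeasurableProg fun x => Prog.pullUnif (next x)
  | cases {X ι : Type} [MeasurableSpace X] [Countable ι] (f : X → ι)
      (hf : ∀ i, MeasurableSet (f ⁻¹' {i})) (p : ι → X → Prog K Unit)
      (hp : ∀ i, MeasurableProg (p i)) : MeasurableProg fun x => p (f x) x

namespace MeasurableProg

theorem comp {X : Type} [MeasurableSpace X] {p : X → Prog K Unit} (hp : MeasurableProg p) :
    ∀ {X' : Type} [MeasurableSpace X'] {φ : X' → X}, Measurable φ →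
      MeasurableProg fun x' => p (φ x') := by
  induction hp with
  | ret => intros; exact ret
  | pull k next h ih =>
    intro X' _ φ hφ
    refine pull k (fun x' => next (φ x')) ?_
    exact ih (φ := fun z : X' × ℝ × Bool => (φ z.1, z.2)) (by fun_prop)
  | pullUnif next h ih =>
    intro X' _ φ hφ
    refine pullUnif (fun x' => next (φ x')) ?_
    exact ih (φ := fun z : X' × Fin K × ℝ × Bool => (φ z.1, z.2)) (by fun_prop)
  | cases f hf p hp ih =>
    intro X' _ φ hφ
    exact cases (fun x' => f (φ x')) (fun i => hφ (hf i)) (fun i x' => p i (φ x'))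
      fun i => ih i hφ

theorem measurable_of_cases {X ι Z : Type} [MeasurableSpace X] [Countable ι]
    [MeasurableSpace Z] (f : X → ι) (hf : ∀ i, MeasurableSet (f ⁻¹' {i})) (g : ι → X → Z)
    (hg : ∀ i, Measurable (g i)) : Measurable fun x => g (f x) x := by
  let _ : MeasurableSpace ι := ⊤
  have : DiscreteMeasurableSpace ι := ⟨fun _ => trivial⟩
  have hf' : Measurable f := measurable_to_countable' hf
  exact (measurable_from_prod_countable_right (f := fun z : ι × X => g z.1 z.2) hg).comp
    (hf'.prodMk measurable_id)

theorem measurable_arm [NeZero K] {X : Type} [MeasurableSpace X] {p : X → Prog K Unit}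
    (hp : MeasurableProg p) : Measurable fun z : X × Fin K => (p z.1).arm z.2 := by
  induction hp with
  | ret => exact measurable_const
  | pull k next h ih => exact measurable_const
  | pullUnif next h ih => exact measurable_snd
  | cases f hf p hp ih =>
    exact measurable_of_cases (fun z : _ × Fin K => f z.1) (fun i => measurable_fst (hf i))
      (fun i z => (p i z.1).arm z.2) ih

theorem step {X : Type} [MeasurableSpace X] {p : X → Prog K Unit}
    (hp : MeasurableProg p) : MeasurableProg fun z : X × Fin K × ℝ × Bool =>
      (p z.1).step z.2.1 z.2.2.1 z.2.2.2 := by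
  induction hp with
  | ret => exact ret
  | @pull X _ k next h ih =>
    exact h.comp (φ := fun z : X × Fin K × ℝ × Bool => (z.1, z.2.2)) (by fun_prop)
  | pullUnif next h ih => exact h
  | @cases X ι _ _ f hf p hp ih =>
    exact cases (fun z : X × Fin K × ℝ × Bool => f z.1) (fun i => measurable_fst (hf i))
      (fun i z => (p i z.1).step z.2.1 z.2.2.1 z.2.2.2) ih

/-- Lists of observations of fixed length that depend on a parameter in a measurable way. -/
inductive _root_.MultiplayerBandit.MeasurableObs {X : Type} [MeasurableSpace X] :
    (X → List (ℝ × Bool)) → Prop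
  | nil : MeasurableObs fun _ => []
  | cons (o : X → ℝ × Bool) (os : X → List (ℝ × Bool)) (ho : Measurable o)
      (hos : MeasurableObs os) : MeasurableObs fun x => o x :: os x

/-- The observations of the block become part of the parameter on which the continuation depends.
The hypothesis therefore ranges over all parameter spaces above `X`. -/
theorem pulls_bind {X : Type} [MeasurableSpace X] (l : List (Fin K))
    (g : X → List (ℝ × Bool) → Prog K Unit)
    (hg : ∀ (Z : Type) [MeasurableSpace Z] (φ : Z → X) (os : Z → List (ℝ × Bool)),
      Measurable φ → MeasurableObs os → MeasurableProg fun z => g (φ z) (os z)) :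
    MeasurableProg fun x => (pulls l).bind (g x) := by
  induction l generalizing X with
  | nil => exact hg X id (fun _ => []) measurable_id MeasurableObs.nil
  | cons a l ih =>
    simp only [pulls, Prog.bind, Prog.bind_assoc]
    refine pull a _ (ih (X := X × ℝ × Bool)
      (fun z os => g z.1 ((z.2.1, z.2.2) :: os)) fun Z _ φ os hφ hos => ?_)
    exact hg Z (fun z => (φ z).1) (fun z => ((φ z).2.1, (φ z).2.2) :: os z) (by fun_prop)
      (MeasurableObs.cons _ _ (by fun_prop) hos)

theorem measurableSet_map_snd {X : Type} [MeasurableSpace X] {os : X → List (ℝ × Bool)}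
    (h : MeasurableObs os) (l : List Bool) :
    MeasurableSet ((fun x => (os x).map Prod.snd) ⁻¹' {l}) := by
  induction h generalizing l with
  | nil => exact MeasurableSet.const _
  | cons o os ho hos ih =>
    cases l with
    | nil => convert MeasurableSet.empty; ext; simp
    | cons b l =>
      have : ((fun x => ((o x :: os x).map Prod.snd)) ⁻¹' {b :: l}) =
          ((fun x => (o x).2) ⁻¹' {b}) ∩ ((fun x => (os x).map Prod.snd) ⁻¹' {l}) := by
        ext; simp
      rw [this]
      exact ((measurable_snd.comp ho) (MeasurableSet.singleton b)).inter (ih l)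

/-- Pulling arms and then looking at the collisions only. -/
theorem pulls_bind_bits {X : Type} [MeasurableSpace X] (l : List (Fin K))
    (g : X → List Bool → Prog K Unit) (hg : ∀ bits, MeasurableProg fun x => g x bits) :
    MeasurableProg fun x => (pulls l).bind fun os => g x (os.map Prod.snd) :=
  pulls_bind l (fun x os => g x (os.map Prod.snd)) fun _ _ φ os hφ hos =>
    cases (fun z => (os z).map Prod.snd) (measurableSet_map_snd hos) (fun bits z => g (φ z) bits)
      fun bits => (hg bits).comp hφ

theorem pulls_bind_const {X : Type} [MeasurableSpace X] (l : List (Fin K))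
    {p : X → Prog K Unit} (hp : MeasurableProg p) :
    MeasurableProg fun x => (pulls l).bind fun _ => p x :=
  pulls_bind l (fun x _ => p x) fun _ _ _ _ hφ _ => hp.comp hφ

theorem measurable_filter_sum {X : Type} [MeasurableSpace X] {os : X → List (ℝ × Bool)}
    (h : MeasurableObs os) (as : List (Fin K)) (k : Fin K) :
    (Measurable fun x => (((as.zip (os x)).filter fun z => z.1 = k).map fun z => z.2.1).sum) ∧
    Measurable fun x =>
      (((as.zip (os x)).filter fun z => z.1 = k).map fun z => z.2.1).length := by
  induction h generalizing as with
  | nil => simp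
  | cons o os ho hos ih =>
    cases as with
    | nil => simp
    | cons a as =>
      by_cases hak : a = k
      · simp only [List.zip_cons_cons, List.filter_cons, hak, decide_true, if_true,
          List.map_cons, List.sum_cons, List.length_cons]
        exact ⟨(measurable_fst.comp ho).add (ih as).1, (ih as).2.add_const 1⟩
      · simp only [List.zip_cons_cons, List.filter_cons, hak, decide_false]
        exact ih as

theorem measurable_empMean {X : Type} [MeasurableSpace X] {os : X → List (ℝ × Bool)}
    (h : MeasurableObs os) (as : List (Fin K)) (k : Fin K) :
    Measurable fun x => empMean as (os x) k := by
  obtain ⟨h1, h2⟩ := measurable_filter_sum h as k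
  exact h1.div (measurable_from_nat.comp h2)

theorem measurable_quantize (b : ℕ) : Measurable (quantize b) := by
  unfold quantize
  exact (Nat.measurable_floor.comp (measurable_const.mul measurable_id)).min measurable_const

theorem musicalChairs_bind {X : Type} [MeasurableSpace X] (s : ℕ) (o : Option (Fin K))
    (g : Option (Fin K) → Prog K Unit) (hg : ∀ o, MeasurableProg fun _ : Unit => g o) :
    MeasurableProg fun _ : X => (musicalChairs s o).bind g := by
  induction s generalizing o X with
  | zero =>
    exact (hg o).comp (measurable_const (a := ()))
  | succ s ih =>
    cases o with
    | some k =>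
      simp only [musicalChairs, Prog.bind]
      exact pull k _ (ih (some k))
    | none =>
      simp only [musicalChairs, Prog.bind]
      refine pullUnif _ ?_
      refine cases (fun z : X × Fin K × ℝ × Bool => (z.2.1, z.2.2.2)) (fun i => ?_)
        (fun i _ => (musicalChairs s (if i.2 then none else some i.1)).bind g) fun i => ih _
      exact (show Measurable fun z : X × Fin K × ℝ × Bool => (z.2.1, z.2.2.2) by fun_prop)
        (MeasurableSet.singleton i)

end MeasurableProg

end MeasurableProg


/-! ### Decomposition of the algorithm into blocks of pulls, and its measurability -/

section Epochs

variable {K : ℕ}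

/-- What the leader computes at the beginning of an epoch with threshold `θ`: the best matching,
the remaining candidate edges and the list of candidate matchings. -/
noncomputable def leaderChoice [NeZero K] {n : ℕ} (θ : ℝ) (E : Finset (Fin n × Fin K))
    (w : Fin n → Fin K → ℝ) :
    (Fin n → Fin K) × Finset (Fin n × Fin K) × List (Fin n → Fin K) :=
  let π₁ := bestMatching w fun _ => True
  let assoc : Fin n × Fin K → Fin n → Fin K := fun e => bestMatching w fun π => π e.1 = e.2
  let E' := E.filter fun e => weight w π₁ - weight w (assoc e) ≤ θ
  (π₁, E', (E'.toList.map assoc).dedup)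

/-- The arms pulled by the leader to communicate in an epoch. -/
def leaderSizeArms {N : ℕ} (κ : Fin (N + 1) → Fin K) (size : ℕ) : List (Fin K) :=
  (List.finRange N).flatMap fun m =>
    sendArms (κ 0) (κ m.succ) (encode (sizeBits (N + 1) K) size)

/-- The message of the leader to player `r`. -/
def leaderMessage {N : ℕ} (π₁ : Fin (N + 1) → Fin K) (C : List (Fin (N + 1) → Fin K))
    (r : Fin (N + 1)) : List Bool :=
  (C.map (fun π => π r) ++ [π₁ 0, π₁ r]).flatMap fun a => encode (armBits K) a.val

/-- The arms pulled by the leader to send the candidate matchings. -/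
def leaderMatchingArms {N : ℕ} (κ π₁ : Fin (N + 1) → Fin K) (C : List (Fin (N + 1) → Fin K)) :
    List (Fin K) :=
  (List.finRange N).flatMap fun m => sendArms (κ 0) (κ m.succ) (leaderMessage π₁ C m.succ)

/-- The new estimates of the leader. -/
noncomputable def leaderEstimates {N : ℕ} (b : ℕ) (as : List (Fin K)) (os : List (ℝ × Bool))
    (bits : List Bool) : Fin (N + 1) → Fin K → ℝ :=
  Fin.cases (empMean as os) fun m k => (decodeBlock b (m.val * K + k.val) bits : ℝ) / 2 ^ b

/-- The part of an epoch of the leader that follows the choice of the candidate matchings. -/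
noncomputable def leaderEpoch [NeZero K] (T c lag N s p : ℕ) (κ π₁ : Fin (N + 1) → Fin K)
    (E' : Finset (Fin (N + 1) × Fin K)) (C : List (Fin (N + 1) → Fin K)) : Prog K Unit :=
  (pulls (leaderSizeArms κ C.length)).bind fun _ =>
  (pulls (leaderMatchingArms κ π₁ C)).bind fun _ =>
  if C.length = 1 then
    (pulls (List.replicate T ((C.headD π₁) 0))).bind fun _ => Prog.ret ()
  else
    (pulls (exploreArms c p (C.map fun π => π 0))).bind fun os =>
    (pulls (List.replicate (N * (K * valueBits c p)) (π₁ 0))).bind fun msg =>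
      leaderLoop T c lag N s (p + 1) E'
        (leaderEstimates (valueBits c p) (exploreArms c p (C.map fun π => π 0)) os
          (msg.map Prod.snd)) π₁

theorem leaderLoop_succ [NeZero K] (T c lag N s p : ℕ) (E : Finset (Fin (N + 1) × Fin K))
    (w : Fin (N + 1) → Fin K → ℝ) (κ : Fin (N + 1) → Fin K) :
    leaderLoop T c lag N (s + 1) p E w κ =
      let d := leaderChoice (4 * ((N + 1 : ℕ) : ℝ) * eps (N + 1) K T c (p - lag)) E w
      leaderEpoch T c lag N s p κ d.1 d.2.1 d.2.2 := rfl

/-- The bits that a follower sends to the leader. -/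
noncomputable def followerBits (b : ℕ) (as : List (Fin K)) (os : List (ℝ × Bool)) : List Bool :=
  (List.finRange K).flatMap fun k => encode b (quantize b (empMean as os k))

/-- The part of an epoch of a follower that follows the message of the leader. -/
noncomputable def followerEpoch [NeZero K] (T c N R s p size : ℕ) (armAt : ℕ → Fin K) :
    Prog K Unit :=
  if size = 1 then
    (pulls (List.replicate T (armAt 0))).bind fun _ => Prog.ret ()
  else
    (pulls (exploreArms c p ((List.range size).map armAt))).bind fun os =>
    (pulls (List.replicate ((R - 1) * (K * valueBits c p)) (armAt (size + 1)))).bind fun _ =>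
    (pulls (sendArms (armAt (size + 1)) (armAt size) (followerBits (valueBits c p)
      (exploreArms c p ((List.range size).map armAt)) os))).bind fun _ =>
    (pulls (List.replicate ((N - R) * (K * valueBits c p)) (armAt (size + 1)))).bind fun _ =>
      followerLoop T c N R s (p + 1) (armAt (size + 1))

/-- Decoding of the message of the leader. -/
def decodeArm [NeZero K] (msg : List Bool) (i : ℕ) : Fin K :=
  Fin.ofNat K (decodeBlock (armBits K) i msg)

theorem followerLoop_succ [NeZero K] (T c N R s p : ℕ) (own : Fin K) :
    followerLoop T c N R (s + 1) p own =
      (listen N R (sizeBits (N + 1) K) own).bind fun sizeMsg =>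
      (listen N R ((decode sizeMsg + 2) * armBits K) own).bind fun msg =>
        followerEpoch T c N R s p (decode sizeMsg) (decodeArm msg) := rfl

theorem listen_bind {β : Type} (N R len : ℕ) (own : Fin K) (g : List Bool → Prog K β) :
    (listen N R len own).bind g =
      (pulls (List.replicate ((R - 1) * len) own)).bind fun _ =>
      (pulls (List.replicate len own)).bind fun os =>
      (pulls (List.replicate ((N - R) * len) own)).bind fun _ => g (os.map Prod.snd) := by
  change Prog.bind (Prog.bind _ _) g = _
  rw [Prog.bind_assoc]
  congr 1; funext _
  change Prog.bind (Prog.bind _ _) g = _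
  rw [Prog.bind_assoc]
  congr 1; funext _
  change Prog.bind (Prog.bind _ _) g = _
  rw [Prog.bind_assoc]
  rfl

theorem init_bind {β : Type} [NeZero K] (δ₀ : ℝ) (g : ℕ × ℕ → Prog K β) :
    (init K δ₀).bind g =
      (musicalChairs ⌈(K : ℝ) * Real.log (K / δ₀)⌉₊ none).bind fun k' =>
      (pulls (List.replicate (2 * (k'.getD 0).val) (k'.getD 0))).bind fun o₁ =>
      (pulls ((List.range (K - 1 - (k'.getD 0).val)).map
        fun i => Fin.ofNat K ((k'.getD 0).val + 1 + i))).bind fun o₂ =>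
      (pulls (List.replicate (K - 1 - (k'.getD 0).val) 0)).bind fun _ =>
        g (collisions o₁, collisions o₁ + collisions o₂) := by
  change Prog.bind (Prog.bind _ _) g = _
  rw [Prog.bind_assoc]
  congr 1; funext k'
  change Prog.bind (Prog.bind _ _) g = _
  rw [Prog.bind_assoc]
  congr 1; funext _
  change Prog.bind (Prog.bind _ _) g = _
  rw [Prog.bind_assoc]
  congr 1; funext _
  change Prog.bind (Prog.bind _ _) g = _
  rw [Prog.bind_assoc]
  rfl

theorem metcElim_eq [NeZero K] (T c lag : ℕ) :
    metcElim K T c lag = (init K (1 / ((K : ℝ) * T))).bind fun z =>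
      if z.1 = 0 then leader T c lag z.2 else follower T c z.2 z.1 := rfl

/-- `List.argmax` only compares weights, so even the way ties are broken is determined by the order
of the weights. -/
theorem bestMatching_congr [NeZero K] {n : ℕ} {w w' : Fin n → Fin K → ℝ}
    (h : ∀ π π', weight w π < weight w π' ↔ weight w' π < weight w' π')
    (Q : (Fin n → Fin K) → Prop) : bestMatching w Q = bestMatching w' Q := by
  classical
  unfold bestMatching List.argmax
  congr 2
  funext a b
  unfold List.argAux
  cases a with
  | none => rfl
  | some c => simp only [h]

/-- The level sets of `g` are countable unions of fibres of `f`; no σ-algebra on `κ` is needed. -/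
theorem measurableSet_preimage_of_factors {X ι κ : Type} [MeasurableSpace X] [Countable ι]
    (f : X → ι) (hf : ∀ i, MeasurableSet (f ⁻¹' {i})) (g : X → κ)
    (h : ∀ x x', f x = f x' → g x = g x') (k : κ) : MeasurableSet (g ⁻¹' {k}) := by
  have : g ⁻¹' {k} = ⋃ i ∈ {i | ∃ x, f x = i ∧ g x = k}, f ⁻¹' {i} := by
    ext x
    simp only [Set.mem_preimage, Set.mem_singleton_iff, Set.mem_ofPred_eq, Set.mem_iUnion,
      exists_prop, exists_eq_right']
    constructor
    · intro hx
      exact ⟨x, rfl, hx⟩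
    · rintro ⟨x', h1, h2⟩
      rw [← h2]
      exact h _ _ h1.symm
  rw [this]
  exact MeasurableSet.biUnion (Set.to_countable _) fun i _ => hf i

/-- The choice depends on the estimates only through finitely many comparisons: those between
weights, and those of differences of weights with `θ`. -/
theorem measurableSet_leaderChoice [NeZero K] {n : ℕ} (θ : ℝ) (E : Finset (Fin n × Fin K))
    (d : (Fin n → Fin K) × Finset (Fin n × Fin K) × List (Fin n → Fin K)) :
    MeasurableSet (leaderChoice θ E ⁻¹' {d}) := by
  have hw : ∀ π : Fin n → Fin K, Measurable fun w : Fin n → Fin K → ℝ => weight w π := by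
    intro π
    unfold weight
    fun_prop
  refine measurableSet_preimage_of_factors
    (ι := (Fin n → Fin K) → (Fin n → Fin K) → Bool × Bool)
    (fun w π π' => (decide (weight w π < weight w π'), decide (weight w π - weight w π' ≤ θ)))
    ?_ _ ?_ d
  · intro i
    have : (fun (w : Fin n → Fin K → ℝ) π π' =>
        (decide (weight w π < weight w π'), decide (weight w π - weight w π' ≤ θ))) ⁻¹' {i} =
        ⋂ π, ⋂ π', ({w | decide (weight w π < weight w π') = (i π π').1} ∩
          {w | decide (weight w π - weight w π' ≤ θ) = (i π π').2}) := by
      ext w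
      simp [funext_iff, Prod.ext_iff]
    rw [this]
    refine MeasurableSet.iInter fun π => MeasurableSet.iInter fun π' =>
      MeasurableSet.inter ?_ ?_
    · have h1 : MeasurableSet {w : Fin n → Fin K → ℝ | weight w π < weight w π'} :=
        measurableSet_lt (hw π) (hw π')
      cases (i π π').1
      · simpa only [decide_eq_false_iff_not] using! h1.compl
      · simpa using h1
    · have h1 : MeasurableSet {w : Fin n → Fin K → ℝ | weight w π - weight w π' ≤ θ} :=
        measurableSet_le ((hw π).sub (hw π')) measurable_const
      cases (i π π').2
      · simpa only [decide_eq_false_iff_not] using! h1.compl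
      · simpa using h1
  · intro w w' h
    have h' : ∀ π π', (weight w π < weight w π' ↔ weight w' π < weight w' π') ∧
        (weight w π - weight w π' ≤ θ ↔ weight w' π - weight w' π' ≤ θ) := by
      intro π π'
      have := congrFun (congrFun h π) π'
      simpa using this
    have hb : ∀ Q, bestMatching w Q = bestMatching w' Q :=
      bestMatching_congr fun π π' => (h' π π').1
    unfold leaderChoice
    simp only [hb, (h' _ _).2]

theorem measurable_leaderEstimates {X : Type} [MeasurableSpace X] {N : ℕ} (b : ℕ)
    (as : List (Fin K)) {os : X → List (ℝ × Bool)} (hos : MeasurableObs os) (bits : List Bool) :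
    Measurable fun x => (leaderEstimates b as (os x) bits : Fin (N + 1) → Fin K → ℝ) := by
  refine measurable_pi_lambda _ fun m => measurable_pi_lambda _ fun k => ?_
  refine Fin.cases ?_ (fun m => ?_) m
  · exact MeasurableProg.measurable_empMean hos _ k
  · exact measurable_const

theorem measurableProg_bind_leaderEstimates {X : Type} [MeasurableSpace X] {N : ℕ}
    {p : (Fin (N + 1) → Fin K → ℝ) → Prog K Unit} (hp : MeasurableProg p) (b : ℕ)
    (as l : List (Fin K)) :
    MeasurableProg fun _ : X => (pulls as).bind fun os => (pulls l).bind fun msg =>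
      p (leaderEstimates b as os (msg.map Prod.snd)) := by
  refine MeasurableProg.pulls_bind as (fun _ os => (pulls l).bind fun msg =>
    p (leaderEstimates b as os (msg.map Prod.snd))) fun Z _ φ os _ hos => ?_
  exact MeasurableProg.pulls_bind_bits l (fun z bits => p (leaderEstimates b as (os z) bits))
    fun bits => hp.comp (measurable_leaderEstimates b as hos bits)

theorem measurableProg_leaderLoop [NeZero K] (T c lag N s p : ℕ)
    (E : Finset (Fin (N + 1) × Fin K)) (κ : Fin (N + 1) → Fin K) :
    MeasurableProg fun w => leaderLoop T c lag N s p E w κ := by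
  induction s generalizing p E κ with
  | zero => exact MeasurableProg.ret
  | succ s ih =>
    refine MeasurableProg.cases
      (leaderChoice (4 * ((N + 1 : ℕ) : ℝ) * eps (N + 1) K T c (p - lag)) E)
      (measurableSet_leaderChoice _ E)
      (fun d (_ : Fin (N + 1) → Fin K → ℝ) => leaderEpoch T c lag N s p κ d.1 d.2.1 d.2.2)
      fun d => ?_
    obtain ⟨π₁, E', C⟩ := d
    dsimp only [leaderEpoch]
    apply MeasurableProg.pulls_bind_const
    apply MeasurableProg.pulls_bind_const
    by_cases h1 : C.length = 1
    · simp only [h1, if_true]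
      exact MeasurableProg.pulls_bind_const _ MeasurableProg.ret
    · simp only [h1, if_false]
      exact measurableProg_bind_leaderEstimates (ih (p + 1) E' π₁) _ _ _

theorem measurableProg_followerEpoch [NeZero K] (T c N R s p size : ℕ) (armAt : ℕ → Fin K)
    (h : ∀ own : Fin K, MeasurableProg fun _ : Unit => followerLoop T c N R s (p + 1) own) :
    MeasurableProg fun _ : Unit => followerEpoch T c N R s p size armAt := by
  unfold followerEpoch
  by_cases h1 : size = 1
  · simp only [h1, if_true]
    exact MeasurableProg.pulls_bind_const _ MeasurableProg.ret
  · simp only [h1, if_false]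
    refine MeasurableProg.pulls_bind _ (fun (_ : Unit) os =>
      (pulls (List.replicate ((R - 1) * (K * valueBits c p)) (armAt (size + 1)))).bind fun _ =>
      (pulls (sendArms (armAt (size + 1)) (armAt size) (followerBits (valueBits c p)
        (exploreArms c p ((List.range size).map armAt)) os))).bind fun _ =>
      (pulls (List.replicate ((N - R) * (K * valueBits c p)) (armAt (size + 1)))).bind fun _ =>
        followerLoop T c N R s (p + 1) (armAt (size + 1))) fun Z _ φ os hφ hos => ?_
    refine MeasurableProg.pulls_bind_const _ ?_
    have hq : Measurable fun z => fun k : Fin K =>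
        quantize (valueBits c p) (empMean (exploreArms c p ((List.range size).map armAt))
          (os z) k) :=
      measurable_pi_lambda _ fun k => (MeasurableProg.measurable_quantize _).comp
        (MeasurableProg.measurable_empMean hos _ k)
    -- A follower uses its rewards only through the quantized averages, which take countably many
    -- values. Once they are fixed, so are the arms that transmit them.
    refine MeasurableProg.cases _ (fun i => hq (MeasurableSet.singleton i))
      (fun q (_ : Z) => (pulls (sendArms (armAt (size + 1)) (armAt size)
        ((List.finRange K).flatMap fun k => encode (valueBits c p) (q k)))).bind fun _ =>
      (pulls (List.replicate ((N - R) * (K * valueBits c p)) (armAt (size + 1)))).bind fun _ =>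
        followerLoop T c N R s (p + 1) (armAt (size + 1)))
      fun q => ?_
    exact MeasurableProg.pulls_bind_const _ (MeasurableProg.pulls_bind_const _
      ((h _).comp (measurable_const (a := ()))))

theorem measurableProg_listen_bind (N R len : ℕ) (own : Fin K)
    (g : List Bool → Prog K Unit) (hg : ∀ bits, MeasurableProg fun _ : Unit => g bits) :
    MeasurableProg fun _ : Unit => (listen N R len own).bind g := by
  simp only [listen_bind]
  exact MeasurableProg.pulls_bind_const _ (MeasurableProg.pulls_bind_bits _
    (fun _ bits => (pulls (List.replicate ((N - R) * len) own)).bind fun _ => g bits)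
      fun bits => MeasurableProg.pulls_bind_const _ (hg bits))

theorem measurableProg_followerLoop [NeZero K] (T c N R s p : ℕ) (own : Fin K) :
    MeasurableProg fun _ : Unit => followerLoop T c N R s p own := by
  induction s generalizing p own with
  | zero => exact MeasurableProg.ret
  | succ s ih =>
    simp only [followerLoop_succ]
    exact measurableProg_listen_bind _ _ _ _ _ fun _ => measurableProg_listen_bind _ _ _ _ _
      fun _ => measurableProg_followerEpoch _ _ _ _ _ _ _ _ fun _ => ih _ _

theorem measurableProg_metcElim [NeZero K] (T c lag : ℕ) :
    MeasurableProg fun _ : Unit => metcElim K T c lag := by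
  simp only [metcElim_eq, init_bind]
  refine MeasurableProg.musicalChairs_bind _ _ _ fun o => ?_
  refine MeasurableProg.pulls_bind_bits _ (fun (_ : Unit) b₁ =>
    (pulls ((List.range (K - 1 - (o.getD 0).val)).map
        fun i => Fin.ofNat K ((o.getD 0).val + 1 + i))).bind fun o₂ =>
      (pulls (List.replicate (K - 1 - (o.getD 0).val) 0)).bind fun _ =>
    if b₁.count true = 0 then leader T c lag (b₁.count true + collisions o₂)
    else follower T c (b₁.count true + collisions o₂) (b₁.count true)) fun b₁ => ?_
  refine MeasurableProg.pulls_bind_bits _ (fun (_ : Unit) b₂ =>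
    (pulls (List.replicate (K - 1 - (o.getD 0).val) 0)).bind fun _ =>
    if b₁.count true = 0 then leader T c lag (b₁.count true + b₂.count true)
    else follower T c (b₁.count true + b₂.count true) (b₁.count true)) fun b₂ => ?_
  refine MeasurableProg.pulls_bind_const _ ?_
  by_cases h1 : b₁.count true = 0
  · simp only [h1, if_true]
    exact (measurableProg_leaderLoop T c lag _ T 1 _ _).comp (φ := fun _ : Unit => fun _ _ => 0)
      measurable_const
  · simp only [h1, if_false]
    exact measurableProg_followerLoop T c _ _ T 1 _

end Epochs


/-! ## Independence of the utilities from the past -/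

section Dynamics

variable {M K : ℕ}

theorem measurable_rewards (m : Fin M) :
    Measurable fun z : (Fin M → Fin K → ℝ) × (Fin M → Fin K) => rewards z.1 z.2 m := by
  refine MeasurableProg.measurable_of_cases
    (fun z : (Fin M → Fin K → ℝ) × (Fin M → Fin K) => z.2)
    (fun i => measurable_snd (MeasurableSet.singleton i)) (fun a z => rewards z.1 a m)
    fun a => ?_
  unfold rewards
  fun_prop

theorem measurable_arms_of_forall {Ω : Type*} {m : MeasurableSpace Ω} {f : Ω → Fin M → Fin K}
    (hf : ∀ i, Measurable[m] fun ω => f ω i) : Measurable[m] f :=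
  measurable_pi_iff.2 hf

theorem rewards_mem_Icc {y : Fin M → Fin K → ℝ} (hy : ∀ m k, y m k ∈ Set.Icc (0 : ℝ) 1)
    (a : Fin M → Fin K) (m : Fin M) : rewards y a m ∈ Set.Icc (0 : ℝ) 1 := by
  unfold rewards
  split_ifs
  · simp
  · simpa using hy m (a m)

end Dynamics

namespace Environment

variable {M K : ℕ} {Ω : Type*} [MeasurableSpace Ω] {P : Measure Ω} (B : Environment M K P)

/-- The events that are determined by the rounds before `t`. -/
abbrev past (t : ℕ) : MeasurableSpace Ω :=
  ⨆ s ∈ Set.Iio t, MeasurableSpace.comap (fun ω => (B.Y s ω, B.U s ω)) inferInstance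

/-- The events that are determined by the rounds before `t` and the private draws of round `t`. -/
abbrev history (t : ℕ) : MeasurableSpace Ω :=
  B.past t ⊔ MeasurableSpace.comap (B.U t) inferInstance

theorem measurable_round (t : ℕ) : Measurable fun ω => (B.Y t ω, B.U t ω) :=
  (B.measurable_Y t).prodMk (B.measurable_U t)

theorem past_le (t : ℕ) : B.past t ≤ ‹MeasurableSpace Ω› :=
  iSup₂_le fun s _ => (B.measurable_round s).comap_le

theorem history_le (t : ℕ) : B.history t ≤ ‹MeasurableSpace Ω› :=
  sup_le (B.past_le t) (B.measurable_U t).comap_le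

theorem past_mono {s t : ℕ} (h : s ≤ t) : B.past s ≤ B.past t :=
  biSup_mono fun _ hi => lt_of_lt_of_le hi h

theorem measurable_round_past {s t : ℕ} (h : s < t) :
    Measurable[B.past t] fun ω => (B.Y s ω, B.U s ω) :=
  Measurable.mono (comap_measurable _)
    (le_iSup₂_of_le (f := fun s (_ : s ∈ Set.Iio t) =>
      MeasurableSpace.comap (fun ω => (B.Y s ω, B.U s ω)) inferInstance) s h le_rfl) le_rfl

theorem measurable_Y_past {s t : ℕ} (h : s < t) : Measurable[B.past t] (B.Y s) :=
  measurable_fst.comp (B.measurable_round_past h)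

theorem measurable_U_past {s t : ℕ} (h : s < t) : Measurable[B.past t] (B.U s) :=
  measurable_snd.comp (B.measurable_round_past h)

theorem past_le_history (t : ℕ) : B.past t ≤ B.history t := le_sup_left

theorem history_le_past (t : ℕ) : B.history t ≤ B.past (t + 1) :=
  sup_le (B.past_mono (Nat.le_succ t)) (B.measurable_U_past (Nat.lt_succ_self t)).comap_le

theorem measurable_U_history (t : ℕ) : Measurable[B.history t] (B.U t) :=
  Measurable.mono (comap_measurable _) le_sup_right le_rfl

theorem indep_round_past (t : ℕ) :
    Indep (MeasurableSpace.comap (fun ω => (B.Y t ω, B.U t ω)) inferInstance) (B.past t) P := by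
  have h := indep_iSup_of_disjoint (fun s => (B.measurable_round s).comap_le)
    ((iIndepFun_iff_iIndep _ _ _).1 B.indep_rounds) (S := {t}) (T := Set.Iio t) (by simp)
  simpa [past] using h

/-- The product rule is checked on the π-system of sets `a ∩ b` that generates `mP ⊔ mU`: first `c ∩
b`, an event of `mR`, is separated from `a`, then `c` from `b`. -/
theorem _root_.ProbabilityTheory.Indep.sup_right_of_indep {Ω : Type*}
    {mY mU mR mP mΩ : MeasurableSpace Ω} {μ : Measure Ω} [IsProbabilityMeasure μ]
    (hR : mR ≤ mΩ) (hP : mP ≤ mΩ) (hYR : mY ≤ mR) (hUR : mU ≤ mR) (h1 : Indep mR mP μ)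
    (h2 : Indep mY mU μ) : Indep mY (mP ⊔ mU) μ := by
  rw [Indep_iff] at h1 h2
  let π : Set (Set Ω) := {s | ∃ a b, MeasurableSet[mP] a ∧ MeasurableSet[mU] b ∧ s = a ∩ b}
  have hgen : mP ⊔ mU = MeasurableSpace.generateFrom π := by
    apply le_antisymm
    · refine sup_le (fun a ha => ?_) fun b hb => ?_
      · exact MeasurableSpace.measurableSet_generateFrom
          ⟨a, Set.univ, ha, @MeasurableSet.univ Ω mU, (Set.inter_univ a).symm⟩
      · exact MeasurableSpace.measurableSet_generateFrom
          ⟨Set.univ, b, @MeasurableSet.univ Ω mP, hb, (Set.univ_inter b).symm⟩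
    · refine MeasurableSpace.generateFrom_le ?_
      rintro _ ⟨a, b, ha, hb, rfl⟩
      exact @MeasurableSet.inter Ω (mP ⊔ mU) _ _ (le_sup_left (a := mP) (b := mU) _ ha)
        (le_sup_right (a := mP) (b := mU) _ hb)
  refine IndepSets.indep (p1 := {s | MeasurableSet[mY] s}) (p2 := π)
    (hYR.trans hR) (sup_le hP (hUR.trans hR)) ?_ ?_ ?_ hgen ?_
  · exact @MeasurableSpace.isPiSystem_measurableSet Ω mY
  · rintro _ ⟨a, b, ha, hb, rfl⟩ _ ⟨a', b', ha', hb', rfl⟩ -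
    exact ⟨a ∩ a', b ∩ b', @MeasurableSet.inter Ω mP _ _ ha ha',
      @MeasurableSet.inter Ω mU _ _ hb hb', by ext; simp only [Set.mem_inter_iff]; tauto⟩
  · exact (@MeasurableSpace.generateFrom_measurableSet Ω mY).symm
  · rw [IndepSets_iff]
    rintro c _ hc ⟨a, b, ha, hb, rfl⟩
    have hc' : MeasurableSet[mY] c := hc
    have e1 := h1 (c ∩ b) a (@MeasurableSet.inter Ω mR _ _ (hYR _ hc') (hUR _ hb)) ha
    have e2 := h1 b a (hUR _ hb) ha
    have e3 := h2 c b hc' hb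
    rw [show c ∩ (a ∩ b) = c ∩ b ∩ a by ext; simp only [Set.mem_inter_iff]; tauto, e1, e3,
      Set.inter_comm a b, e2, mul_assoc]

/-- The utilities of a round are independent of the previous rounds and of the private draws. -/
theorem indep_Y_history [IsProbabilityMeasure P] (t : ℕ) :
    Indep (MeasurableSpace.comap (B.Y t) inferInstance) (B.history t) P :=
  Indep.sup_right_of_indep (B.measurable_round t).comap_le (B.past_le t)
    (measurable_fst.comp (comap_measurable fun ω => (B.Y t ω, B.U t ω))).comap_le
    (measurable_snd.comp (comap_measurable fun ω => (B.Y t ω, B.U t ω))).comap_le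
    (B.indep_round_past t) (B.indep_Y_U t)

section Arms

variable [NeZero K] {prog : Prog K Unit}

/-- Programs carry no σ-algebra, so the measurability of a state is expressed by a factorization
through a parameter determined by the past. A round adds the draw, the reward and the collision
indicator to this parameter. -/
theorem exists_measurableProg (hprog : MeasurableProg fun _ : Unit => prog) (t : ℕ) (m : Fin M) :
    ∃ (X : Type) (_ : MeasurableSpace X) (p : X → Prog K Unit) (x : Ω → X),
      MeasurableProg p ∧ Measurable[B.past t] x ∧
      ∀ ω, programs prog (fun s => B.Y s ω) (fun s => B.U s ω) t m = p (x ω) := by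
  induction t generalizing m with
  | zero => exact ⟨Unit, inferInstance, _, fun _ => (), hprog, measurable_const, fun ω => rfl⟩
  | succ t ih =>
    choose X mX p x hp hx hpx using ih
    have ha : ∀ m', Measurable[B.past (t + 1)]
        fun ω => (p m' (x m' ω)).arm (B.U t ω m') := fun m' =>
      (hp m').measurable_arm.comp (((hx m').mono (B.past_mono (Nat.le_succ t)) le_rfl).prodMk
        ((measurable_pi_apply m').comp (B.measurable_U_past (Nat.lt_succ_self t))))
    have ha' : Measurable[B.past (t + 1)]
        fun ω => fun m' => (p m' (x m' ω)).arm (B.U t ω m') := measurable_arms_of_forall ha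
    have hr : Measurable[B.past (t + 1)] fun ω =>
        rewards (B.Y t ω) (fun m' => (p m' (x m' ω)).arm (B.U t ω m')) m :=
      (measurable_rewards m).comp ((B.measurable_Y_past (Nat.lt_succ_self t)).prodMk ha')
    have hc : Measurable[B.past (t + 1)] fun ω =>
        collides (fun m' => (p m' (x m' ω)).arm (B.U t ω m')) m :=
      (measurable_of_countable fun a : Fin M → Fin K => collides a m).comp ha'
    refine ⟨X m × Fin K × ℝ × Bool, inferInstance, _, fun ω => (x m ω, B.U t ω m,
      rewards (B.Y t ω) (fun m' => (p m' (x m' ω)).arm (B.U t ω m')) m,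
      collides (fun m' => (p m' (x m' ω)).arm (B.U t ω m')) m), (hp m).step, ?_, ?_⟩
    · exact ((hx m).mono (B.past_mono (Nat.le_succ t)) le_rfl).prodMk
        (((measurable_pi_apply m).comp (B.measurable_U_past (Nat.lt_succ_self t))).prodMk
          (hr.prodMk hc))
    · intro ω
      rw [programs]
      simp only [hpx]

/-- The arms pulled in round `t`. -/
def armsAt (prog : Prog K Unit) (t : ℕ) (ω : Ω) : Fin M → Fin K :=
  arms prog (fun s => B.Y s ω) (fun s => B.U s ω) t

theorem measurable_armsAt (hprog : MeasurableProg fun _ : Unit => prog) (t : ℕ) :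
    Measurable[B.history t] (B.armsAt prog t) := by
  refine measurable_arms_of_forall fun m => ?_
  obtain ⟨X, mX, p, x, hp, hx, hpx⟩ := B.exists_measurableProg hprog t m
  have : (fun ω => B.armsAt prog t ω m) = fun ω => (p (x ω)).arm (B.U t ω m) := by
    funext ω
    simp [armsAt, arms, hpx]
  rw [this]
  exact hp.measurable_arm.comp ((hx.mono (B.past_le_history t) le_rfl).prodMk
    ((measurable_pi_apply m).comp (B.measurable_U_history t)))

theorem measurable_armsAt' (hprog : MeasurableProg fun _ : Unit => prog) (t : ℕ) :
    Measurable (B.armsAt prog t) :=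
  (B.measurable_armsAt hprog t).mono (B.history_le t) le_rfl

end Arms

theorem measurable_utility (t : ℕ) (m : Fin M) (k : Fin K) : Measurable fun ω => B.Y t ω m k :=
  (measurable_pi_apply k).comp ((measurable_pi_apply m).comp (B.measurable_Y t))

theorem integrable_utility [IsProbabilityMeasure P] (t : ℕ) (m : Fin M) (k : Fin K) :
    Integrable (fun ω => B.Y t ω m k) P :=
  Integrable.of_mem_Icc 0 1 (B.measurable_utility t m k).aemeasurable
    (ae_of_all _ fun ω => B.mem_Icc t ω m k)

theorem integral_utility (t : ℕ) (m : Fin M) (k : Fin K) :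
    ∫ ω, B.Y t ω m k ∂P = B.mean m k :=
  (B.identDistrib t m k).integral_eq

theorem mean_mem_Icc [IsProbabilityMeasure P] (m : Fin M) (k : Fin K) :
    B.mean m k ∈ Set.Icc (0 : ℝ) 1 := by
  constructor
  · exact integral_nonneg fun ω => (B.mem_Icc 0 ω m k).1
  · have := integral_mono (B.integrable_utility 0 m k) (integrable_const (1 : ℝ))
      fun ω => (B.mem_Icc 0 ω m k).2
    simpa [mean] using this

/-- Utilities may be replaced by their means in front of an event of the past. -/
theorem integral_utility_mul [IsProbabilityMeasure P] (t : ℕ) (m : Fin M) (k : Fin K)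
    {f : Ω → ℝ} (hf : Measurable[B.history t] f) :
    ∫ ω, B.Y t ω m k * f ω ∂P = B.mean m k * ∫ ω, f ω ∂P := by
  have hind : IndepFun (fun ω => B.Y t ω m k) f P := by
    rw [IndepFun_iff_Indep]
    refine indep_of_indep_of_le (B.indep_Y_history t) ?_ hf.comap_le
    exact ((measurable_pi_apply k).comp ((measurable_pi_apply m).comp
      (comap_measurable (B.Y t)))).comap_le
  rw [hind.integral_fun_mul_eq_mul_integral (B.measurable_utility t m k).aestronglyMeasurable
    (hf.mono (B.history_le t) le_rfl).aestronglyMeasurable, B.integral_utility]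

end Environment

/-- The expected reward of player `m` when the players pull the arms `a`. -/
noncomputable def meanReward {M K : ℕ} (μ : Fin M → Fin K → ℝ) (a : Fin M → Fin K) : ℝ :=
  ∑ m, rewards μ a m

namespace Environment

variable {M K : ℕ} {Ω : Type*} [MeasurableSpace Ω] {P : Measure Ω} (B : Environment M K P)

/-- Decompose according to the arm obtained: the indicator that the player pulls `k` without
collision belongs to the history, of which the utility of `k` in this round is independent. -/
theorem integral_rewards [NeZero K] [IsProbabilityMeasure P] {prog : Prog K Unit}
    (hprog : MeasurableProg fun _ : Unit => prog) (t : ℕ) (m : Fin M) :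
    ∫ ω, rewards (B.Y t ω) (B.armsAt prog t ω) m ∂P =
      ∫ ω, rewards B.mean (B.armsAt prog t ω) m ∂P := by
  have hind : ∀ k, Measurable[B.history t] fun ω =>
      if B.armsAt prog t ω m = k ∧ collides (B.armsAt prog t ω) m = false then (1 : ℝ) else 0 :=
    fun k => (measurable_of_countable fun a : Fin M → Fin K =>
      if a m = k ∧ collides a m = false then (1 : ℝ) else 0).comp (B.measurable_armsAt hprog t)
  have hexp : ∀ (y : Fin M → Fin K → ℝ) (a : Fin M → Fin K), rewards y a m =
      ∑ k, y m k * if a m = k ∧ collides a m = false then (1 : ℝ) else 0 := by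
    intro y a
    rw [Finset.sum_eq_single (a m)]
    · unfold rewards
      cases collides a m <;> simp
    · intro k _ hk
      simp [Ne.symm hk]
    · simp
  have hint : ∀ k, Integrable (fun ω =>
      if B.armsAt prog t ω m = k ∧ collides (B.armsAt prog t ω) m = false
        then (1 : ℝ) else 0) P := fun k =>
    Integrable.of_mem_Icc 0 1 ((hind k).mono (B.history_le t) le_rfl).aemeasurable
      (ae_of_all _ fun ω => by split_ifs <;> simp)
  simp only [hexp]
  rw [integral_finsetSum _ fun k _ => ?_, integral_finsetSum _ fun k _ => (hint k).const_mul _]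
  · refine Finset.sum_congr rfl fun k _ => ?_
    rw [B.integral_utility_mul t m k (hind k), integral_const_mul]
  · exact Integrable.of_mem_Icc 0 1 ((B.measurable_utility t m k).mul
      ((hind k).mono (B.history_le t) le_rfl)).aemeasurable
      (ae_of_all _ fun ω => by
        have := B.mem_Icc t ω m k
        split_ifs <;> simp_all)

/-- The regret is the expectation of the pseudo-regret. -/
theorem regret_eq [NeZero K] [IsProbabilityMeasure P] {prog : Prog K Unit}
    (hprog : MeasurableProg fun _ : Unit => prog) (T : ℕ) :
    B.regret prog T = ∫ ω, ∑ t ∈ Finset.range T,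
      (B.maxUtility - meanReward B.mean (B.armsAt prog t ω)) ∂P := by
  have hm : ∀ t, Measurable (B.armsAt prog t) := B.measurable_armsAt' hprog
  have hi1 : ∀ t m, Integrable (fun ω => rewards (B.Y t ω) (B.armsAt prog t ω) m) P := fun t m =>
    Integrable.of_mem_Icc 0 1 ((measurable_rewards m).comp
      ((B.measurable_Y t).prodMk (hm t))).aemeasurable
      (ae_of_all _ fun ω => rewards_mem_Icc (B.mem_Icc t ω) _ _)
  have hi2 : ∀ t m, Integrable (fun ω => rewards B.mean (B.armsAt prog t ω) m) P := fun t m =>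
    Integrable.of_mem_Icc 0 1 ((measurable_rewards m).comp
      ((measurable_const (a := B.mean)).prodMk (hm t))).aemeasurable
      (ae_of_all _ fun ω => rewards_mem_Icc B.mean_mem_Icc _ _)
  have h1 : ∫ ω, ∑ t ∈ Finset.range T, ∑ m,
      rewards (B.Y t ω) (arms prog (fun s => B.Y s ω) (fun s => B.U s ω) t) m ∂P =
      ∑ t ∈ Finset.range T, ∑ m, ∫ ω, rewards B.mean (B.armsAt prog t ω) m ∂P := by
    change ∫ ω, ∑ t ∈ Finset.range T, ∑ m, rewards (B.Y t ω) (B.armsAt prog t ω) m ∂P = _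
    rw [integral_finsetSum _ fun t _ => integrable_finsetSum _ fun m _ => hi1 t m]
    refine Finset.sum_congr rfl fun t _ => ?_
    rw [integral_finsetSum _ fun m _ => hi1 t m]
    exact Finset.sum_congr rfl fun m _ => B.integral_rewards hprog t m
  unfold regret meanReward
  have h2 : ∀ t ∈ Finset.range T, ∫ ω, (B.maxUtility -
      ∑ m, rewards B.mean (B.armsAt prog t ω) m) ∂P =
      B.maxUtility - ∑ m, ∫ ω, rewards B.mean (B.armsAt prog t ω) m ∂P := by
    intro t _
    rw [integral_sub (integrable_const _) (integrable_finsetSum _ fun m _ => hi2 t m),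
      integral_finsetSum _ fun m _ => hi2 t m]
    simp
  have h3 : ∀ t ∈ Finset.range T, Integrable (fun ω => B.maxUtility -
      ∑ m, rewards B.mean (B.armsAt prog t ω) m) P := fun t _ =>
    (integrable_const _).sub (integrable_finsetSum _ fun m _ => hi2 t m)
  rw [h1, integral_finsetSum _ h3, Finset.sum_congr rfl h2]
  simp [Finset.sum_sub_distrib]

end Environment


/-! ## Concentration -/

namespace Environment

variable {M K : ℕ} {Ω : Type*} [MeasurableSpace Ω] {P : Measure Ω} (B : Environment M K P)

/-- Hoeffding's lemma: a variable in `[0, 1]` is sub-Gaussian with variance proxy `1 / 4`, which is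
compensated by `l ^ 2 / 8`. -/
theorem lintegral_exp_utility_le [IsProbabilityMeasure P] (t : ℕ) (m : Fin M) (k : Fin K)
    (l : ℝ) : ∫⁻ ω, ENNReal.ofReal (Real.exp (l * (B.Y t ω m k - B.mean m k) - l ^ 2 / 8)) ∂P
      ≤ 1 := by
  have h := hasSubgaussianMGF_of_mem_Icc (μ := P) (X := fun ω => B.Y t ω m k) (a := 0) (b := 1)
    (B.measurable_utility t m k).aemeasurable (ae_of_all _ fun ω => B.mem_Icc t ω m k)
  rw [B.integral_utility] at h
  have h1 := h.mgf_le l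
  have h2 := h.integrable_exp_mul l
  have heq : ∀ ω, Real.exp (l * (B.Y t ω m k - B.mean m k) - l ^ 2 / 8) =
      Real.exp (-(l ^ 2 / 8)) * Real.exp (l * (B.Y t ω m k - B.mean m k)) := by
    intro ω
    rw [← Real.exp_add]
    ring_nf
  simp only [heq]
  rw [← ofReal_integral_eq_lintegral_ofReal (h2.const_mul _)
    (ae_of_all _ fun ω => by positivity), integral_const_mul]
  rw [ENNReal.ofReal_le_one]
  calc Real.exp (-(l ^ 2 / 8)) * ∫ ω, Real.exp (l * (B.Y t ω m k - B.mean m k)) ∂P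
      ≤ Real.exp (-(l ^ 2 / 8)) * Real.exp (l ^ 2 / 8) := by
        refine mul_le_mul_of_nonneg_left (h1.trans (le_of_eq ?_)) (Real.exp_pos _).le
        congr 1
        simp
        ring
    _ = 1 := by rw [← Real.exp_add]; simp

section

variable [NeZero K] {prog : Prog K Unit}

/-- The products form a supermartingale: whether `k` is pulled is decided by the history, and the
new factor, independent of it, has mean at most `1`. The random number of pulls in the window is
thereby taken into account. Measurability is part of the claim because the induction uses it. -/
theorem lintegral_prod_exp_le [IsProbabilityMeasure P]
    (hprog : MeasurableProg fun _ : Unit => prog) (t n : ℕ) (m : Fin M) (k : Fin K) (l : ℝ) :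
    (Measurable[B.past (t + n)] fun ω => ∏ s ∈ Finset.Ico t (t + n),
      (if B.armsAt prog s ω m = k then
        ENNReal.ofReal (Real.exp (l * (B.Y s ω m k - B.mean m k) - l ^ 2 / 8)) else 1)) ∧
    ∫⁻ ω, ∏ s ∈ Finset.Ico t (t + n), (if B.armsAt prog s ω m = k then
        ENNReal.ofReal (Real.exp (l * (B.Y s ω m k - B.mean m k) - l ^ 2 / 8)) else 1) ∂P ≤ 1 := by
  induction n with
  | zero => simp
  | succ n ih =>
    obtain ⟨ih1, ih2⟩ := ih
    set Z : Ω → ℝ≥0∞ := fun ω => ∏ s ∈ Finset.Ico t (t + n), (if B.armsAt prog s ω m = k then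
        ENNReal.ofReal (Real.exp (l * (B.Y s ω m k - B.mean m k) - l ^ 2 / 8)) else 1) with hZ
    set g : Ω → ℝ≥0∞ := fun ω =>
      ENNReal.ofReal (Real.exp (l * (B.Y (t + n) ω m k - B.mean m k) - l ^ 2 / 8)) with hg
    have hZs : ∀ ω, ∏ s ∈ Finset.Ico t (t + (n + 1)), (if B.armsAt prog s ω m = k then
        ENNReal.ofReal (Real.exp (l * (B.Y s ω m k - B.mean m k) - l ^ 2 / 8)) else 1) =
        Z ω * if B.armsAt prog (t + n) ω m = k then g ω else 1 := fun ω =>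
      Finset.prod_Ico_succ_top (Nat.le_add_right t n) _
    simp only [hZs]
    have hgy : Measurable fun y : Fin M → Fin K → ℝ =>
        ENNReal.ofReal (Real.exp (l * (y m k - B.mean m k) - l ^ 2 / 8)) := by fun_prop
    have harm : MeasurableSet[B.history (t + n)] {ω | B.armsAt prog (t + n) ω m = k} :=
      (B.measurable_armsAt hprog (t + n)) (measurableSet_preimage (measurable_pi_apply m)
        (MeasurableSet.singleton k))
    have harm' := B.history_le_past (t + n) _ harm
    have hZh : Measurable[B.history (t + n)] Z := ih1.mono (B.past_le_history _) le_rfl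
    have hI : ∀ (J : Set Ω) {mJ : MeasurableSpace Ω}, MeasurableSet[mJ] J →
        Measurable[mJ] (J.indicator (fun _ => (1 : ℝ≥0∞))) := fun J mJ hJ =>
      measurable_const.indicator hJ
    constructor
    · refine (ih1.mono (B.past_mono (by omega)) le_rfl).mul ?_
      exact Measurable.ite harm' (hgy.comp (B.measurable_Y_past (Nat.lt_succ_self _)))
        measurable_const
    · set J : Set Ω := {ω | B.armsAt prog (t + n) ω m = k} with hJ
      -- On `J` the arm `k` is pulled and `g` factors out by independence; off `J` the product does
      -- not change.
      have hdec : ∀ ω, (Z ω * if B.armsAt prog (t + n) ω m = k then g ω else 1) =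
          g ω * (Z ω * J.indicator (fun _ => 1) ω) + Z ω * Jᶜ.indicator (fun _ => 1) ω := by
        intro ω
        by_cases h : ω ∈ J
        · have h' : B.armsAt prog (t + n) ω m = k := h
          simp [h, h', mul_comm]
        · have h' : ¬ B.armsAt prog (t + n) ω m = k := h
          simp [h, h']
      have hm1 : Measurable[B.history (t + n)] fun ω => Z ω * J.indicator (fun _ => 1) ω :=
        hZh.mul (hI J harm)
      have hgm : Measurable[MeasurableSpace.comap (B.Y (t + n)) inferInstance] g :=
        hgy.comp (comap_measurable _)
      simp only [hdec]
      rw [lintegral_add_left (f := fun ω => g ω * (Z ω * J.indicator (fun _ => 1) ω)) ((hgm.mono (B.measurable_Y _).comap_le le_rfl).mul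
          (hm1.mono (B.history_le _) le_rfl)),
        lintegral_mul_eq_lintegral_mul_lintegral_of_independent_measurableSpace
          (B.measurable_Y _).comap_le (B.history_le _) (B.indep_Y_history (t + n)) hgm hm1]
      calc (∫⁻ ω, g ω ∂P) * (∫⁻ ω, Z ω * J.indicator (fun _ => 1) ω ∂P) +
            ∫⁻ ω, Z ω * Jᶜ.indicator (fun _ => 1) ω ∂P
          ≤ 1 * (∫⁻ ω, Z ω * J.indicator (fun _ => 1) ω ∂P) +
            ∫⁻ ω, Z ω * Jᶜ.indicator (fun _ => 1) ω ∂P := by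
            gcongr
            exact B.lintegral_exp_utility_le (t + n) m k l
        _ = ∫⁻ ω, Z ω ∂P := by
            rw [one_mul, ← lintegral_add_left (hm1.mono (B.history_le _) le_rfl)]
            refine lintegral_congr fun ω => ?_
            by_cases h : ω ∈ J <;> simp [h]
        _ ≤ 1 := ih2

/-- Chernoff's method with `l = ± 4 ε`, for which `l ^ 2 / 8 = 2 ε ^ 2`. With `n'` pulls the
exponent is at least `n' (4 ε ^ 2 - 2 ε ^ 2)`. This grows with `n'`, so a lower bound `n₀` on the
random number of pulls suffices for Markov's inequality. -/
theorem measure_deviation_le_aux [IsProbabilityMeasure P]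
    (hprog : MeasurableProg fun _ : Unit => prog) (t n n₀ : ℕ) (m : Fin M) (k : Fin K)
    {ε : ℝ} (l : ℝ) (hl : l ^ 2 = (4 * ε) ^ 2) :
    P {ω | n₀ ≤ ((Finset.Ico t (t + n)).filter fun s => B.armsAt prog s ω m = k).card ∧
      (((Finset.Ico t (t + n)).filter fun s => B.armsAt prog s ω m = k).card : ℝ) * (4 * ε ^ 2) ≤
        l * ∑ s ∈ (Finset.Ico t (t + n)).filter fun s => B.armsAt prog s ω m = k,
          (B.Y s ω m k - B.mean m k)} ≤ ENNReal.ofReal (Real.exp (-(2 * n₀ * ε ^ 2))) := by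
  obtain ⟨h1, h2⟩ := B.lintegral_prod_exp_le hprog t n m k l
  set Z : Ω → ℝ≥0∞ := fun ω => ∏ s ∈ Finset.Ico t (t + n), (if B.armsAt prog s ω m = k then
        ENNReal.ofReal (Real.exp (l * (B.Y s ω m k - B.mean m k) - l ^ 2 / 8)) else 1) with hZ
  have hmark := meas_ge_le_lintegral_div (μ := P) (f := Z)
    (h1.mono (B.past_le _) le_rfl).aemeasurable
    (ε := ENNReal.ofReal (Real.exp (2 * n₀ * ε ^ 2)))
    (by simp [Real.exp_pos]) ENNReal.ofReal_ne_top
  calc P _ ≤ P {ω | ENNReal.ofReal (Real.exp (2 * n₀ * ε ^ 2)) ≤ Z ω} := by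
        refine measure_mono fun ω hω => ?_
        obtain ⟨hn, hd⟩ := hω
        set S := (Finset.Ico t (t + n)).filter fun s => B.armsAt prog s ω m = k with hS
        have hZω : Z ω = ENNReal.ofReal (Real.exp (∑ s ∈ S,
            (l * (B.Y s ω m k - B.mean m k) - l ^ 2 / 8))) := by
          rw [Real.exp_sum, ENNReal.ofReal_prod_of_nonneg fun _ _ => (Real.exp_pos _).le, hS,
            Finset.prod_filter]
        change _ ≤ Z ω
        rw [hZω]
        refine ENNReal.ofReal_le_ofReal (Real.exp_le_exp.2 ?_)
        rw [Finset.sum_sub_distrib, ← Finset.mul_sum, Finset.sum_const, nsmul_eq_mul, hl]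
        have hn' : (n₀ : ℝ) ≤ S.card := by exact_mod_cast hn
        nlinarith [mul_le_mul_of_nonneg_right hn' (sq_nonneg ε)]
    _ ≤ (∫⁻ ω, Z ω ∂P) / ENNReal.ofReal (Real.exp (2 * n₀ * ε ^ 2)) := hmark
    _ ≤ 1 / ENNReal.ofReal (Real.exp (2 * n₀ * ε ^ 2)) := by gcongr
    _ = ENNReal.ofReal (Real.exp (-(2 * n₀ * ε ^ 2))) := by
        rw [one_div, Real.exp_neg, ENNReal.ofReal_inv_of_pos (Real.exp_pos _)]

theorem measure_deviation_le [IsProbabilityMeasure P]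
    (hprog : MeasurableProg fun _ : Unit => prog) (t n n₀ : ℕ) (m : Fin M) (k : Fin K)
    {ε : ℝ} (hε : 0 ≤ ε) :
    P {ω | n₀ ≤ ((Finset.Ico t (t + n)).filter fun s => B.armsAt prog s ω m = k).card ∧
      (((Finset.Ico t (t + n)).filter fun s => B.armsAt prog s ω m = k).card : ℝ) * ε <
        |∑ s ∈ (Finset.Ico t (t + n)).filter fun s => B.armsAt prog s ω m = k,
          (B.Y s ω m k - B.mean m k)|} ≤
      2 * ENNReal.ofReal (Real.exp (-(2 * n₀ * ε ^ 2))) := by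
  rw [two_mul]
  refine le_trans (measure_mono ?_) ((measure_union_le _ _).trans (add_le_add
    (B.measure_deviation_le_aux hprog t n n₀ m k (4 * ε) rfl)
    (B.measure_deviation_le_aux hprog t n n₀ m k (-(4 * ε)) (by ring))))
  rintro ω ⟨hn, hd⟩
  rcases lt_abs.1 hd with h | h
  · left
    exact ⟨hn, by nlinarith [mul_le_mul_of_nonneg_left h.le (mul_nonneg zero_le_four hε)]⟩
  · right
    exact ⟨hn, by nlinarith [mul_le_mul_of_nonneg_left h.le (mul_nonneg zero_le_four hε)]⟩

end

end Environment

/-- In every window of `L * 2 ^ p ^ c` rounds, every arm that a player has pulled at least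
`2 ^ p ^ c` times is estimated by this player with precision `ε p`. -/
def WellEstimated {M K : ℕ} (μ : Fin M → Fin K → ℝ) (ε : ℕ → ℝ) (c T : ℕ)
    (y : ℕ → Fin M → Fin K → ℝ) (a : ℕ → Fin M → Fin K) : Prop :=
  ∀ p t L m k, 1 ≤ p → 1 ≤ L → L ≤ M * K → t + L * 2 ^ p ^ c ≤ T →
    2 ^ p ^ c ≤ ((Finset.Ico t (t + L * 2 ^ p ^ c)).filter fun s => a s m = k).card →
    |∑ s ∈ (Finset.Ico t (t + L * 2 ^ p ^ c)).filter fun s => a s m = k, (y s m k - μ m k)| ≤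
      ((Finset.Ico t (t + L * 2 ^ p ^ c)).filter fun s => a s m = k).card * ε p

namespace Environment

variable {M K : ℕ} {Ω : Type*} [MeasurableSpace Ω] {P : Measure Ω} (B : Environment M K P)

/-- The start and the length of an actual exploration are random, so the union bound runs over all
their possible values. Only `p ≤ Nat.log 2 T` matters, as `2 ^ p ≤ 2 ^ p ^ c ≤ T`. -/
theorem measure_not_wellEstimated_le [NeZero K] {prog : Prog K Unit} [IsProbabilityMeasure P]
    (hprog : MeasurableProg fun _ : Unit => prog) {ε : ℕ → ℝ} (hε : ∀ p, 0 ≤ ε p) {c T : ℕ}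
    (hc : 1 ≤ c) {d : ℝ}
    (h : ∀ p, 2 * Real.exp (-(2 * (2 ^ p ^ c : ℕ) * ε p ^ 2)) ≤ d) :
    P {ω | ¬ WellEstimated B.mean ε c T (fun s => B.Y s ω) fun s => B.armsAt prog s ω} ≤
      ENNReal.ofReal (Nat.log 2 T * T * (M * K) * (M * K) * d) := by
  let I : Finset (ℕ × ℕ × ℕ × Fin M × Fin K) :=
    Finset.Icc 1 (Nat.log 2 T) ×ˢ Finset.range T ×ˢ Finset.Icc 1 (M * K) ×ˢ Finset.univ
  have hI : (I.card : ℝ) = Nat.log 2 T * T * (M * K) * (M * K) := by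
    simp only [I, Finset.card_product, Nat.card_Icc, Finset.card_range, Finset.card_univ,
      Fintype.card_prod, Fintype.card_fin]
    push_cast
    ring
  let D : ℕ × ℕ × ℕ × Fin M × Fin K → Set Ω := fun i =>
    {ω | 2 ^ i.1 ^ c ≤ ((Finset.Ico i.2.1 (i.2.1 + i.2.2.1 * 2 ^ i.1 ^ c)).filter
        fun s => B.armsAt prog s ω i.2.2.2.1 = i.2.2.2.2).card ∧
      (((Finset.Ico i.2.1 (i.2.1 + i.2.2.1 * 2 ^ i.1 ^ c)).filter
        fun s => B.armsAt prog s ω i.2.2.2.1 = i.2.2.2.2).card : ℝ) * ε i.1 <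
        |∑ s ∈ (Finset.Ico i.2.1 (i.2.1 + i.2.2.1 * 2 ^ i.1 ^ c)).filter
          fun s => B.armsAt prog s ω i.2.2.2.1 = i.2.2.2.2,
          (B.Y s ω i.2.2.2.1 i.2.2.2.2 - B.mean i.2.2.2.1 i.2.2.2.2)|}
  have hsub : {ω | ¬ WellEstimated B.mean ε c T (fun s => B.Y s ω)
      fun s => B.armsAt prog s ω} ⊆ ⋃ i ∈ I, D i := by
    intro ω hω
    have hω' : ¬ WellEstimated B.mean ε c T (fun s => B.Y s ω) fun s => B.armsAt prog s ω := hω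
    unfold WellEstimated at hω'
    push Not at hω'
    obtain ⟨p, t, L, m, k, hp, hL, hLM, hT, hn, hdev⟩ := hω'
    simp only [Set.mem_iUnion]
    have h1 : 2 ^ p ^ c ≤ L * 2 ^ p ^ c := Nat.le_mul_of_pos_left _ hL
    have h2 : 0 < 2 ^ p ^ c := Nat.two_pow_pos _
    have hp' : p ≤ Nat.log 2 T := by
      refine (Nat.le_self_pow (Nat.one_le_iff_ne_zero.1 hc) p).trans ?_
      exact Nat.le_log_of_pow_le (by norm_num) (h1.trans ((Nat.le_add_left _ _).trans hT))
    refine ⟨(p, t, L, m, k), ?_, hn, hdev⟩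
    simp only [I, Finset.mem_product, Finset.mem_Icc, Finset.mem_range, Finset.mem_univ, and_true]
    refine ⟨⟨hp, hp'⟩, (?_ : t < T), hL, hLM⟩
    omega
  calc _ ≤ P (⋃ i ∈ I, D i) := measure_mono hsub
    _ ≤ ∑ i ∈ I, P (D i) := measure_biUnion_finset_le _ _
    _ ≤ ∑ i ∈ I, ENNReal.ofReal d := by
        refine Finset.sum_le_sum fun i _ => ?_
        refine (B.measure_deviation_le hprog i.2.1 (i.2.2.1 * 2 ^ i.1 ^ c) (2 ^ i.1 ^ c)
          i.2.2.2.1 i.2.2.2.2 (hε i.1)).trans ?_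
        have h2 : (2 : ℝ≥0∞) = ENNReal.ofReal 2 := by simp
        rw [h2, ← ENNReal.ofReal_mul (by norm_num)]
        exact ENNReal.ofReal_le_ofReal (h i.1)
    _ = ENNReal.ofReal (Nat.log 2 T * T * (M * K) * (M * K) * d) := by
        rw [Finset.sum_const, nsmul_eq_mul, ← hI, ENNReal.ofReal_mul (by positivity),
          ENNReal.ofReal_natCast]

end Environment


/-! ## Initialization -/

section Chairs

variable {M K : ℕ}

/-- One round of musical chairs: `o m` is the arm occupied by player `m`, if any. -/
def chairsStep (o : Fin M → Option (Fin K)) (a : Fin M → Fin K) (m : Fin M) : Option (Fin K) :=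
  match o m with
  | some k => some k
  | none => if collides (fun m' => (o m').getD (a m')) m then none else some (a m)

/-- The arms occupied after the given number of rounds of musical chairs. -/
def chairs (u : ℕ → Fin M → Fin K) : ℕ → Fin M → Option (Fin K)
  | 0 => fun _ => none
  | s + 1 => chairsStep (chairs u s) (u s)

theorem chairsStep_of_some {o : Fin M → Option (Fin K)} {m : Fin M} {k : Fin K}
    (h : o m = some k) (a : Fin M → Fin K) : chairsStep o a m = some k := by
  simp [chairsStep, h]

theorem chairsStep_of_none {o : Fin M → Option (Fin K)} {m : Fin M}
    (h : o m = none) (a : Fin M → Fin K) : chairsStep o a m =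
      if collides (fun m' => (o m').getD (a m')) m then none else some (a m) := by
  simp [chairsStep, h]

/-- A player settles only without collision, and collisions with settled players count as well: `b`
records the arms pulled by everybody in the round. -/
theorem chairs_injective (u : ℕ → Fin M → Fin K) (s : ℕ) {m m' : Fin M} {k : Fin K}
    (h : chairs u s m = some k) (h' : chairs u s m' = some k) : m = m' := by
  by_contra hne
  induction s generalizing k m m' with
  | zero => simp [chairs] at h
  | succ s ih =>
    set b := fun m' => (chairs u s m').getD (u s m') with hb
    have key : ∀ m k, chairs u (s + 1) m = some k → b m = k ∧
        (chairs u s m = none → collides b m = false) := by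
      intro m k hm
      rw [chairs] at hm
      cases ho : chairs u s m with
      | some k' =>
        rw [chairsStep_of_some ho] at hm
        simp only [Option.some.injEq] at hm
        simp [hb, ho, hm]
      | none =>
        rw [chairsStep_of_none ho] at hm
        change (if collides b m = true then none else some (u s m)) = some k at hm
        cases hcb : collides b m with
        | true => simp [hcb] at hm
        | false =>
          simp only [hcb, Bool.false_eq_true, if_false, Option.some.injEq] at hm
          simp [hb, ho, hm]
    have hcol : ∀ m m', m ≠ m' → b m = b m' → collides b m = true := by
      intro m m' hmm hbb
      simp only [collides, decide_eq_true_eq]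
      exact ⟨m', hmm.symm, hbb.symm⟩
    obtain ⟨e1, f1⟩ := key m k h
    obtain ⟨e2, f2⟩ := key m' k h'
    have c1 := hcol m m' hne (e1.trans e2.symm)
    have c2 := hcol m' m (Ne.symm hne) (e2.trans e1.symm)
    cases ho : chairs u s m with
    | none => simp [f1 ho] at c1
    | some k1 =>
      cases ho' : chairs u s m' with
      | none => simp [f2 ho'] at c2
      | some k2 =>
        have h1 : k1 = k := by simpa [hb, ho] using e1
        have h2 : k2 = k := by simpa [hb, ho'] using e2
        subst h1 h2
        exact ih ho ho' hne

theorem IsRun.chairs [NeZero K] {y : ℕ → Fin M → Fin K → ℝ} {u : ℕ → Fin M → Fin K}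
    {Q : ℕ → Fin M → Prog K Unit} (h : IsRun y u Q) (n : ℕ)
    (g : Option (Fin K) → Prog K Unit) (hQ : ∀ m, Q 0 m = (musicalChairs n none).bind g)
    {s : ℕ} (hs : s ≤ n) (m : Fin M) :
    Q s m = (musicalChairs (n - s) (chairs u s m)).bind g := by
  induction s generalizing m with
  | zero => exact hQ m
  | succ s ih =>
    have ih' := fun m => ih (by omega) m
    have hn : n - s = (n - (s + 1)) + 1 := by omega
    have ha : ∀ m', (Q s m').arm (u s m') =
        (MultiplayerBandit.chairs u s m').getD (u s m') := by
      intro m'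
      rw [ih' m', hn]
      cases MultiplayerBandit.chairs u s m' <;> rfl
    rw [h s m]
    simp only [ha]
    rw [ih' m, hn, MultiplayerBandit.chairs]
    cases ho : MultiplayerBandit.chairs u s m with
    | some k => rw [chairsStep_of_some ho]; rfl
    | none => rw [chairsStep_of_none ho]; rfl

/-- Since `M ≤ K`, the other players leave some arm free. Moving `m` to a free arm and remembering
its original draw injects all draws into pairs of a draw without collision for `m` and an arm. Hence
at least a fraction `1 / K` of the draws is good for `m`. -/
theorem card_collides_le (hMK : M ≤ K) {o : Fin M → Option (Fin K)} {m : Fin M}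
    (ho : o m = none) :
    K ^ M ≤ K * (Finset.univ.filter fun a : Fin M → Fin K =>
      collides (fun m' => (o m').getD (a m')) m = false).card := by
  classical
  have hfree : ∀ a : Fin M → Fin K, ∃ f : Fin K, ∀ m', m' ≠ m → (o m').getD (a m') ≠ f := by
    intro a
    by_contra hcon
    push Not at hcon
    have hsub : (Finset.univ : Finset (Fin K)) ⊆
        (Finset.univ.erase m).image fun m' => (o m').getD (a m') := by
      intro f _
      obtain ⟨m', h1, h2⟩ := hcon f
      exact Finset.mem_image.2 ⟨m', by simp [h1], h2⟩
    have h1 := (Finset.card_le_card hsub).trans Finset.card_image_le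
    rw [Finset.card_erase_of_mem (Finset.mem_univ m)] at h1
    simp only [Finset.card_univ, Fintype.card_fin] at h1
    have := m.pos
    omega
  choose free hfree using hfree
  set G := Finset.univ.filter fun a : Fin M → Fin K =>
      collides (fun m' => (o m').getD (a m')) m = false with hG
  have hcard : (Finset.univ : Finset (Fin M → Fin K)).card ≤
      (G ×ˢ (Finset.univ : Finset (Fin K))).card := by
    refine Finset.card_le_card_of_injOn (fun a => (Function.update a m (free a), a m)) ?_ ?_
    · intro a _
      simp only [hG, Finset.coe_product, Set.mem_prod, Finset.mem_coe, Finset.mem_filter,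
        Finset.mem_univ, true_and, and_true, collides, decide_eq_false_iff_not]
      rintro ⟨m', h1, h2⟩
      simp only [ho, Option.getD_none, Function.update_self, Function.update_of_ne h1] at h2
      exact hfree a m' h1 h2
    · intro a _ a' _ haa
      simp only [Prod.mk.injEq] at haa
      funext m'
      by_cases hm : m' = m
      · rw [hm]; exact haa.2
      · have := congrFun haa.1 m'
        simpa [Function.update_of_ne hm] using this
  rw [Finset.card_product] at hcard
  simp only [Finset.card_univ, Fintype.card_fun, Fintype.card_fin] at hcard
  rw [mul_comm]
  exact hcard

end Chairs

namespace Environment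

variable {M K : ℕ} {Ω : Type*} [MeasurableSpace Ω] {P : Measure Ω} (B : Environment M K P)

theorem measurableSet_chairs (s : ℕ) (o : Fin M → Option (Fin K)) :
    MeasurableSet[B.past s] {ω | chairs (fun t => B.U t ω) s = o} := by
  induction s generalizing o with
  | zero => exact @MeasurableSet.const Ω (B.past 0) ((fun _ => none) = o)
  | succ s ih =>
    have : {ω | chairs (fun t => B.U t ω) (s + 1) = o} =
        ⋃ o', ⋃ a : Fin M → Fin K, ⋃ (_ : chairsStep o' a = o),
          ({ω | chairs (fun t => B.U t ω) s = o'} ∩ B.U s ⁻¹' {a}) := by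
      ext ω
      simp [chairs]
    rw [this]
    refine @MeasurableSet.iUnion Ω _ (B.past (s + 1)) _ _ fun o' =>
      @MeasurableSet.iUnion Ω _ (B.past (s + 1)) _ _ fun a =>
      @MeasurableSet.iUnion Ω _ (B.past (s + 1)) _ _ fun _ =>
      @MeasurableSet.inter Ω (B.past (s + 1)) _ _ ?_ ?_
    · exact B.past_mono (Nat.le_succ s) _ (ih o')
    · exact B.measurable_U_past (Nat.lt_succ_self s) (MeasurableSet.singleton a)

theorem measureReal_chairs_inter [IsProbabilityMeasure P] (s : ℕ)
    (o : Fin M → Option (Fin K)) (a : Fin M → Fin K) :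
    P.real ({ω | chairs (fun t => B.U t ω) s = o} ∩ B.U s ⁻¹' {a}) =
      P.real {ω | chairs (fun t => B.U t ω) s = o} * ((K : ℝ) ^ M)⁻¹ := by
  have h := (Indep_iff _ _ _).1 (B.indep_round_past s) (B.U s ⁻¹' {a})
    {ω | chairs (fun t => B.U t ω) s = o}
    (measurable_snd.comp (comap_measurable fun ω => (B.Y s ω, B.U s ω))
      (MeasurableSet.singleton a)) (B.measurableSet_chairs s o)
  rw [B.uniform_U] at h
  simp only [Measure.real]
  rw [Set.inter_comm, h, ENNReal.toReal_mul, mul_comm]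
  simp

/-- Given the state after `s` rounds, the next draw is still uniform, so by `card_collides_le` an
unsettled player remains so with probability at most `1 - 1 / K`. Summing over the states gives the
geometric decay. -/
theorem measureReal_chairs_le [NeZero K] [IsProbabilityMeasure P] (hMK : M ≤ K) (s : ℕ)
    (m : Fin M) : P.real {ω | chairs (fun t => B.U t ω) s m = none} ≤ (1 - 1 / (K : ℝ)) ^ s := by
  classical
  have hK : (0 : ℝ) < K := by exact_mod_cast Nat.pos_of_ne_zero (NeZero.ne K)
  have hK1 : (1 : ℝ) ≤ K := by exact_mod_cast Nat.one_le_iff_ne_zero.2 (NeZero.ne K)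
  induction s with
  | zero => simp
  | succ s ih =>
    let O : Finset (Fin M → Option (Fin K)) := Finset.univ.filter fun o => o m = none
    let bad : (Fin M → Option (Fin K)) → Finset (Fin M → Fin K) := fun o =>
      Finset.univ.filter fun a => collides (fun m' => (o m').getD (a m')) m = true
    have hbad : ∀ o ∈ O, ((bad o).card : ℝ) * ((K : ℝ) ^ M)⁻¹ ≤ 1 - 1 / (K : ℝ) := by
      intro o ho
      have h1 := card_collides_le hMK (o := o) (m := m) (by simpa [O] using ho)
      set G := Finset.univ.filter fun a : Fin M → Fin K =>
        collides (fun m' => (o m').getD (a m')) m = false with hG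
      have h2 : (bad o).card + G.card = K ^ M := by
        have := Finset.card_filter_add_card_filter_not (s := (Finset.univ : Finset (Fin M → Fin K)))
          (fun a : Fin M → Fin K => collides (fun m' => (o m').getD (a m')) m = true)
        simpa [bad, hG] using this
      have h1' : (K : ℝ) ^ M ≤ K * G.card := by exact_mod_cast h1
      have h2' : ((bad o).card : ℝ) + G.card = (K : ℝ) ^ M := by exact_mod_cast h2
      have hp : (0 : ℝ) < (K : ℝ) ^ M := by positivity
      rw [← div_eq_mul_inv, div_le_iff₀ hp, sub_mul, one_mul, div_mul_eq_mul_div, one_mul]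
      have : (K : ℝ) ^ M / K ≤ G.card := by
        rw [div_le_iff₀ hK]; linarith
      linarith
    have hsub : {ω | chairs (fun t => B.U t ω) (s + 1) m = none} ⊆
        ⋃ o ∈ O, ⋃ a ∈ bad o, ({ω | chairs (fun t => B.U t ω) s = o} ∩ B.U s ⁻¹' {a}) := by
      intro ω hω
      have hω' : chairsStep (chairs (fun t => B.U t ω) s) (B.U s ω) m = none := hω
      have hnone : chairs (fun t => B.U t ω) s m = none := by
        cases ho : chairs (fun t => B.U t ω) s m with
        | none => rfl
        | some k => rw [chairsStep_of_some ho] at hω'; simp at hω'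
      rw [chairsStep_of_none hnone] at hω'
      simp only [Set.mem_iUnion]
      refine ⟨chairs (fun t => B.U t ω) s, by simp [O, hnone], B.U s ω, ?_, rfl, rfl⟩
      simp only [bad, Finset.mem_filter, Finset.mem_univ, true_and]
      by_contra hc
      simp [hc] at hω'
    have hA : {ω | chairs (fun t => B.U t ω) s m = none} =
        ⋃ o ∈ O, {ω | chairs (fun t => B.U t ω) s = o} := by
      ext ω
      simp [O]
    calc P.real {ω | chairs (fun t => B.U t ω) (s + 1) m = none}
        ≤ P.real (⋃ o ∈ O, ⋃ a ∈ bad o,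
          ({ω | chairs (fun t => B.U t ω) s = o} ∩ B.U s ⁻¹' {a})) := measureReal_mono hsub (measure_ne_top _ _)
      _ ≤ ∑ o ∈ O, P.real (⋃ a ∈ bad o,
          ({ω | chairs (fun t => B.U t ω) s = o} ∩ B.U s ⁻¹' {a})) :=
        measureReal_biUnion_finset_le _ _
      _ ≤ ∑ o ∈ O, P.real {ω | chairs (fun t => B.U t ω) s = o} * (1 - 1 / (K : ℝ)) := by
        refine Finset.sum_le_sum fun o ho => (measureReal_biUnion_finset_le _ _).trans ?_
        simp only [B.measureReal_chairs_inter]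
        rw [Finset.sum_const, nsmul_eq_mul]
        calc ((bad o).card : ℝ) *
              (P.real {ω | chairs (fun t => B.U t ω) s = o} * ((K : ℝ) ^ M)⁻¹)
            = P.real {ω | chairs (fun t => B.U t ω) s = o} *
              (((bad o).card : ℝ) * ((K : ℝ) ^ M)⁻¹) := by ring
          _ ≤ _ := mul_le_mul_of_nonneg_left (hbad o ho) measureReal_nonneg
      _ = P.real {ω | chairs (fun t => B.U t ω) s m = none} * (1 - 1 / (K : ℝ)) := by
        rw [hA, measureReal_biUnion_finset, Finset.sum_mul]
        · intro o _ o' _ hne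
          refine Set.disjoint_left.2 fun ω h1 h2 => hne ?_
          exact (show _ = o from h1).symm.trans h2
        · exact fun o _ => B.past_le s _ (B.measurableSet_chairs s o)
      _ ≤ (1 - 1 / (K : ℝ)) ^ s * (1 - 1 / (K : ℝ)) := by
        refine mul_le_mul_of_nonneg_right ih ?_
        rw [sub_nonneg, div_le_one hK]
        exact hK1
      _ = (1 - 1 / (K : ℝ)) ^ (s + 1) := (pow_succ _ _).symm

/-- The probability that some player has no arm at the end of the musical chairs. -/
theorem measureReal_exists_chairs_le [NeZero K] [IsProbabilityMeasure P] (hMK : M ≤ K) {x : ℝ}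
    (hx : 0 < x) :
    P.real {ω | ∃ m, chairs (fun t => B.U t ω) ⌈(K : ℝ) * Real.log x⌉₊ m = none} ≤ M / x := by
  have hK : (0 : ℝ) < K := by exact_mod_cast Nat.pos_of_ne_zero (NeZero.ne K)
  have hK1 : (1 : ℝ) ≤ K := by exact_mod_cast Nat.one_le_iff_ne_zero.2 (NeZero.ne K)
  set n := ⌈(K : ℝ) * Real.log x⌉₊ with hn
  have h0 : (0 : ℝ) ≤ 1 - 1 / (K : ℝ) := by
    rw [sub_nonneg, div_le_one hK]
    exact hK1
  have h1 : (1 - 1 / (K : ℝ)) ^ n ≤ 1 / x := by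
    calc (1 - 1 / (K : ℝ)) ^ n ≤ (Real.exp (-(1 / (K : ℝ)))) ^ n := by
          gcongr
          exact Real.one_sub_le_exp_neg _
      _ = Real.exp (-(n / K)) := by
          rw [← Real.exp_nat_mul]
          ring_nf
      _ ≤ Real.exp (-Real.log x) := by
          refine Real.exp_le_exp.2 (neg_le_neg ?_)
          rw [le_div_iff₀ hK, mul_comm]
          exact Nat.le_ceil _
      _ = 1 / x := by rw [Real.exp_neg, Real.exp_log hx, one_div]
  have hU : {ω | ∃ m, chairs (fun t => B.U t ω) n m = none} =
      ⋃ m ∈ (Finset.univ : Finset (Fin M)), {ω | chairs (fun t => B.U t ω) n m = none} := by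
    ext ω
    simp
  rw [hU]
  calc _ ≤ ∑ m : Fin M, P.real {ω | chairs (fun t => B.U t ω) n m = none} :=
        measureReal_biUnion_finset_le _ _
    _ ≤ ∑ m : Fin M, 1 / x :=
        Finset.sum_le_sum fun m _ => (B.measureReal_chairs_le hMK n m).trans h1
    _ = M / x := by simp [div_eq_mul_inv]

end Environment


/-! ### Sequential hopping and ranks -/

section Hopping

variable {M K : ℕ}

/-- The arm pulled in round `i` of the sequential hopping by the player that occupies arm `a`. -/
def hopArm (K a i : ℕ) : ℕ := if i < 2 * a then a else if i < a + K - 1 then i + 1 - a else 0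

theorem hopArm_lt {a i : ℕ} (ha : a < K) : hopArm K a i < K := by
  unfold hopArm
  split_ifs <;> omega

/-- The player with the smaller arm passes the larger one while its owner still waits there, in
round `a + b - 1`. The bound on `i` excludes the last stage of the player at `a`, where meetings on
arm `0` carry no information. -/
theorem hopArm_eq_iff {a b i : ℕ} (ha : a < K) (hb : b < K) (hab : a ≠ b) (hi : i < a + K - 1) :
    hopArm K b i = hopArm K a i ↔ a + b = i + 1 := by
  unfold hopArm
  split_ifs <;> omega

/-- The joint schedule of the sequential hopping. -/
def hopSchedule [NeZero K] (k : Fin M → Fin K) : List (Fin M → Fin K) :=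
  (List.range (2 * K - 2)).map fun i m => Fin.ofNat K (hopArm K (k m).val i)

theorem hopSchedule_map [NeZero K] (k : Fin M → Fin K) (m : Fin M) :
    (hopSchedule k).map (fun a => a m) =
      List.replicate (2 * (k m).val) (k m) ++
        ((List.range (K - 1 - (k m).val)).map (fun i => Fin.ofNat K ((k m).val + 1 + i)) ++
          List.replicate (K - 1 - (k m).val) 0) := by
  have hk := (k m).isLt
  apply List.ext_getElem
  · simp [hopSchedule]
    omega
  · intro i h1 h2
    simp only [hopSchedule, List.map_map, List.getElem_map, List.getElem_range,
      Function.comp_apply, List.getElem_append, List.length_replicate, List.length_map,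
      List.length_range, List.getElem_replicate]
    have hi : i < 2 * K - 2 := by simpa [hopSchedule] using h1
    unfold hopArm
    split_ifs with h3 h4 h5 h6
    · apply Fin.ext
      simp
    · congr 1
      omega
    · omega
    · omega
    · rfl

theorem count_true_map_range (f : ℕ → Bool) (n : ℕ) :
    ((List.range n).map f).count true = ((Finset.range n).filter fun i => f i = true).card := by
  induction n with
  | zero => simp
  | succ n ih =>
    rw [List.range_succ, List.map_append, List.count_append, ih, Finset.range_add_one,
      Finset.filter_insert]
    cases h : f n <;> simp [h]

theorem collides_hop_iff [NeZero K] {k : Fin M → Fin K} (hk : Function.Injective k) (m : Fin M)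
    {i : ℕ} (hi : i < (k m).val + K - 1) :
    collides (fun m => Fin.ofNat K (hopArm K (k m).val i)) m = true ↔
      ∃ m', m' ≠ m ∧ (k m).val + (k m').val = i + 1 := by
  simp only [collides, decide_eq_true_eq]
  refine exists_congr fun m' => and_congr_right fun hm => ?_
  have hne : (k m).val ≠ (k m').val := fun h => hm (hk (Fin.ext h.symm))
  rw [← hopArm_eq_iff (k m).isLt (k m').isLt hne hi, Fin.ext_iff]
  simp [Nat.mod_eq_of_lt (hopArm_lt (k m).isLt), Nat.mod_eq_of_lt (hopArm_lt (k m').isLt)]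

/-- The rank of a player, when the players occupy the arms `k`. -/
def rankOf (k : Fin M → Fin K) (m : Fin M) : ℕ :=
  (Finset.univ.filter fun m' => k m' < k m).card

/-- Each other player is met exactly once, and different players in different rounds, so collisions
count players. -/
theorem card_collides_hop [NeZero K] {k : Fin M → Fin K} (hk : Function.Injective k) (m : Fin M)
    {n : ℕ} (hn : n ≤ (k m).val + K - 1) :
    ((Finset.range n).filter fun i =>
      collides (fun m => Fin.ofNat K (hopArm K (k m).val i)) m = true).card =
    (Finset.univ.filter fun m' => m' ≠ m ∧ (k m).val + (k m').val ≤ n).card := by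
  symm
  have hpos : ∀ m', m' ≠ m → 1 ≤ (k m).val + (k m').val := by
    intro m' hm
    have hne : (k m).val ≠ (k m').val := fun h => hm (hk (Fin.ext h.symm))
    omega
  refine Finset.card_bij (fun m' _ => (k m).val + (k m').val - 1) ?_ ?_ ?_
  · intro m' hm'
    simp only [Finset.mem_filter, Finset.mem_univ, true_and, Finset.mem_range] at hm' ⊢
    have := hpos m' hm'.1
    refine ⟨by omega, (collides_hop_iff hk m (by omega)).2 ⟨m', hm'.1, by omega⟩⟩
  · intro m1 h1 m2 h2 h
    simp only [Finset.mem_filter, Finset.mem_univ, true_and] at h1 h2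
    have e1 := hpos m1 h1.1
    have e2 := hpos m2 h2.1
    exact hk (Fin.ext (by omega))
  · intro i hi
    simp only [Finset.mem_filter, Finset.mem_range] at hi
    obtain ⟨m', h1, h2⟩ := (collides_hop_iff hk m (by omega)).1 hi.2
    exact ⟨m', by simp only [Finset.mem_filter, Finset.mem_univ, true_and]; exact ⟨h1, by omega⟩,
      by omega⟩

/-- In the first `2 (k m)` rounds the players met are those with `k m + k m' ≤ 2 (k m)`, that is,
with a smaller arm. By round `(k m) + K - 1` everybody else has been met. -/
theorem collisions_hop [NeZero K] {k : Fin M → Fin K} (hk : Function.Injective k) (m : Fin M)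
    (y : ℕ → Fin M → Fin K → ℝ) (t : ℕ) :
    let os := observations y t (hopSchedule k) m
    let o₁ := os.take (2 * (k m).val)
    let o₂ := (os.drop (2 * (k m).val)).take (K - 1 - (k m).val)
    collisions o₁ = rankOf k m ∧ collisions o₁ + collisions o₂ = M - 1 := by
  intro os o₁ o₂
  have hkm := (k m).isLt
  have hos : os.map Prod.snd = (List.range (2 * K - 2)).map fun i =>
      collides (fun m => Fin.ofNat K (hopArm K (k m).val i)) m := by
    simp only [os, observations_map_snd, hopSchedule, List.map_map]
    rfl
  have htake : ∀ n ≤ 2 * K - 2, collisions (os.take n) = ((Finset.range n).filter fun i =>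
      collides (fun m => Fin.ofNat K (hopArm K (k m).val i)) m = true).card := by
    intro n hn
    rw [← count_true_map_range, collisions, List.map_take, hos, ← List.map_take, List.take_range,
      Nat.min_eq_left hn]
  constructor
  · rw [htake _ (by omega), card_collides_hop hk m (by omega), rankOf]
    congr 1
    ext m'
    simp only [Finset.mem_filter, Finset.mem_univ, true_and, Fin.lt_def]
    constructor
    · rintro ⟨h1, h2⟩
      have hne : (k m).val ≠ (k m').val := fun h => h1 (hk (Fin.ext h.symm))
      omega
    · intro h
      exact ⟨fun e => by rw [e] at h; omega, by omega⟩
  · have hsum : collisions o₁ + collisions o₂ =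
        collisions (os.take ((k m).val + K - 1)) := by
      rw [show (k m).val + K - 1 = 2 * (k m).val + (K - 1 - (k m).val) by omega,
        List.take_add]
      simp [collisions, o₁, o₂]
    rw [hsum, htake _ (by omega), card_collides_hop hk m le_rfl]
    rw [show (Finset.univ.filter fun m' => m' ≠ m ∧ (k m).val + (k m').val ≤ (k m).val + K - 1) =
      Finset.univ.erase m by
        ext m'
        have := (k m').isLt
        simp only [Finset.mem_filter, Finset.mem_univ, true_and, Finset.mem_erase, and_true]
        exact ⟨fun h => h.1, fun h => ⟨h, by omega⟩⟩]
    simp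

theorem rankOf_lt (k : Fin M → Fin K) (m : Fin M) : rankOf k m < M := by
  have h : (Finset.univ.filter fun m' => k m' < k m) ⊂ (Finset.univ : Finset (Fin M)) :=
    Finset.filter_ssubset.2 ⟨m, Finset.mem_univ m, lt_irrefl _⟩
  simpa [rankOf] using Finset.card_lt_card h

theorem rankOf_injective {k : Fin M → Fin K} (hk : Function.Injective k) :
    Function.Injective fun m => (⟨rankOf k m, rankOf_lt k m⟩ : Fin M) := by
  have hlt : ∀ m m', k m < k m' → rankOf k m < rankOf k m' := by
    intro m m' h
    refine Finset.card_lt_card (Finset.ssubset_iff_of_subset ?_ |>.2 ⟨m, by simp [h], by simp⟩)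
    intro x hx
    simp only [Finset.mem_filter, Finset.mem_univ, true_and] at hx ⊢
    exact hx.trans h
  intro m m' h
  simp only [Fin.mk.injEq] at h
  by_contra hne
  rcases lt_trichotomy (k m) (k m') with h1 | h1 | h1
  · exact absurd (hlt _ _ h1) (by omega)
  · exact hne (hk h1)
  · exact absurd (hlt _ _ h1) (by omega)

/-- If all the players get an arm in the musical chairs, then the initialization gives them
different ranks. -/
theorem IsRun.init [NeZero K] {y : ℕ → Fin M → Fin K → ℝ} {u : ℕ → Fin M → Fin K}
    {Q : ℕ → Fin M → Prog K Unit} (h : IsRun y u Q) (δ₀ : ℝ) (g : ℕ × ℕ → Prog K Unit)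
    (hQ : ∀ m, Q 0 m = (MultiplayerBandit.init K δ₀).bind g)
    (hchairs : ∀ m, MultiplayerBandit.chairs u ⌈(K : ℝ) * Real.log (K / δ₀)⌉₊ m ≠ none) :
    ∃ σ : Equiv.Perm (Fin M), ∀ r,
      Q (⌈(K : ℝ) * Real.log (K / δ₀)⌉₊ + (2 * K - 2)) (σ r) = g (r.val, M - 1) := by
  set n := ⌈(K : ℝ) * Real.log (K / δ₀)⌉₊ with hn
  have hsome : ∀ m, ∃ k, MultiplayerBandit.chairs u n m = some k := fun m =>
    Option.ne_none_iff_exists'.1 (hchairs m)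
  choose k hk using hsome
  have hinj : Function.Injective k := fun m m' e =>
    chairs_injective u n (hk m) (by rw [e]; exact hk m')
  have h1 : ∀ m, Q n m = (pulls ((hopSchedule k).map fun a => a m)).bind fun os =>
      g (collisions (os.take (2 * (k m).val)), collisions (os.take (2 * (k m).val)) +
        collisions ((os.drop (2 * (k m).val)).take (K - 1 - (k m).val))) := by
    intro m
    have hQ0 : ∀ m, Q 0 m = (musicalChairs n none).bind _ := fun m => by
      rw [hQ, init_bind]
    rw [h.chairs n _ hQ0 le_rfl m, Nat.sub_self, hk]
    simp only [musicalChairs, Prog.bind, Option.getD_some]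
    rw [hopSchedule_map]
    simp only [pulls_append_bind, List.length_replicate, List.length_map, List.length_range]
  have h2 := (h.block (hopSchedule k) _ n h1).1
  have hlen : (hopSchedule k).length = 2 * K - 2 := by simp [hopSchedule]
  -- Injective ranks form a permutation of the players; its inverse names the players by their
  -- ranks.
  let ρ : Equiv.Perm (Fin M) := Equiv.ofBijective _
    (Finite.injective_iff_bijective.1 (rankOf_injective hinj))
  refine ⟨ρ.symm, fun r => ?_⟩
  have h3 := h2 (ρ.symm r)
  rw [hlen] at h3
  obtain ⟨c1, c2⟩ := collisions_hop hinj (ρ.symm r) y n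
  rw [h3, c2, c1]
  congr 2
  have : ρ (ρ.symm r) = r := ρ.apply_symm_apply r
  exact congrArg Fin.val this

end Hopping


/-! ## Communication -/

section Coding

theorem length_encode (len x : ℕ) : (encode len x).length = len := by simp [encode]

theorem decode_encode {len x : ℕ} (h : x < 2 ^ len) : decode (encode len x) = x := by
  induction len generalizing x with
  | zero => simp_all [encode, decode]
  | succ len ih =>
    have h1 : encode (len + 1) x = x.testBit 0 :: encode len (x / 2) := by
      simp [encode, List.range_succ_eq_map, Nat.testBit_succ, Function.comp_def]
    have h2 : decode (encode len (x / 2)) = x / 2 := ih (by rw [pow_succ] at h; omega)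
    rw [h1]
    change (x.testBit 0).toNat + 2 * decode (encode len (x / 2)) = x
    rw [h2, Nat.testBit_zero]
    rcases Nat.mod_two_eq_zero_or_one x with h3 | h3 <;> simp [h3] <;> omega

variable {α β : Type}

theorem length_flatMap_of_forall {l : List α} {f : α → List β} {b : ℕ}
    (h : ∀ a ∈ l, (f a).length = b) : (l.flatMap f).length = l.length * b := by
  induction l with
  | nil => simp
  | cons a l ih =>
    simp only [List.flatMap_cons, List.length_append, List.length_cons]
    rw [h a (by simp), ih fun a' ha' => h a' (by simp [ha'])]
    ring

theorem take_drop_flatMap {l : List α} {f : α → List β} {b : ℕ}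
    (h : ∀ a ∈ l, (f a).length = b) {i : ℕ} (hi : i < l.length) :
    ((l.flatMap f).drop (i * b)).take b = f l[i] := by
  induction l generalizing i with
  | nil => simp at hi
  | cons a l ih =>
    have ha : (f a).length = b := h a (by simp)
    cases i with
    | zero => simp [← ha]
    | succ i =>
      rw [List.flatMap_cons, show (i + 1) * b = (f a).length + i * b by rw [ha]; ring,
        List.drop_length_add_append]
      simpa using ih (fun a' ha' => h a' (by simp [ha'])) (by simpa using hi)

theorem decodeBlock_flatMap_encode {l : List α} {x : α → ℕ} {b : ℕ} {i : ℕ} (hi : i < l.length)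
    (hx : x l[i] < 2 ^ b) : decodeBlock b i (l.flatMap fun a => encode b (x a)) = x l[i] := by
  rw [decodeBlock, take_drop_flatMap (fun a _ => length_encode _ _) hi, decode_encode hx]

theorem flatMap_eq_replicate {l : List α} {f : α → List β} {b : ℕ} {a : β}
    (h : ∀ x ∈ l, f x = List.replicate b a) :
    l.flatMap f = List.replicate (l.length * b) a := by
  induction l with
  | nil => simp
  | cons x l ih =>
    rw [List.flatMap_cons, h x (by simp), ih fun y hy => h y (by simp [hy]),
      ← List.replicate_add, List.length_cons]
    congr 1
    ring

/-- When messages are exchanged in turn, the timetable of one follower is constant except in its own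
slot `r`. -/
theorem flatMap_finRange_eq {N : ℕ} {f : Fin N → List β} {b : ℕ} {a : β} (r : Fin N)
    (h : ∀ j, j ≠ r → f j = List.replicate b a) :
    (List.finRange N).flatMap f =
      List.replicate (r.val * b) a ++ (f r ++ List.replicate ((N - (r.val + 1)) * b) a) := by
  have hsplit : List.finRange N =
      (List.finRange N).take r.val ++ r :: (List.finRange N).drop (r.val + 1) := by
    have := List.take_append_drop r.val (List.finRange N)
    rw [List.drop_eq_getElem_cons (by simp)] at this
    simpa using this.symm
  rw [hsplit, List.flatMap_append, List.flatMap_cons, flatMap_eq_replicate (b := b) (a := a),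
    flatMap_eq_replicate (b := b) (a := a)]
  · simp
  · intro j hj
    obtain ⟨i, hi, rfl⟩ := List.mem_iff_getElem.1 hj
    refine h _ fun e => ?_
    have := congrArg Fin.val e
    simp at this
    omega
  · intro j hj
    obtain ⟨i, hi, rfl⟩ := List.mem_iff_getElem.1 hj
    refine h _ fun e => ?_
    have := congrArg Fin.val e
    simp at this hi
    omega

end Coding

section Communication

variable {K : ℕ} {N : ℕ}

/-- The arms pulled when player `s` sends a bit to player `t`. -/
def bitArms {M : ℕ} (κ : Fin M → Fin K) (s t : Fin M) (b : Bool) : Fin M → Fin K :=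
  if b then Function.update κ s (κ t) else κ

theorem bitArms_apply_self {M : ℕ} (κ : Fin M → Fin K) (s t : Fin M) (b : Bool) :
    bitArms κ s t b s = if b then κ t else κ s := by
  cases b <;> simp [bitArms]

theorem bitArms_apply_of_ne {M : ℕ} (κ : Fin M → Fin K) {s t r : Fin M} (h : r ≠ s) (b : Bool) :
    bitArms κ s t b r = κ r := by
  cases b <;> simp [bitArms, h]

/-- With distinct communication arms, only the sender can come to the arm of the receiver, so the
collision indicator is the bit. -/
theorem collides_bitArms {M : ℕ} {κ : Fin M → Fin K} (hκ : Function.Injective κ) {s t : Fin M}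
    (h : s ≠ t) (b : Bool) : collides (bitArms κ s t b) t = b := by
  cases b with
  | false => exact collides_eq_false_of_injective hκ t
  | true =>
    simp only [collides, decide_eq_true_eq]
    exact ⟨s, h, by simp [bitArms, Function.update_of_ne h.symm]⟩

theorem exists_finRange_flatMap_mem {f : Fin N → List (Fin (N + 1) → Fin K)}
    {a : Fin (N + 1) → Fin K} (h : a ∈ (List.finRange N).flatMap f) : ∃ j, a ∈ f j := by
  obtain ⟨j, _, hj⟩ := List.mem_flatMap.1 h
  exact ⟨j, hj⟩

/-- The leader sends messages to the followers in turn. -/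
theorem IsRun.broadcast [NeZero K] {y : ℕ → Fin (N + 1) → Fin K → ℝ}
    {u : ℕ → Fin (N + 1) → Fin K} {Q : ℕ → Fin (N + 1) → Prog K Unit} (h : IsRun y u Q)
    {κ : Fin (N + 1) → Fin K} (hκ : Function.Injective κ) (len : ℕ) (msg : Fin N → List Bool)
    (hmsg : ∀ j, (msg j).length = len) (q₀ : Prog K Unit) (q : Fin N → List Bool → Prog K Unit)
    (t : ℕ)
    (h₀ : Q t 0 = (pulls ((List.finRange N).flatMap fun j =>
      sendArms (κ 0) (κ j.succ) (msg j))).bind fun _ => q₀)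
    (hQ : ∀ j : Fin N, Q t j.succ = (listen N (j.val + 1) len (κ j.succ)).bind (q j)) :
    Q (t + N * len) 0 = q₀ ∧ (∀ j : Fin N, Q (t + N * len) j.succ = q j (msg j)) ∧
    ∀ (f : (Fin (N + 1) → Fin K) → ℝ) (T : ℕ) (b : ℝ), 0 ≤ b →
      (∀ s r β, s ≠ r → f (bitArms κ s r β) ≤ b) →
      tailCost f u Q T t ≤ (N * len : ℕ) * b + tailCost f u Q T (t + N * len) := by
  set S : List (Fin (N + 1) → Fin K) := (List.finRange N).flatMap fun j =>
    (msg j).map fun β => bitArms κ 0 j.succ β with hS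
  have hlen : S.length = N * len := by
    rw [hS, length_flatMap_of_forall (b := len) fun j _ => by simp [hmsg], List.length_finRange]
  have hS0 : S.map (fun a => a 0) = (List.finRange N).flatMap fun j =>
      sendArms (κ 0) (κ j.succ) (msg j) := by
    simp only [hS, List.map_flatMap, List.map_map, sendArms]
    congr 1
    funext j
    congr 1
    funext β
    simp [bitArms_apply_self]
  have hSr : ∀ r : Fin N, S.map (fun a => a r.succ) =
      List.replicate ((r.val + 1 - 1) * len) (κ r.succ) ++ (List.replicate len (κ r.succ) ++
        List.replicate ((N - (r.val + 1)) * len) (κ r.succ)) := by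
    intro r
    have h1 : ∀ j : Fin N, ((msg j).map ((fun a : Fin (N + 1) → Fin K => a r.succ) ∘
        fun β => bitArms κ 0 j.succ β)) = List.replicate len (κ r.succ) := by
      intro j
      simp only [Function.comp_def, bitArms_apply_of_ne κ (Fin.succ_ne_zero r), List.map_const',
        hmsg]
    simp only [hS, List.map_flatMap, List.map_map]
    rw [flatMap_finRange_eq (b := len) (a := κ r.succ) r fun j _ => h1 j]
    congr 2
    exact h1 r
  let g : Fin (N + 1) → List (ℝ × Bool) → Prog K Unit := Fin.cases (fun _ => q₀) fun j os =>
    q j (((os.drop (j.val * len)).take len).map Prod.snd)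
  have hall : ∀ r, Q t r = (pulls (S.map fun a => a r)).bind (g r) := by
    intro r
    refine Fin.cases ?_ (fun j => ?_) r
    · rw [h₀, hS0]
      rfl
    · rw [hQ, listen_bind, hSr]
      simp only [pulls_append_bind, List.length_replicate, Nat.add_sub_cancel]
      rfl
  refine ⟨?_, fun j => ?_, fun f T b hb hf => ?_⟩
  · rw [← hlen, (h.block S g t hall).1 0]
    rfl
  · rw [← hlen, (h.block S g t hall).1 j.succ]
    change q j _ = _
    congr 1
    rw [List.map_take, List.map_drop, observations_map_snd, hS, List.map_flatMap,
      take_drop_flatMap (b := len) (fun j _ => by simp [hmsg]) (by simp)]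
    simp only [List.getElem_finRange, Fin.cast_mk, Fin.eta, List.map_map]
    conv_rhs => rw [← List.map_id (msg j)]
    congr 1
    funext β
    exact collides_bitArms hκ (Fin.succ_ne_zero j).symm β
  · rw [← hlen]
    refine h.tailCost_block S g t hall f T hb fun a ha => ?_
    obtain ⟨j, hj⟩ := exists_finRange_flatMap_mem ha
    obtain ⟨β, _, rfl⟩ := List.mem_map.1 hj
    exact hf _ _ _ (Fin.succ_ne_zero j).symm

/-- The followers send messages to the leader in turn. -/
theorem IsRun.gather [NeZero K] {y : ℕ → Fin (N + 1) → Fin K → ℝ}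
    {u : ℕ → Fin (N + 1) → Fin K} {Q : ℕ → Fin (N + 1) → Prog K Unit} (h : IsRun y u Q)
    {κ : Fin (N + 1) → Fin K} (hκ : Function.Injective κ) (len : ℕ) (msg : Fin N → List Bool)
    (hmsg : ∀ j, (msg j).length = len) (q₀ : List Bool → Prog K Unit) (q : Fin N → Prog K Unit)
    (t : ℕ)
    (h₀ : Q t 0 = (pulls (List.replicate (N * len) (κ 0))).bind fun os => q₀ (os.map Prod.snd))
    (hQ : ∀ j : Fin N, Q t j.succ =
      (pulls (List.replicate ((j.val + 1 - 1) * len) (κ j.succ))).bind fun _ =>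
      (pulls (sendArms (κ j.succ) (κ 0) (msg j))).bind fun _ =>
      (pulls (List.replicate ((N - (j.val + 1)) * len) (κ j.succ))).bind fun _ => q j) :
    Q (t + N * len) 0 = q₀ ((List.finRange N).flatMap msg) ∧
    (∀ j : Fin N, Q (t + N * len) j.succ = q j) ∧
    ∀ (f : (Fin (N + 1) → Fin K) → ℝ) (T : ℕ) (b : ℝ), 0 ≤ b →
      (∀ s r β, s ≠ r → f (bitArms κ s r β) ≤ b) →
      tailCost f u Q T t ≤ (N * len : ℕ) * b + tailCost f u Q T (t + N * len) := by
  set S : List (Fin (N + 1) → Fin K) := (List.finRange N).flatMap fun j =>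
    (msg j).map fun β => bitArms κ j.succ 0 β with hS
  have hlen : S.length = N * len := by
    rw [hS, length_flatMap_of_forall (b := len) fun j _ => by simp [hmsg], List.length_finRange]
  have hS0 : S.map (fun a => a 0) = List.replicate (N * len) (κ 0) := by
    simp only [hS, List.map_flatMap, List.map_map]
    rw [flatMap_eq_replicate (b := len) (a := κ 0), List.length_finRange]
    intro j _
    rw [← hmsg j, ← List.map_const']
    congr 1
    funext β
    exact bitArms_apply_of_ne κ (Fin.succ_ne_zero j).symm β
  have hSr : ∀ r : Fin N, S.map (fun a => a r.succ) =
      List.replicate ((r.val + 1 - 1) * len) (κ r.succ) ++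
        (sendArms (κ r.succ) (κ 0) (msg r) ++
        List.replicate ((N - (r.val + 1)) * len) (κ r.succ)) := by
    intro r
    simp only [hS, List.map_flatMap, List.map_map]
    rw [flatMap_finRange_eq (b := len) (a := κ r.succ) r]
    · congr 2
      rw [sendArms]
      congr 1
      funext β
      exact bitArms_apply_self κ _ _ β
    · intro j hj
      rw [← hmsg j, ← List.map_const']
      congr 1
      funext β
      exact bitArms_apply_of_ne κ (fun e => hj (Fin.succ_injective _ e).symm) β
  let g : Fin (N + 1) → List (ℝ × Bool) → Prog K Unit :=
    Fin.cases (fun os => q₀ (os.map Prod.snd)) fun j _ => q j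
  have hall : ∀ r, Q t r = (pulls (S.map fun a => a r)).bind (g r) := by
    intro r
    refine Fin.cases ?_ (fun j => ?_) r
    · rw [h₀, hS0]
      rfl
    · rw [hQ, hSr]
      simp only [pulls_append_bind]
      rfl
  refine ⟨?_, fun j => ?_, fun f T b hb hf => ?_⟩
  · rw [← hlen, (h.block S g t hall).1 0]
    change q₀ _ = _
    congr 1
    rw [observations_map_snd, hS, List.map_flatMap]
    congr 1
    funext j
    rw [List.map_map]
    conv_rhs => rw [← List.map_id (msg j)]
    congr 1
    funext β
    exact collides_bitArms hκ (Fin.succ_ne_zero j) β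
  · rw [← hlen, (h.block S g t hall).1 j.succ]
    rfl
  · rw [← hlen]
    refine h.tailCost_block S g t hall f T hb fun a ha => ?_
    obtain ⟨j, hj⟩ := exists_finRange_flatMap_mem ha
    obtain ⟨β, _, rfl⟩ := List.mem_map.1 hj
    exact hf _ _ _ (Fin.succ_ne_zero j)

end Communication


/-! ## One epoch -/

section Epoch

variable {K : ℕ} {N : ℕ}

theorem leaderMessage_length (π₁ : Fin (N + 1) → Fin K) (C : List (Fin (N + 1) → Fin K))
    (r : Fin (N + 1)) : (leaderMessage π₁ C r).length = (C.length + 2) * armBits K := by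
  rw [leaderMessage, length_flatMap_of_forall fun _ _ => length_encode _ _]
  simp

theorem decodeArm_leaderMessage [NeZero K] (π₁ : Fin (N + 1) → Fin K)
    (C : List (Fin (N + 1) → Fin K)) (r : Fin (N + 1)) :
    (∀ i (hi : i < C.length), decodeArm (leaderMessage π₁ C r) i = C[i] r) ∧
    decodeArm (leaderMessage π₁ C r) C.length = π₁ 0 ∧
    decodeArm (leaderMessage π₁ C r) (C.length + 1) = π₁ r := by
  have key : ∀ i (hi : i < (C.map (fun π => π r) ++ [π₁ 0, π₁ r]).length),
      decodeArm (leaderMessage π₁ C r) i = (C.map (fun π => π r) ++ [π₁ 0, π₁ r])[i] := by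
    intro i hi
    rw [decodeArm, leaderMessage, decodeBlock_flatMap_encode (x := fun a : Fin K => a.val) hi]
    · simp
    · exact lt_of_lt_of_le (Fin.isLt _) (Nat.le_pow_clog (by norm_num) _)
  refine ⟨fun i hi => ?_, ?_, ?_⟩
  · rw [key i (by simp; omega)]
    simp [hi]
  · rw [key _ (by simp)]
    simp
  · rw [key _ (by simp)]
    simp

/-- The programs of the players at the beginning of an epoch. -/
noncomputable def epochState [NeZero K] (T c lag s p : ℕ) (E : Finset (Fin (N + 1) × Fin K))
    (w : Fin (N + 1) → Fin K → ℝ) (κ : Fin (N + 1) → Fin K) : Fin (N + 1) → Prog K Unit :=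
  Fin.cases (leaderLoop T c lag N s p E w κ) fun j =>
    followerLoop T c N (j.val + 1) s p (κ j.succ)

/-- What is left of the epoch of the leader after the communication of the matchings. -/
noncomputable def leaderRest [NeZero K] (T c lag N s p : ℕ) (π₁ : Fin (N + 1) → Fin K)
    (E' : Finset (Fin (N + 1) × Fin K)) (C : List (Fin (N + 1) → Fin K)) : Prog K Unit :=
  if C.length = 1 then
    (pulls (List.replicate T ((C.headD π₁) 0))).bind fun _ => Prog.ret ()
  else
    (pulls (exploreArms c p (C.map fun π => π 0))).bind fun os =>
    (pulls (List.replicate (N * (K * valueBits c p)) (π₁ 0))).bind fun msg =>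
      leaderLoop T c lag N s (p + 1) E'
        (leaderEstimates (valueBits c p) (exploreArms c p (C.map fun π => π 0)) os
          (msg.map Prod.snd)) π₁

/-- The number of bits sent before the exploration, if there are `L` candidate matchings. -/
def announceBits (N K L : ℕ) : ℕ := N * sizeBits (N + 1) K + N * ((L + 2) * armBits K)

/-- Two broadcasts are needed: a follower must decode the size of the list to know the length of the
second message. The condition `hC` says that the size fits into its message. -/
theorem IsRun.announce [NeZero K] {y : ℕ → Fin (N + 1) → Fin K → ℝ}
    {u : ℕ → Fin (N + 1) → Fin K} {Q : ℕ → Fin (N + 1) → Prog K Unit} (h : IsRun y u Q)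
    {T c lag s p : ℕ} {E : Finset (Fin (N + 1) × Fin K)} {w : Fin (N + 1) → Fin K → ℝ}
    {κ : Fin (N + 1) → Fin K} (hκ : Function.Injective κ) {t : ℕ}
    (hQ : Q t = epochState T c lag (s + 1) p E w κ)
    {π₁ : Fin (N + 1) → Fin K} {E' : Finset (Fin (N + 1) × Fin K)}
    {C : List (Fin (N + 1) → Fin K)}
    (hd : leaderChoice (4 * ((N + 1 : ℕ) : ℝ) * eps (N + 1) K T c (p - lag)) E w = (π₁, E', C))
    (hC : C.length < 2 ^ sizeBits (N + 1) K) :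
    (Q (t + announceBits N K C.length) 0 = leaderRest T c lag N s p π₁ E' C ∧
    ∀ j : Fin N, Q (t + announceBits N K C.length) j.succ =
      followerEpoch T c N (j.val + 1) s p C.length (decodeArm (leaderMessage π₁ C j.succ))) ∧
    ∀ (f : (Fin (N + 1) → Fin K) → ℝ) (T' : ℕ) (b : ℝ), 0 ≤ b →
      (∀ s r β, s ≠ r → f (bitArms κ s r β) ≤ b) →
      tailCost f u Q T' t ≤ (announceBits N K C.length : ℕ) * b +
        tailCost f u Q T' (t + announceBits N K C.length) := by
  have h0 : Q t 0 = (pulls (leaderSizeArms κ C.length)).bind fun _ =>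
      (pulls (leaderMatchingArms κ π₁ C)).bind fun _ => leaderRest T c lag N s p π₁ E' C := by
    rw [hQ]
    change leaderLoop T c lag N (s + 1) p E w κ = _
    rw [leaderLoop_succ]
    simp only [hd]
    rfl
  have hj : ∀ j : Fin N, Q t j.succ = (listen N (j.val + 1) (sizeBits (N + 1) K) (κ j.succ)).bind
      fun sizeMsg => (listen N (j.val + 1) ((decode sizeMsg + 2) * armBits K) (κ j.succ)).bind
        fun msg => followerEpoch T c N (j.val + 1) s p (decode sizeMsg) (decodeArm msg) := by
    intro j
    rw [hQ]
    exact followerLoop_succ T c N (j.val + 1) s p (κ j.succ)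
  obtain ⟨a0, aj, ac⟩ := h.broadcast hκ (sizeBits (N + 1) K)
    (fun _ => encode (sizeBits (N + 1) K) C.length) (fun _ => length_encode _ _) _ _ t h0 hj
  simp only [decode_encode hC] at aj
  obtain ⟨b0, bj, bc⟩ := h.broadcast hκ ((C.length + 2) * armBits K)
    (fun j => leaderMessage π₁ C j.succ) (fun j => leaderMessage_length _ _ _) _ _ _ a0 aj
  have ht : t + announceBits N K C.length =
      t + N * sizeBits (N + 1) K + N * ((C.length + 2) * armBits K) := by
    rw [announceBits, Nat.add_assoc]
  rw [ht]
  refine ⟨⟨b0, bj⟩, fun f T' b hb hf => ?_⟩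
  have e1 := ac f T' b hb hf
  have e2 := bc f T' b hb hf
  rw [announceBits]
  push_cast at e1 e2 ⊢
  linarith

theorem IsRun.exploit [NeZero K] {y : ℕ → Fin (N + 1) → Fin K → ℝ}
    {u : ℕ → Fin (N + 1) → Fin K} {Q : ℕ → Fin (N + 1) → Prog K Unit} (h : IsRun y u Q)
    {T c lag s p : ℕ} {π₁ : Fin (N + 1) → Fin K} {E' : Finset (Fin (N + 1) × Fin K)}
    {C : List (Fin (N + 1) → Fin K)} {t : ℕ}
    (h0 : Q t 0 = leaderRest T c lag N s p π₁ E' C)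
    (hj : ∀ j : Fin N, Q t j.succ =
      followerEpoch T c N (j.val + 1) s p C.length (decodeArm (leaderMessage π₁ C j.succ)))
    {π : Fin (N + 1) → Fin K} (hC : C = [π]) : ∀ i < T, runArms u Q (t + i) = π := by
  subst hC
  have hall : ∀ r, Q t r = (pulls ((List.replicate T π).map fun a => a r)).bind
      fun _ => Prog.ret () := by
    intro r
    refine Fin.cases ?_ (fun j => ?_) r
    · rw [h0]
      simp [leaderRest]
    · rw [hj, followerEpoch, (decodeArm_leaderMessage π₁ [π] j.succ).1 0 (by simp)]
      simp
  intro i hi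
  rw [(h.block _ _ t hall).2 i (by simpa using hi)]
  simp

/-- The joint schedule of the exploration. -/
def exploreSchedule {M : ℕ} (c p : ℕ) (C : List (Fin M → Fin K)) : List (Fin M → Fin K) :=
  C.flatMap fun π => List.replicate (2 ^ p ^ c) π

theorem exploreSchedule_length {M : ℕ} (c p : ℕ) (C : List (Fin M → Fin K)) :
    (exploreSchedule c p C).length = C.length * 2 ^ p ^ c :=
  length_flatMap_of_forall fun _ _ => by simp

theorem exploreSchedule_map {M : ℕ} (c p : ℕ) (C : List (Fin M → Fin K)) (r : Fin M) :
    (exploreSchedule c p C).map (fun a => a r) = exploreArms c p (C.map fun π => π r) := by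
  simp only [exploreSchedule, exploreArms, List.map_flatMap, List.map_replicate, List.flatMap_map]

theorem quantize_lt (b : ℕ) (x : ℝ) : quantize b x < 2 ^ b := by
  have : 0 < 2 ^ b := Nat.two_pow_pos b
  unfold quantize
  omega

theorem length_followerBits (b : ℕ) (as : List (Fin K)) (os : List (ℝ × Bool)) :
    (followerBits b as os).length = K * b := by
  rw [followerBits, length_flatMap_of_forall fun _ _ => length_encode _ _, List.length_finRange]

/-- Blocks are nested: block `k` of length `b` inside block `j` of length `K * b` is block `j * K +
k` of length `b`. -/
theorem decodeBlock_followerBits {b : ℕ} {f : Fin N → Fin K → ℕ} (hf : ∀ j k, f j k < 2 ^ b)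
    (j : Fin N) (k : Fin K) :
    decodeBlock b (j.val * K + k.val) ((List.finRange N).flatMap fun j =>
      (List.finRange K).flatMap fun k => encode b (f j k)) = f j k := by
  set l := (List.finRange N).flatMap fun j =>
      (List.finRange K).flatMap fun k => encode b (f j k) with hl
  have h1 : (l.drop (j.val * (K * b))).take (K * b) =
      (List.finRange K).flatMap fun k => encode b (f j k) := by
    rw [hl, take_drop_flatMap (b := K * b) (fun j _ => by
      rw [length_flatMap_of_forall fun _ _ => length_encode _ _, List.length_finRange]) (by simp)]
    simp
  have h2 : decodeBlock b k.val ((l.drop (j.val * (K * b))).take (K * b)) = f j k := by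
    rw [h1, decodeBlock_flatMap_encode (x := f j) (by simp) (hf j _)]
    simp
  rw [← h2, decodeBlock, decodeBlock, List.drop_take, List.drop_drop, List.take_take]
  congr 2
  · have : (k.val + 1) * b ≤ K * b := Nat.mul_le_mul_right b k.isLt
    have : (k.val + 1) * b = k.val * b + b := by ring
    omega
  · ring_nf

/-- The averages computed by player `r` after an exploration that begins in round `t`. -/
noncomputable def estimate {M : ℕ} (y : ℕ → Fin M → Fin K → ℝ) (c p t : ℕ)
    (C : List (Fin M → Fin K)) (r : Fin M) (k : Fin K) : ℝ :=
  empMean ((exploreSchedule c p C).map fun a => a r)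
    (observations y t (exploreSchedule c p C) r) k

/-- The reports that follow the exploration already use the new communication arms `π₁`, so their
cost depends on the loss of `π₁` and not on that of the previous arms. Only the averages of the
followers are truncated. -/
theorem IsRun.explore [NeZero K] {y : ℕ → Fin (N + 1) → Fin K → ℝ}
    {u : ℕ → Fin (N + 1) → Fin K} {Q : ℕ → Fin (N + 1) → Prog K Unit} (h : IsRun y u Q)
    {T c lag s p : ℕ} {π₁ : Fin (N + 1) → Fin K} (hπ₁ : Function.Injective π₁)
    {E' : Finset (Fin (N + 1) × Fin K)} {C : List (Fin (N + 1) → Fin K)} {t : ℕ}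
    (h0 : Q t 0 = leaderRest T c lag N s p π₁ E' C)
    (hj : ∀ j : Fin N, Q t j.succ =
      followerEpoch T c N (j.val + 1) s p C.length (decodeArm (leaderMessage π₁ C j.succ)))
    (hC : C.length ≠ 1) :
    (∃ w', Q (t + C.length * 2 ^ p ^ c + N * (K * valueBits c p)) =
        epochState T c lag s (p + 1) E' w' π₁ ∧ ∀ k, w' 0 k = estimate y c p t C 0 k ∧
        ∀ j : Fin N, w' j.succ k =
          (quantize (valueBits c p) (estimate y c p t C j.succ k) : ℝ) / 2 ^ valueBits c p) ∧
    (∀ i (hi : i < (exploreSchedule c p C).length),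
      runArms u Q (t + i) = (exploreSchedule c p C)[i]) ∧
    ∀ (f : (Fin (N + 1) → Fin K) → ℝ) (T' : ℕ) (b b' : ℝ), 0 ≤ b → 0 ≤ b' →
      (∀ s r β, s ≠ r → f (bitArms π₁ s r β) ≤ b) → (∀ π ∈ C, f π ≤ b') →
      tailCost f u Q T' t ≤ (C.length * 2 ^ p ^ c : ℕ) * b' + (N * (K * valueBits c p) : ℕ) * b +
        tailCost f u Q T' (t + C.length * 2 ^ p ^ c + N * (K * valueBits c p)) := by
  set S := exploreSchedule c p C with hS
  let g : Fin (N + 1) → List (ℝ × Bool) → Prog K Unit := Fin.cases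
    (fun os => (pulls (List.replicate (N * (K * valueBits c p)) (π₁ 0))).bind fun msg =>
      leaderLoop T c lag N s (p + 1) E'
        (leaderEstimates (valueBits c p) (S.map fun a => a 0) os (msg.map Prod.snd)) π₁)
    fun j os =>
      (pulls (List.replicate ((j.val + 1 - 1) * (K * valueBits c p)) (π₁ j.succ))).bind fun _ =>
      (pulls (sendArms (π₁ j.succ) (π₁ 0)
        (followerBits (valueBits c p) (S.map fun a => a j.succ) os))).bind fun _ =>
      (pulls (List.replicate ((N - (j.val + 1)) * (K * valueBits c p)) (π₁ j.succ))).bind fun _ =>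
        followerLoop T c N (j.val + 1) s (p + 1) (π₁ j.succ)
  have hall : ∀ r, Q t r = (pulls (S.map fun a => a r)).bind (g r) := by
    intro r
    refine Fin.cases ?_ (fun j => ?_) r
    · rw [h0, leaderRest, if_neg hC, hS, exploreSchedule_map]
      simp only [g, Fin.cases_zero, hS, exploreSchedule_map]
    · obtain ⟨d1, d2, d3⟩ := decodeArm_leaderMessage π₁ C j.succ
      have hmap : (List.range C.length).map (decodeArm (leaderMessage π₁ C j.succ)) =
          C.map fun π => π j.succ := by
        apply List.ext_getElem
        · simp
        · intro i h1 h2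
          simp only [List.getElem_map, List.getElem_range]
          exact d1 i (by simpa using h2)
      rw [hj, followerEpoch, if_neg hC, hS, exploreSchedule_map, hmap, d2, d3]
      simp only [g, Fin.cases_succ, hS, exploreSchedule_map]
  obtain ⟨hb1, hb2⟩ := h.block S g t hall
  rw [hS, exploreSchedule_length] at hb1
  obtain ⟨c0, cj, cc⟩ := h.gather hπ₁ (K * valueBits c p)
    (fun j => followerBits (valueBits c p) (S.map fun a => a j.succ)
      (observations y t S j.succ)) (fun j => length_followerBits _ _ _)
    (fun bits => leaderLoop T c lag N s (p + 1) E'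
        (leaderEstimates (valueBits c p) (S.map fun a => a 0) (observations y t S 0) bits) π₁)
    (fun j => followerLoop T c N (j.val + 1) s (p + 1) (π₁ j.succ))
    (t + C.length * 2 ^ p ^ c) (hb1 0) (fun j => hb1 j.succ)
  refine ⟨⟨leaderEstimates (valueBits c p) (S.map fun a => a 0) (observations y t S 0)
    ((List.finRange N).flatMap fun j => followerBits (valueBits c p)
      (S.map fun a => a j.succ) (observations y t S j.succ)), ?_, fun k => ⟨rfl, fun j => ?_⟩⟩,
    hb2, ?_⟩
  · funext r
    refine Fin.cases c0 (fun j => ?_) r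
    exact cj j
  · change ((decodeBlock _ _ _ : ℕ) : ℝ) / _ = _
    congr 2
    exact decodeBlock_followerBits (f := fun j k => quantize (valueBits c p)
      (estimate y c p t C j.succ k)) (fun j k => quantize_lt _ _) j k
  · intro f T' b b' hb hb' hf hf'
    have e1 := h.tailCost_block S g t hall f T' hb' (fun a ha => by
      obtain ⟨π, hπ, ha'⟩ := List.mem_flatMap.1 ha
      rw [List.eq_of_mem_replicate ha']
      exact hf' π hπ)
    have e2 := cc f T' b hb hf
    rw [hS, exploreSchedule_length] at e1
    linarith

/-- The averages in terms of the rounds in which the arm has been pulled. -/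
theorem empMean_observations {M : ℕ} (y : ℕ → Fin M → Fin K → ℝ) (S : List (Fin M → Fin K))
    (hS : ∀ a ∈ S, Function.Injective a) (t : ℕ) (a : ℕ → Fin M → Fin K)
    (ha : ∀ i (hi : i < S.length), a (t + i) = S[i]) (r : Fin M) (k : Fin K) :
    empMean (S.map fun b => b r) (observations y t S r) k =
      (∑ s ∈ (Finset.Ico t (t + S.length)).filter fun s => a s r = k, y s r k) /
        ((Finset.Ico t (t + S.length)).filter fun s => a s r = k).card := by
  have key : ((((S.map fun b => b r).zip (observations y t S r)).filter fun x => x.1 = k).map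
      fun x => x.2.1).sum = (∑ s ∈ Finset.Ico t (t + S.length), if a s r = k then y s r k else 0) ∧
      ((((S.map fun b => b r).zip (observations y t S r)).filter fun x => x.1 = k).map
      fun x => x.2.1).length = ∑ s ∈ Finset.Ico t (t + S.length), if a s r = k then 1 else 0 := by
    induction S generalizing t with
    | nil => simp [observations]
    | cons b S ih =>
      have h0 : a t = b := ha 0 (by simp)
      have hlt : t < t + (b :: S).length := by simp
      have hih := ih (fun a ha => hS a (by simp [ha])) (t + 1) (fun i hi => by
        have := ha (i + 1) (by simpa using hi)
        rw [show t + 1 + i = t + (i + 1) by ring, this]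
        simp)
      have hlen : t + 1 + S.length = t + (b :: S).length := by simp; ring
      rw [hlen] at hih
      rw [Finset.sum_eq_sum_Ico_succ_bot hlt, Finset.sum_eq_sum_Ico_succ_bot hlt, ← hih.1, ← hih.2,
        h0]
      by_cases hk : b r = k
      · simp [observations, hk, rewards_of_injective _ (hS b (by simp)), add_comm]
      · simp [observations, hk]
  simp only [empMean]
  rw [key.1, key.2, Finset.sum_filter, Finset.card_filter]

end Epoch


/-! ## Candidate matchings -/

section Choice

variable {K n : ℕ}

theorem bestMatching_spec [NeZero K] (w : Fin n → Fin K → ℝ) {Q : (Fin n → Fin K) → Prop}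
    (h : ∃ π, Function.Injective π ∧ Q π) :
    (Function.Injective (bestMatching w Q) ∧ Q (bestMatching w Q)) ∧
      ∀ π, Function.Injective π → Q π → weight w π ≤ weight w (bestMatching w Q) := by
  classical
  unfold bestMatching
  set l := (Finset.univ : Finset (Fin n → Fin K)).toList.filter
    fun π => Function.Injective π ∧ Q π with hl
  have hmem : ∀ π, π ∈ l ↔ Function.Injective π ∧ Q π := by
    intro π
    simp [hl]
  obtain ⟨π₀, h₀⟩ := h
  cases ha : l.argmax (weight w) with
  | none =>
    rw [List.argmax_eq_none] at ha
    have := (hmem π₀).2 h₀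
    rw [ha] at this
    simp at this
  | some π =>
    have hπ : π ∈ l.argmax (weight w) := ha
    refine ⟨(hmem π).1 (List.argmax_mem hπ), fun π' h1 h2 => ?_⟩
    exact List.le_of_mem_argmax ((hmem π').2 ⟨h1, h2⟩) hπ

/-- Composing any matching with a transposition moves `m` to `k`; so every edge has an associated
matching. -/
theorem exists_injective_apply_eq (hn : n ≤ K) (m : Fin n) (k : Fin K) :
    ∃ π : Fin n → Fin K, Function.Injective π ∧ π m = k :=
  ⟨fun i => Equiv.swap (Fin.castLE hn m) k (Fin.castLE hn i),
    (Equiv.injective _).comp (Fin.castLE_injective hn), by simp⟩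

/-- The properties of the choice of the leader. -/
theorem leaderChoice_spec [NeZero K] (hn : n ≤ K) (hpos : 0 < n) {θ : ℝ}
    {E : Finset (Fin n × Fin K)} {w : Fin n → Fin K → ℝ} {π₁ : Fin n → Fin K}
    {E' : Finset (Fin n × Fin K)} {C : List (Fin n → Fin K)}
    (hd : leaderChoice θ E w = (π₁, E', C)) :
    Function.Injective π₁ ∧ (∀ π, Function.Injective π → weight w π ≤ weight w π₁) ∧
    (∀ π ∈ C, Function.Injective π ∧ weight w π₁ - weight w π ≤ θ) ∧
    C.length ≤ n * K ∧ C.Nodup ∧ (∀ e ∈ E', ∃ π ∈ C, π e.1 = e.2) ∧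
    (∀ e ∈ E, ∀ π, Function.Injective π → π e.1 = e.2 → weight w π₁ - weight w π ≤ θ →
      e ∈ E') := by
  unfold leaderChoice at hd
  simp only [Prod.mk.injEq] at hd
  obtain ⟨h1, h2, h3⟩ := hd
  obtain ⟨π₀, h₀, -⟩ := exists_injective_apply_eq hn ⟨0, hpos⟩ 0
  obtain ⟨⟨s1, -⟩, s2⟩ := bestMatching_spec w (Q := fun _ => True) ⟨π₀, h₀, trivial⟩
  rw [h1] at s1 s2 h2 h3
  have sa : ∀ e : Fin n × Fin K, _ := fun e =>
    bestMatching_spec w (Q := fun π => π e.1 = e.2) (exists_injective_apply_eq hn e.1 e.2)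
  rw [h2] at h3
  have hE' : ∀ e, e ∈ E' ↔ e ∈ E ∧
      weight w π₁ - weight w (bestMatching w fun π => π e.1 = e.2) ≤ θ := by
    intro e
    rw [← h2, Finset.mem_filter]
  have hC : ∀ π, π ∈ C ↔ ∃ e ∈ E', (bestMatching w fun π => π e.1 = e.2) = π := by
    intro π
    rw [← h3, List.mem_dedup, List.mem_map]
    simp only [Finset.mem_toList]
  refine ⟨s1, fun π hπ => s2 π hπ trivial, ?_, ?_, ?_, ?_, ?_⟩
  · intro π hπ
    obtain ⟨e, he, rfl⟩ := (hC π).1 hπ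
    exact ⟨(sa e).1.1, ((hE' e).1 he).2⟩
  · rw [← h3]
    refine (List.dedup_sublist _).length_le.trans ?_
    rw [List.length_map, Finset.length_toList]
    calc E'.card ≤ (Finset.univ : Finset (Fin n × Fin K)).card :=
          Finset.card_le_card (Finset.subset_univ _)
      _ = n * K := by simp
  · rw [← h3]
    exact List.nodup_dedup _
  · intro e he
    exact ⟨_, (hC _).2 ⟨e, he, rfl⟩, (sa e).1.2⟩
  · intro e he π hπ hπe hw
    refine (hE' e).2 ⟨he, ?_⟩
    have := (sa e).2 π hπ hπe
    linarith

theorem weight_le_add {w w' : Fin n → Fin K → ℝ} {π : Fin n → Fin K} {b : ℝ}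
    (h : ∀ m, w m (π m) ≤ w' m (π m) + b) : weight w π ≤ weight w' π + n * b := by
  unfold weight
  calc ∑ m, w m (π m) ≤ ∑ m, (w' m (π m) + b) := Finset.sum_le_sum fun m _ => h m
    _ = ∑ m, w' m (π m) + n * b := by simp [Finset.sum_add_distrib]

theorem meanReward_of_injective (μ : Fin n → Fin K → ℝ) {π : Fin n → Fin K}
    (h : Function.Injective π) : meanReward μ π = weight μ π := by
  simp only [meanReward, weight, rewards_of_injective μ h]

/-- Sending a bit costs at most `2`. -/
theorem weight_le_meanReward_bitArms {μ : Fin n → Fin K → ℝ}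
    (hμ : ∀ m k, μ m k ∈ Set.Icc (0 : ℝ) 1) {κ : Fin n → Fin K} (hκ : Function.Injective κ)
    (s r : Fin n) (β : Bool) :
    weight μ κ ≤ meanReward μ (bitArms κ s r β) + 2 := by
  -- Only the sender and the receiver of a bit can lose reward, at most `1` each.
  have h2 : (2 : ℝ) = ∑ m : Fin n, ((if m = s then 1 else 0) + if m = r then 1 else 0) := by
    rw [Finset.sum_add_distrib]
    simp
    norm_num
  rw [h2, meanReward, ← Finset.sum_add_distrib, weight]
  refine Finset.sum_le_sum fun m _ => ?_
  have h0 := (rewards_mem_Icc hμ (bitArms κ s r β) m).1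
  have h1 := (hμ m (κ m)).2
  by_cases hms : m = s
  · simp only [hms, if_true]
    rw [hms] at h0 h1
    split_ifs <;> linarith
  by_cases hmr : m = r
  · simp only [hmr, if_true]
    rw [hmr] at h0 h1
    split_ifs <;> linarith
  · have hc : collides (bitArms κ s r β) m = false := by
      simp only [collides, decide_eq_false_iff_not]
      rintro ⟨m', h3, h4⟩
      rw [bitArms_apply_of_ne κ hms] at h4
      by_cases hm's : m' = s
      · rw [hm's, bitArms_apply_self] at h4
        split_ifs at h4
        · exact hmr (hκ h4).symm
        · exact hms (hκ h4).symm
      · rw [bitArms_apply_of_ne κ hm's] at h4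
        exact h3 (hκ h4)
    simp [rewards, hc, bitArms_apply_of_ne κ hms, hms, hmr]

end Choice

/-! ## Precision of the estimates -/

section Estimates

variable {K n : ℕ}

theorem quantize_div_le (b : ℕ) {x : ℝ} (hx : 0 ≤ x) : (quantize b x : ℝ) / 2 ^ b ≤ x := by
  rw [div_le_iff₀ (by positivity)]
  calc (quantize b x : ℝ) ≤ (⌊(2 : ℝ) ^ b * x⌋₊ : ℝ) := by
        exact Nat.cast_le.2 (min_le_left _ _)
    _ ≤ 2 ^ b * x := Nat.floor_le (by positivity)
    _ = x * 2 ^ b := mul_comm _ _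

theorem le_quantize_div_add (b : ℕ) {x : ℝ} (hx1 : x ≤ 1) :
    x ≤ (quantize b x : ℝ) / 2 ^ b + ((2 : ℝ) ^ b)⁻¹ := by
  have hp : (0 : ℝ) < 2 ^ b := by positivity
  have h : (2 : ℝ) ^ b * x ≤ quantize b x + 1 := by
    unfold quantize
    rcases min_choice ⌊(2 : ℝ) ^ b * x⌋₊ (2 ^ b - 1) with h | h
    · rw [h]
      exact (Nat.lt_floor_add_one _).le
    · rw [h, Nat.cast_sub Nat.one_le_two_pow]
      push_cast
      nlinarith
  rw [← one_div, ← add_div, le_div_iff₀ hp]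
  linarith

theorem two_pow_le_card_explore {M : ℕ} {c p t : ℕ} {C : List (Fin M → Fin K)}
    {a : ℕ → Fin M → Fin K}
    (ha : ∀ i (hi : i < (exploreSchedule c p C).length), a (t + i) = (exploreSchedule c p C)[i])
    {π : Fin M → Fin K} (hπ : π ∈ C) (r : Fin M) :
    2 ^ p ^ c ≤ ((Finset.Ico t (t + C.length * 2 ^ p ^ c)).filter fun s => a s r = π r).card := by
  obtain ⟨i, hi, rfl⟩ := List.mem_iff_getElem.1 hπ
  set b := 2 ^ p ^ c with hb
  have hblock := take_drop_flatMap (f := fun π : Fin M → Fin K => List.replicate b π) (b := b)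
    (fun _ _ => by simp) hi
  have hib : (i + 1) * b ≤ C.length * b := Nat.mul_le_mul_right b hi
  have hib' : (i + 1) * b = i * b + b := by ring
  have hlen : (exploreSchedule c p C).length = C.length * b := exploreSchedule_length c p C
  have hget : ∀ j < b, a (t + (i * b + j)) = C[i] := by
    intro j hj
    rw [ha (i * b + j) (by rw [hlen]; omega)]
    have h1 : ((C.flatMap fun π => List.replicate b π).drop (i * b)).take b =
      List.replicate b C[i] := hblock
    have h2 : (((C.flatMap fun π => List.replicate b π).drop (i * b)).take b)[j]? = some C[i] := by
      rw [h1]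
      simp [hj]
    rw [List.getElem?_take_of_lt hj, List.getElem?_drop] at h2
    exact (List.getElem_eq_iff _).2 h2
  calc b = (Finset.Ico (t + i * b) (t + i * b + b)).card := by simp
    _ ≤ _ := Finset.card_le_card fun s hs => by
      rw [Finset.mem_Ico] at hs
      rw [Finset.mem_filter, Finset.mem_Ico]
      refine ⟨⟨by omega, by omega⟩, ?_⟩
      have := hget (s - (t + i * b)) (by omega)
      rw [show t + (i * b + (s - (t + i * b))) = s by omega] at this
      rw [this]

/-- An unexplored arm has estimate `0`, which is never too large; thus the upper bound holds for all
arms, and only the lower bound requires a candidate through the edge. An edge shared by several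
candidates is pulled more than `2 ^ p ^ c` times, which is why `WellEstimated` only asks for a
minimal number of pulls. -/
theorem estimate_bounds {M : ℕ} {μ : Fin M → Fin K → ℝ} (hμ : ∀ m k, μ m k ∈ Set.Icc (0 : ℝ) 1)
    {y : ℕ → Fin M → Fin K → ℝ} (hy : ∀ t m k, y t m k ∈ Set.Icc (0 : ℝ) 1)
    {ε : ℕ → ℝ} {c p t T : ℕ} {C : List (Fin M → Fin K)} {a : ℕ → Fin M → Fin K}
    (hwell : WellEstimated μ ε c T y a) (hε : 0 ≤ ε p) (hp : 1 ≤ p)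
    (hC : ∀ π ∈ C, Function.Injective π) (hC0 : C ≠ []) (hCM : C.length ≤ M * K)
    (ht : t + C.length * 2 ^ p ^ c ≤ T)
    (ha : ∀ i (hi : i < (exploreSchedule c p C).length), a (t + i) = (exploreSchedule c p C)[i])
    (r : Fin M) (k : Fin K) :
    estimate y c p t C r k ∈ Set.Icc (0 : ℝ) 1 ∧ estimate y c p t C r k ≤ μ r k + ε p ∧
    ((∃ π ∈ C, π r = k) → μ r k - ε p ≤ estimate y c p t C r k) := by
  have hS : ∀ b ∈ exploreSchedule c p C, Function.Injective b := by
    intro b hb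
    obtain ⟨π, hπ, hb'⟩ := List.mem_flatMap.1 hb
    rw [List.eq_of_mem_replicate hb']
    exact hC π hπ
  have hest := empMean_observations y _ hS t a ha r k
  rw [exploreSchedule_length] at hest
  rw [estimate, hest]
  set F := (Finset.Ico t (t + C.length * 2 ^ p ^ c)).filter fun s => a s r = k with hF
  have hmem : (∑ s ∈ F, y s r k) / F.card ∈ Set.Icc (0 : ℝ) 1 := by
    constructor
    · exact div_nonneg (Finset.sum_nonneg fun s _ => (hy s r k).1) (Nat.cast_nonneg _)
    · refine div_le_one_of_le₀ ?_ (Nat.cast_nonneg _)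
      calc ∑ s ∈ F, y s r k ≤ ∑ s ∈ F, (1 : ℝ) := Finset.sum_le_sum fun s _ => (hy s r k).2
        _ = F.card := by simp
  refine ⟨hmem, ?_⟩
  by_cases hex : ∃ π ∈ C, π r = k
  · obtain ⟨π, hπ, hπk⟩ := hex
    have hcard : 2 ^ p ^ c ≤ F.card := by
      rw [hF, ← hπk]
      exact two_pow_le_card_explore ha hπ r
    have hpos : (0 : ℝ) < F.card := by
      exact_mod_cast lt_of_lt_of_le (Nat.two_pow_pos _) hcard
    have hdev := hwell p t C.length r k hp (List.length_pos_iff.2 hC0) hCM ht hcard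
    rw [← hF, Finset.sum_sub_distrib, Finset.sum_const, nsmul_eq_mul, abs_le] at hdev
    constructor
    · rw [div_le_iff₀ hpos]
      nlinarith
    · intro _
      rw [le_div_iff₀ hpos]
      nlinarith
  · refine ⟨?_, fun h => absurd h hex⟩
    have hempty : F = ∅ := by
      rw [hF, Finset.filter_eq_empty_iff]
      intro s hs hsk
      rw [Finset.mem_Ico] at hs
      have h1 := ha (s - t) (by rw [exploreSchedule_length]; omega)
      rw [show t + (s - t) = s by omega] at h1
      have h2 : a s ∈ exploreSchedule c p C := by
        rw [h1]
        exact List.getElem_mem _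
      obtain ⟨π, hπ, hb'⟩ := List.mem_flatMap.1 h2
      rw [List.eq_of_mem_replicate hb'] at hsk
      exact hex ⟨π, hπ, hsk⟩
    rw [hempty]
    have := (hμ r k).1
    simp
    linarith

end Estimates


/-! ## Cost of the epochs -/

section Epochs

variable {K N : ℕ}

/-- What the estimates guarantee at the beginning of epoch `p`, when the estimates have
precision `ε` and the truncation errors are `τ`. -/
structure EpochInv {n : ℕ} (μ : Fin n → Fin K → ℝ) (Us : ℝ) (ε τ : ℕ → ℝ) (p : ℕ)
    (E : Finset (Fin n × Fin K)) (w : Fin n → Fin K → ℝ) (κ : Fin n → Fin K) : Prop where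
  injective : Function.Injective κ
  loss_le : Us - weight μ κ ≤ 8 * n * ε (p - 2)
  mem : ∀ π, Function.Injective π → weight μ π = Us → ∀ m, (m, π m) ∈ E
  le_add : ∀ m k, w m k ≤ μ m k + ε (p - 1)
  sub_le : ∀ π, Function.Injective π → weight μ π = Us → ∀ m,
    μ m (π m) - ε (p - 1) - τ (p - 1) ≤ w m (π m)

/-- Write `ε`, `τ` for their values at `p - 1`. Maximum matchings have estimated weight at least `Us
- n (ε + τ)`, and no matching exceeds `Us + n ε`. The estimated deficit of a maximum matching is
therefore at most `n (2 ε + τ)`, which `hτ` places below the threshold, so its edges survive.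
Conversely, a matching that passes the test loses at most the threshold plus `n (2 ε + τ)`, hence at
most twice the threshold. -/
theorem EpochInv.candidates [NeZero K] {n : ℕ} (hn : n ≤ K) (hpos : 0 < n)
    {μ : Fin n → Fin K → ℝ} {Us : ℝ} {ε τ : ℕ → ℝ} {p lag : ℕ}
    {E : Finset (Fin n × Fin K)} {w : Fin n → Fin K → ℝ} {κ : Fin n → Fin K}
    (hI : EpochInv μ Us ε τ p E w κ) (hle : ∀ π, Function.Injective π → weight μ π ≤ Us)
    (hopt : ∃ π, Function.Injective π ∧ weight μ π = Us)
    (hε : 0 ≤ ε (p - lag))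
    (hτ : 2 * ε (p - 1) + τ (p - 1) ≤ 4 * ε (p - lag)) (hlag : ε (p - lag) ≤ ε (p - 1))
    {π₁ : Fin n → Fin K} {E' : Finset (Fin n × Fin K)} {C : List (Fin n → Fin K)}
    (hd : leaderChoice (4 * (n : ℝ) * ε (p - lag)) E w = (π₁, E', C)) :
    (Function.Injective π₁ ∧ Us - weight μ π₁ ≤ 8 * n * ε (p - 1)) ∧
    (∀ π ∈ C, Function.Injective π ∧ Us - weight μ π ≤ 8 * n * ε (p - 1)) ∧
    (∀ π, Function.Injective π → weight μ π = Us → ∀ m, (m, π m) ∈ E' ∧ ∃ π' ∈ C, π' m = π m) ∧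
    C ≠ [] ∧ C.length ≤ n * K ∧ C.Nodup := by
  obtain ⟨s1, s2, s3, s4, s5, s6, s7⟩ := leaderChoice_spec hn hpos hd
  have hn0 : (0 : ℝ) ≤ n := Nat.cast_nonneg n
  have hup : ∀ π : Fin n → Fin K, weight w π ≤ weight μ π + n * ε (p - 1) := fun π =>
    weight_le_add fun m => hI.le_add m (π m)
  have hlow : ∀ π, Function.Injective π → weight μ π = Us →
      Us ≤ weight w π + n * (ε (p - 1) + τ (p - 1)) := fun π h1 h2 => by
    rw [← h2]
    refine weight_le_add fun m => ?_
    have := hI.sub_le π h1 h2 m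
    linarith
  have hnτ := mul_le_mul_of_nonneg_left hτ hn0
  have hnl := mul_le_mul_of_nonneg_left hlag hn0
  obtain ⟨π₀, h₀, h₀'⟩ := hopt
  have hgood : ∀ π, Function.Injective π → weight w π₁ - weight w π ≤ 4 * n * ε (p - lag) →
      Us - weight μ π ≤ 8 * n * ε (p - 1) := by
    intro π _ h2
    have h3 := hup π
    have h4 := hlow π₀ h₀ h₀'
    have h5 := s2 π₀ h₀
    linarith
  have hE' : ∀ π, Function.Injective π → weight μ π = Us → ∀ m, (m, π m) ∈ E' := by
    intro π h1 h2 m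
    refine s7 _ (hI.mem π h1 h2 m) π h1 rfl ?_
    have h3 := hup π₁
    have h4 := hle π₁ s1
    have h5 := hlow π h1 h2
    linarith
  have hcov := fun π h1 h2 m => s6 _ (hE' π h1 h2 m)
  refine ⟨⟨s1, hgood π₁ s1 (by rw [sub_self]; positivity)⟩, fun π hπ => ⟨(s3 π hπ).1, hgood π (s3 π hπ).1 (s3 π hπ).2⟩,
    fun π h1 h2 m => ⟨hE' π h1 h2 m, hcov π h1 h2 m⟩, ?_, s4, s5⟩
  · obtain ⟨π', h', -⟩ := hcov π₀ h₀ h₀' ⟨0, hpos⟩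
    exact List.ne_nil_of_mem h'

/-- Elimination leaves a single candidate once only the optimal matching has a small loss. -/
theorem length_eq_one_of_unique {n : ℕ} {C : List (Fin n → Fin K)} (hne : C ≠ [])
    (hnd : C.Nodup) {π : Fin n → Fin K} (h : ∀ π' ∈ C, π' = π) : C.length = 1 := by
  cases C with
  | nil => exact absurd rfl hne
  | cons a l =>
    cases l with
    | nil => rfl
    | cons b l =>
      exfalso
      rw [List.nodup_cons] at hnd
      have h1 := h a (by simp)
      have h2 := h b (by simp)
      exact hnd.1 (by simp [h1, h2])

/-- The cost of the epochs `p, …, q` when the losses are at most `a` during the explorations and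
at most `ρ` during the communications. -/
noncomputable def epochsCost (N K c : ℕ) (a ρ : ℕ → ℝ) (s : Finset ℕ) : ℝ :=
  ∑ q ∈ s, (((N + 1) * K * 2 ^ q ^ c : ℕ) * a q +
    (announceBits N K ((N + 1) * K) + N * (K * valueBits c q) : ℕ) * ρ q)

theorem announceBits_mono {L L' : ℕ} (h : L ≤ L') : announceBits N K L ≤ announceBits N K L' := by
  unfold announceBits
  gcongr

theorem epochsCost_nonneg {c : ℕ} {a ρ : ℕ → ℝ} (ha : ∀ q, 0 ≤ a q) (hρ : ∀ q, 0 ≤ ρ q)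
    (s : Finset ℕ) : 0 ≤ epochsCost N K c a ρ s :=
  Finset.sum_nonneg fun q _ => by
    have := ha q
    have := hρ q
    positivity

/-- A loss `e'` per round is deducted beforehand; explorations may lose `a q` and communications `ρ
q` beyond it. This freedom lets the same induction serve the gap-dependent and the minimax bounds.
`P` is the last epoch that can matter: by `HP`, its exploration would fill the horizon, or it has a
single candidate. The invariant is required only when `t < T`, since windows beyond the horizon are
not controlled. -/
theorem tailCost_epochState_le [NeZero K] (hN : N + 1 ≤ K) {y : ℕ → Fin (N + 1) → Fin K → ℝ}
    {u : ℕ → Fin (N + 1) → Fin K} {Q : ℕ → Fin (N + 1) → Prog K Unit} (h : IsRun y u Q)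
    {T c lag : ℕ} {μ : Fin (N + 1) → Fin K → ℝ} {Us : ℝ} {τ a ρ : ℕ → ℝ} {e' : ℝ} {P : ℕ}
    (hμ : ∀ m k, μ m k ∈ Set.Icc (0 : ℝ) 1) (hy : ∀ t m k, y t m k ∈ Set.Icc (0 : ℝ) 1)
    (hwell : WellEstimated μ (eps (N + 1) K T c) c T y (runArms u Q))
    (hle : ∀ π, Function.Injective π → weight μ π ≤ Us)
    (hopt : ∃ π, Function.Injective π ∧ weight μ π = Us)
    (hε0 : ∀ p, 0 ≤ eps (N + 1) K T c p) (hεa : Antitone (eps (N + 1) K T c))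
    (hτ' : ∀ p, 1 ≤ p → ((2 : ℝ) ^ valueBits c p)⁻¹ ≤ τ p)
    (hτ : ∀ p, 1 ≤ p → 2 * eps (N + 1) K T c (p - 1) + τ (p - 1) ≤
      4 * eps (N + 1) K T c (p - lag))
    (hlag : ∀ p, 1 ≤ p → eps (N + 1) K T c (p - lag) ≤ eps (N + 1) K T c (p - 1))
    (he' : 0 ≤ e') (ha : ∀ q, 0 ≤ a q) (hρ : ∀ q, 0 ≤ ρ q)
    (H1 : ∀ q, 1 ≤ q → ∀ π, Function.Injective π →
      Us - weight μ π ≤ 8 * (N + 1 : ℕ) * eps (N + 1) K T c (q - 1) →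
      Us - weight μ π ≤ e' + a q)
    (H2 : ∀ q, 1 ≤ q → ∀ π, Function.Injective π →
      Us - weight μ π ≤ 8 * (N + 1 : ℕ) * eps (N + 1) K T c (q - 2) →
      2 + (Us - weight μ π) ≤ e' + ρ q)
    (HP : T ≤ 2 ^ P ^ c ∨ ∃ π₀, ∀ π, Function.Injective π →
      Us - weight μ π ≤ 8 * (N + 1 : ℕ) * eps (N + 1) K T c (P - 1) → π = π₀)
    (s : ℕ) : ∀ (p t : ℕ) (E : Finset (Fin (N + 1) × Fin K)) (w : Fin (N + 1) → Fin K → ℝ)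
      (κ : Fin (N + 1) → Fin K), 1 ≤ p → T ≤ s + t → Q t = epochState T c lag s p E w κ →
      (t < T → EpochInv μ Us (eps (N + 1) K T c) τ p E w κ ∧ p ≤ P) →
      tailCost (fun b => Us - meanReward μ b - e') u Q T t ≤
        epochsCost N K c a ρ (Finset.Ico p (P + 1)) := by
  set ε := eps (N + 1) K T c with hε
  set f : (Fin (N + 1) → Fin K) → ℝ := fun b => Us - meanReward μ b - e' with hf
  induction s with
  | zero =>
    intro p t E w κ _ hT _ _
    rw [tailCost_of_le f u Q (by omega)]
    exact epochsCost_nonneg ha hρ _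
  | succ s ih =>
    intro p t E w κ hp hT hQ hI
    by_cases htT : T ≤ t
    · rw [tailCost_of_le f u Q htT]
      exact epochsCost_nonneg ha hρ _
    obtain ⟨hI, hpP⟩ := hI (by omega)
    have hsplit : epochsCost N K c a ρ (Finset.Ico p (P + 1)) =
        (((N + 1) * K * 2 ^ p ^ c : ℕ) * a p +
          ((announceBits N K ((N + 1) * K) : ℝ) * ρ p + (N * (K * valueBits c p) : ℕ) * ρ p)) +
        epochsCost N K c a ρ (Finset.Ico (p + 1) (P + 1)) := by
      unfold epochsCost
      rw [Finset.sum_eq_sum_Ico_succ_bot (by omega), ← add_mul, ← Nat.cast_add]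
    have hrest := epochsCost_nonneg (N := N) (K := K) (c := c) ha hρ (Finset.Ico (p + 1) (P + 1))
    obtain ⟨π₁, E', C, hd⟩ : ∃ π₁ E' C,
        leaderChoice (4 * ((N + 1 : ℕ) : ℝ) * ε (p - lag)) E w = (π₁, E', C) := ⟨_, _, _, rfl⟩
    obtain ⟨⟨c1, c1'⟩, c2, c3, c4, c5, c6⟩ := hI.candidates hN (Nat.succ_pos N) hle hopt
      (hε0 _) (hτ p hp) (hlag p hp) hd
    obtain ⟨⟨h0, hj⟩, hcost⟩ := h.announce hI.injective hQ hd
      (c5.trans_lt (Nat.lt_size_self _))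
    set A := announceBits N K C.length with hA
    have hfκ : ∀ κ, Function.Injective κ → Us - weight μ κ ≤ 8 * (N + 1 : ℕ) * ε (p - 2) →
        ∀ s r β, s ≠ r → f (bitArms κ s r β) ≤ ρ p := by
      intro κ hκ hκ' s r β _
      have h1 := weight_le_meanReward_bitArms hμ hκ s r β
      have h2 := H2 p hp κ hκ hκ'
      simp only [hf]
      linarith
    have hcost' := hcost f T (ρ p) (hρ p) (hfκ κ hI.injective hI.loss_le)
    have hAle : (A : ℝ) * ρ p ≤ announceBits N K ((N + 1) * K) * ρ p :=
      mul_le_mul_of_nonneg_right (Nat.cast_le.2 (announceBits_mono c5)) (hρ p)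
    have hex0 : (0 : ℝ) ≤ ((N + 1) * K * 2 ^ p ^ c : ℕ) * a p :=
      mul_nonneg (Nat.cast_nonneg _) (ha p)
    have hco0 : (0 : ℝ) ≤ (N * (K * valueBits c p) : ℕ) * ρ p :=
      mul_nonneg (Nat.cast_nonneg _) (hρ p)
    rw [hsplit]
    by_cases hC1 : C.length = 1
    -- Every edge of a maximum matching lies in some candidate, so the only candidate is that
    -- matching. It is pulled for `T` rounds, hence up to the horizon, without loss.
    · obtain ⟨π, rfl⟩ := List.length_eq_one_iff.1 hC1
      have hexp := h.exploit h0 hj rfl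
      obtain ⟨π₀, o1, o2⟩ := hopt
      have hππ₀ : π = π₀ := by
        funext m
        obtain ⟨π', hπ', h2⟩ := (c3 π₀ o1 o2 m).2
        rw [List.mem_singleton] at hπ'
        rw [← h2, hπ']
      have := tailCost_le_add f u Q T (t + A) T le_rfl fun i hi => by
        rw [hexp i hi, hππ₀]
        simp only [hf]
        rw [meanReward_of_injective μ o1, o2]
        linarith
      rw [tailCost_of_le f u Q (show T ≤ t + A + T by omega)] at this
      linarith
    · obtain ⟨⟨w', hQ', hw'⟩, hsched, hcostE⟩ := h.explore c1 h0 hj hC1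
      have hεle : ε (p - 1) ≤ ε (p - 2) := hεa (by omega)
      have hcE := hcostE f T (ρ p) (a p) (hρ p) (ha p)
        (hfκ π₁ c1 (c1'.trans (by gcongr))) fun π hπ => by
          have h1 := H1 p hp π (c2 π hπ).1 (c2 π hπ).2
          simp only [hf]
          rw [meanReward_of_injective μ (c2 π hπ).1]
          linarith
      -- There is at least one candidate, so the exploration takes at least one round and the fuel
      -- `s` still covers the remaining ones.
      have hnext := ih (p + 1) _ E' w' π₁ (by omega) (by
        have : 0 < C.length * 2 ^ p ^ c :=
          Nat.mul_pos (List.length_pos_iff.2 c4) (Nat.two_pow_pos _)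
        omega) hQ' (fun hlt => by
          -- The next epoch begins before the horizon, so the whole exploration window lies before
          -- it and `hwell` applies.
          have hlen : t + A + C.length * 2 ^ p ^ c ≤ T := by omega
          have hb := estimate_bounds hμ hy hwell (hε0 p) hp (fun π hπ => (c2 π hπ).1) c4 c5
            hlen hsched
          refine ⟨⟨c1, c1', fun π h1 h2 m => (c3 π h1 h2 m).1, ?_, ?_⟩, ?_⟩
          · intro m k
            refine Fin.cases ?_ (fun j => ?_) m
            · rw [(hw' k).1]
              exact (hb 0 k).2.1
            · rw [(hw' k).2 j]
              exact (quantize_div_le _ (hb j.succ k).1.1).trans (hb j.succ k).2.1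
          · intro π h1 h2 m
            have hlo := (hb m (π m)).2.2 (c3 π h1 h2 m).2
            have htr := hτ' p hp
            have hpos : (0 : ℝ) < ((2 : ℝ) ^ valueBits c p)⁻¹ := by positivity
            simp only [Nat.add_sub_cancel]
            revert hlo
            refine Fin.cases (fun hlo => ?_) (fun j hlo => ?_) m
            · rw [(hw' _).1]
              linarith
            · rw [(hw' _).2 j]
              have := le_quantize_div_add (valueBits c p) (hb j.succ (π j.succ)).1.2
              linarith
          -- Epoch `P` has no successor within the horizon: either its exploration fills the
          -- horizon, or it had one candidate only, contrary to `hC1`.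
          · by_contra hPp
            have hpP' : p = P := by omega
            rcases HP with HP | ⟨π₀, HP⟩
            · rw [← hpP'] at HP
              have : 1 * 2 ^ p ^ c ≤ C.length * 2 ^ p ^ c :=
                Nat.mul_le_mul_right _ (List.length_pos_iff.2 c4)
              omega
            · rw [← hpP'] at HP
              exact hC1 (length_eq_one_of_unique c4 c6 fun π hπ =>
                HP π (c2 π hπ).1 (c2 π hπ).2))
      have hlenle : ((C.length * 2 ^ p ^ c : ℕ) : ℝ) * a p ≤
          ((N + 1) * K * 2 ^ p ^ c : ℕ) * a p :=
        mul_le_mul_of_nonneg_right (Nat.cast_le.2 (Nat.mul_le_mul_right _ c5)) (ha p)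
      linarith

/-- Here `1 - 1` and `1 - 2` are both `0`, and a radius `ε 0 ≥ 1` makes the null estimates and
arbitrary communication arms admissible. -/
theorem epochInv_one {n : ℕ} {μ : Fin n → Fin K → ℝ} (hμ : ∀ m k, μ m k ∈ Set.Icc (0 : ℝ) 1)
    {Us : ℝ} (hUs : Us ≤ n) {ε τ : ℕ → ℝ} (hε : 1 ≤ ε 0) (hτ : 0 ≤ τ 0) {κ : Fin n → Fin K}
    (hκ : Function.Injective κ) :
    EpochInv μ Us ε τ 1 Finset.univ (fun _ _ => 0) κ := by
  refine ⟨hκ, ?_, fun _ _ _ _ => Finset.mem_univ _, fun m k => ?_, fun π _ _ m => ?_⟩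
  · have h1 : 0 ≤ weight μ κ := Finset.sum_nonneg fun m _ => (hμ m _).1
    have h2 : (n : ℝ) * 1 ≤ n * ε 0 := mul_le_mul_of_nonneg_left hε (Nat.cast_nonneg n)
    have h3 : (0 : ℝ) ≤ n := Nat.cast_nonneg n
    simp only [show 1 - 2 = 0 from rfl]
    linarith
  · have := (hμ m k).1
    simp only [Nat.sub_self]
    linarith
  · have := (hμ m (π m)).2
    simp only [Nat.sub_self]
    linarith

theorem fin_ofNat_injective [NeZero K] {n : ℕ} (hn : n ≤ K) :
    Function.Injective fun i : Fin n => Fin.ofNat K i.val := by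
  intro i j hij
  have h := congrArg Fin.val hij
  simp only [Fin.val_ofNat] at h
  rw [Nat.mod_eq_of_lt (i.2.trans_le hn), Nat.mod_eq_of_lt (j.2.trans_le hn)] at h
  exact Fin.ext h

end Epochs

/-! ## Maximum matchings and the gap -/

namespace Environment

variable {M K : ℕ} {Ω : Type*} [MeasurableSpace Ω] {P : Measure Ω} (B : Environment M K P)

theorem weight_le_maxUtility {π : Fin M → Fin K} (h : Function.Injective π) :
    weight B.mean π ≤ B.maxUtility :=
  le_ciSup (f := B.utility) (Set.finite_range _).bddAbove ⟨π, h⟩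

theorem exists_weight_eq_maxUtility (hMK : M ≤ K) :
    ∃ π : Fin M → Fin K, Function.Injective π ∧ weight B.mean π = B.maxUtility := by
  have : Nonempty (Fin M ↪ Fin K) := ⟨⟨Fin.castLE hMK, Fin.castLE_injective hMK⟩⟩
  obtain ⟨π, hπ⟩ := exists_eq_ciSup_of_finite (f := B.utility)
  exact ⟨π, π.injective, hπ⟩

theorem maxUtility_le [IsProbabilityMeasure P] (hMK : M ≤ K) : B.maxUtility ≤ M := by
  obtain ⟨π, -, h⟩ := B.exists_weight_eq_maxUtility hMK
  rw [← h]
  calc weight B.mean π ≤ ∑ _m : Fin M, (1 : ℝ) :=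
        Finset.sum_le_sum fun m _ => (B.mean_mem_Icc m _).2
    _ = M := by simp

theorem weight_eq_of_gap_eq_top (h : B.gap = ⊤) {π : Fin M → Fin K}
    (hπ : Function.Injective π) : weight B.mean π = B.maxUtility := by
  refine le_antisymm (B.weight_le_maxUtility hπ) (le_of_not_gt fun hlt => ?_)
  have h2 : B.gap ≤ ENNReal.ofReal (B.maxUtility - B.utility ⟨π, hπ⟩) :=
    iInf₂_le (⟨π, hπ⟩ : Fin M ↪ Fin K) (sub_pos.2 hlt)
  rw [h] at h2
  exact absurd h2 (by simp)

theorem gap_toReal_le {π : Fin M → Fin K} (hπ : Function.Injective π)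
    (hne : weight B.mean π ≠ B.maxUtility) :
    B.gap.toReal ≤ B.maxUtility - weight B.mean π := by
  have hlt : 0 < B.maxUtility - B.utility ⟨π, hπ⟩ :=
    sub_pos.2 (lt_of_le_of_ne (B.weight_le_maxUtility hπ) hne)
  have h2 : B.gap ≤ ENNReal.ofReal (B.maxUtility - B.utility ⟨π, hπ⟩) :=
    iInf₂_le (⟨π, hπ⟩ : Fin M ↪ Fin K) hlt
  exact ENNReal.toReal_le_of_le_ofReal hlt.le h2

theorem exists_gap_eq (h : B.gap ≠ ⊤) : ∃ π : Fin M → Fin K, Function.Injective π ∧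
    0 < B.gap.toReal ∧ B.gap.toReal = B.maxUtility - weight B.mean π := by
  have hne : Nonempty (Fin M ↪ Fin K) := by
    by_contra hemp
    rw [not_nonempty_iff] at hemp
    exact h (by simp [gap])
  obtain ⟨π, hπ⟩ := exists_eq_ciInf_of_finite (f := fun π : Fin M ↪ Fin K =>
    ⨅ (_ : 0 < B.maxUtility - B.utility π), ENNReal.ofReal (B.maxUtility - B.utility π))
  have hg : B.gap = ⨅ (_ : 0 < B.maxUtility - B.utility π),
    ENNReal.ofReal (B.maxUtility - B.utility π) := hπ.symm
  by_cases hpos : 0 < B.maxUtility - B.utility π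
  · rw [iInf_pos hpos] at hg
    have e : B.gap.toReal = B.maxUtility - B.utility π := by
      rw [hg, ENNReal.toReal_ofReal hpos.le]
    exact ⟨π, π.injective, by rw [e]; exact hpos, e⟩
  · rw [iInf_neg hpos] at hg
    exact absurd hg h

theorem gap_toReal_pos (h : B.gap ≠ ⊤) : 0 < B.gap.toReal :=
  let ⟨_, _, h, _⟩ := B.exists_gap_eq h
  h

end Environment

/-- Exchanging two arms moves at most two players, and each of them loses at most `1`. -/
theorem weight_swap_le {n K : ℕ} {μ : Fin n → Fin K → ℝ}
    (hμ : ∀ m k, μ m k ∈ Set.Icc (0 : ℝ) 1) {π : Fin n → Fin K} (hπ : Function.Injective π)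
    (i : Fin n) (k : Fin K) :
    weight μ π ≤ weight μ (fun m => Equiv.swap (π i) k (π m)) + 2 := by
  have h2 : ∑ m : Fin n, ((if m = i then 1 else 0) + if π m = k then 1 else 0 : ℝ) ≤ 2 := by
    rw [Finset.sum_add_distrib]
    have e1 : ∑ m : Fin n, (if m = i then 1 else 0 : ℝ) = 1 := by simp
    have e2 : ∑ m : Fin n, (if π m = k then 1 else 0 : ℝ) ≤ 1 := by
      rw [Finset.sum_boole]
      have hc : (Finset.univ.filter fun m => π m = k).card ≤ 1 :=
        Finset.card_le_one.2 fun a ha b hb => by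
          rw [Finset.mem_filter] at ha hb
          exact hπ (ha.2.trans hb.2.symm)
      exact_mod_cast hc
    linarith
  refine le_trans ?_ (add_le_add_right h2 _)
  unfold weight
  rw [← Finset.sum_add_distrib]
  refine Finset.sum_le_sum fun m _ => ?_
  have h0 := (hμ m (Equiv.swap (π i) k (π m))).1
  have h1 := (hμ m (π m)).2
  by_cases hm : m = i
  · rw [if_pos hm]
    split_ifs <;> linarith
  by_cases hk : π m = k
  · rw [if_pos hk, if_neg hm]
    linarith
  · beta_reduce
    rw [if_neg hm, if_neg hk, Equiv.swap_apply_of_ne_of_ne (fun e => hm (hπ e)) hk]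
    linarith

namespace Environment

variable {M K : ℕ} {Ω : Type*} [MeasurableSpace Ω] {P : Measure Ω} (B : Environment M K P)

/-- Walk from a maximum matching to one that realizes the gap by exchanging two arms at a time. Each
exchange costs at most `2`; were the gap larger, every matching on the way would stay maximum,
including the last. The induction is on the number of players on which the two matchings differ. -/
theorem gap_toReal_le_two [IsProbabilityMeasure P] (hMK : M ≤ K) (h : B.gap ≠ ⊤) :
    B.gap.toReal ≤ 2 := by
  classical
  obtain ⟨π', hπ', hpos, he⟩ := B.exists_gap_eq h
  by_contra! hgt
  have hopt : ∀ d : ℕ, ∀ π : Fin M → Fin K, Function.Injective π →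
      weight B.mean π = B.maxUtility →
      (Finset.univ.filter fun m => π m ≠ π' m).card ≤ d → False := by
    intro d
    induction d with
    | zero =>
      intro π _ h2 h3
      have : π = π' := by
        funext m
        by_contra hm
        have : m ∈ Finset.univ.filter fun m => π m ≠ π' m := by simp [hm]
        rw [Finset.card_eq_zero.1 (Nat.le_zero.1 h3)] at this
        simp at this
      rw [this] at h2
      linarith
    | succ d ih =>
      intro π h1 h2 h3
      by_cases hall : ∀ m, π m = π' m
      · rw [funext hall] at h2
        linarith
      push Not at hall
      obtain ⟨i, hi⟩ := hall
      have hinj : Function.Injective fun m => Equiv.swap (π i) (π' i) (π m) :=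
        (Equiv.injective _).comp h1
      have hsub : (Finset.univ.filter fun m => Equiv.swap (π i) (π' i) (π m) ≠ π' m) ⊂
          Finset.univ.filter fun m => π m ≠ π' m := by
        rw [Finset.ssubset_iff_of_subset]
        · exact ⟨i, by simp [hi], by simp⟩
        · intro m hm
          rw [Finset.mem_filter] at hm ⊢
          refine ⟨hm.1, fun e => hm.2 ?_⟩
          by_cases hmi : m = i
          · rw [hmi, Equiv.swap_apply_left]
          · rw [Equiv.swap_apply_of_ne_of_ne (fun e' => hmi (h1 e')) fun e' => hmi
              (hπ' (e.symm.trans e')), e]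
      have hle := weight_swap_le B.mean_mem_Icc h1 i (π' i)
      refine ih _ hinj ?_ (by have := Finset.card_lt_card hsub; omega)
      by_contra hne
      have := B.gap_toReal_le hinj hne
      linarith
  obtain ⟨π, h1, h2⟩ := B.exists_weight_eq_maxUtility hMK
  exact hopt _ π h1 h2 le_rfl

theorem eq_of_gap_eq_top (h : B.gap = ⊤) (hu : ∃! π, B.IsOptimal π)
    {π π' : Fin M → Fin K} (hπ : Function.Injective π) (hπ' : Function.Injective π') : π = π' := by
  have h1 : B.IsOptimal ⟨π, hπ⟩ := B.weight_eq_of_gap_eq_top h hπ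
  have h2 : B.IsOptimal ⟨π', hπ'⟩ := B.weight_eq_of_gap_eq_top h hπ'
  exact congrArg DFunLike.coe (hu.unique h1 h2)

end Environment

/-! ## The confidence radii -/

section Radii

/-- The logarithm in the confidence radii. -/
noncomputable def radiusLog (n K T : ℕ) : ℝ := Real.log (2 * ((n : ℝ) ^ 2 * K * (T : ℝ) ^ 2))

variable {n K T : ℕ}

theorem eps_eq (c p : ℕ) : eps n K T c p = Real.sqrt (radiusLog n K T / 2 ^ (1 + p ^ c)) := by
  rw [eps, radiusLog, one_div, div_inv_eq_mul]

theorem eps_nonneg (c p : ℕ) : 0 ≤ eps n K T c p := Real.sqrt_nonneg _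

theorem two_le_radiusLog (hn : 1 ≤ n) (hK : 1 ≤ K) (hT : 2 ≤ T) : 2 ≤ radiusLog n K T := by
  have h1 : (1 : ℝ) ≤ n := by exact_mod_cast hn
  have h2 : (1 : ℝ) ≤ K := by exact_mod_cast hK
  have h3 : (2 : ℝ) ≤ T := by exact_mod_cast hT
  rw [radiusLog, Real.le_log_iff_exp_le (by positivity)]
  -- The argument of the logarithm is at least `2 * 2 ^ 2 = 8`.
  have h4 : Real.exp 2 ≤ 8 := by
    have := Real.exp_one_lt_d9
    rw [show (2 : ℝ) = 1 + 1 by norm_num, Real.exp_add]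
    nlinarith [Real.exp_pos 1]
  have h5 : (1 : ℝ) ≤ (n : ℝ) ^ 2 := one_le_pow₀ h1
  have h6 : (4 : ℝ) ≤ (T : ℝ) ^ 2 := by nlinarith
  have h7 : (1 : ℝ) ≤ (n : ℝ) ^ 2 * K := one_le_mul_of_one_le_of_one_le h5 h2
  nlinarith

theorem eps_sq (hL : 0 ≤ radiusLog n K T) (c p : ℕ) :
    eps n K T c p ^ 2 = radiusLog n K T / 2 ^ (1 + p ^ c) := by
  rw [eps_eq, Real.sq_sqrt (by positivity)]

theorem eps_antitone (hL : 0 ≤ radiusLog n K T) (c : ℕ) : Antitone (eps n K T c) := by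
  intro p q hpq
  rw [eps_eq, eps_eq]
  gcongr
  norm_num

theorem one_le_eps_zero (hL : 2 ≤ radiusLog n K T) {c : ℕ} (hc : 1 ≤ c) :
    1 ≤ eps n K T c 0 := by
  rw [eps_eq, Real.one_le_sqrt, zero_pow (by omega)]
  norm_num
  linarith

/-- The truncation error is smaller than the confidence radius. -/
theorem truncation_le (hL : 2 ≤ radiusLog n K T) (c p : ℕ) :
    ((2 : ℝ) ^ valueBits c p)⁻¹ ≤ 4 / 5 * eps n K T c p := by
  refine le_of_sq_le_sq ?_ (mul_nonneg (by norm_num) (eps_nonneg c p))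
  rw [mul_pow, eps_sq (by linarith), inv_pow, ← pow_mul]
  have h1 : 1 + p ^ c ≤ valueBits c p * 2 := by
    unfold valueBits
    omega
  have h2 : (2 : ℝ) ^ (1 + p ^ c) ≤ 2 ^ (valueBits c p * 2) := pow_le_pow_right₀ (by norm_num) h1
  calc ((2 : ℝ) ^ (valueBits c p * 2))⁻¹ ≤ (2 ^ (1 + p ^ c))⁻¹ := by gcongr
    _ = 1 / 2 ^ (1 + p ^ c) := (one_div _).symm
    _ ≤ (4 / 5) ^ 2 * radiusLog n K T / 2 ^ (1 + p ^ c) := by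
      gcongr
      linarith
    _ = _ := by ring

/-- This is the condition on the threshold in `EpochInv.candidates`. The left side is at most `14 /
5` of the radius at `p - 1`. For `lag = 0` and `c = 1`, consecutive radii have ratio `1 / √2 ≥ 7 /
10`, and `4 * (7 / 10) = 14 / 5` is just enough. For larger `c` the radii shrink too fast for this.
-/
theorem eps_pred_add_truncation_le (hL : 2 ≤ radiusLog n K T) {c lag : ℕ}
    (hlag : lag = 1 ∨ lag = 0 ∧ c = 1) {p : ℕ} (hp : 1 ≤ p) :
    2 * eps n K T c (p - 1) + ((2 : ℝ) ^ valueBits c (p - 1))⁻¹ ≤ 4 * eps n K T c (p - lag) := by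
  have h1 := truncation_le hL c (p - 1)
  have h0 := eps_nonneg (n := n) (K := K) (T := T) c (p - 1)
  rcases hlag with rfl | ⟨rfl, rfl⟩
  · linarith
  · obtain ⟨q, rfl⟩ : ∃ q, p = q + 1 := ⟨p - 1, by omega⟩
    simp only [Nat.add_sub_cancel, Nat.sub_zero] at *
    have h2 : eps n K T 1 (q + 1) ^ 2 = eps n K T 1 q ^ 2 / 2 := by
      rw [eps_sq (by linarith), eps_sq (by linarith), pow_one, pow_one,
        show 1 + (q + 1) = (1 + q) + 1 by ring, pow_succ, div_div]
    have h3 : 7 / 10 * eps n K T 1 q ≤ eps n K T 1 (q + 1) := by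
      refine le_of_sq_le_sq ?_ (eps_nonneg _ _)
      rw [h2, mul_pow]
      nlinarith [sq_nonneg (eps n K T 1 q)]
    linarith

/-- The radii are chosen so that the exponent is the same for all epochs, namely `radiusLog`, and
the failure probability is `δ`. -/
theorem two_mul_exp_le (hn : 1 ≤ n) (hK : 1 ≤ K) (hT : 2 ≤ T) (c p : ℕ) :
    2 * Real.exp (-(2 * (2 ^ p ^ c : ℕ) * eps n K T c p ^ 2)) ≤
      1 / ((n : ℝ) ^ 2 * K * (T : ℝ) ^ 2) := by
  have hL := two_le_radiusLog hn hK hT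
  have hn' : (0 : ℝ) < n := by exact_mod_cast hn
  have hK' : (0 : ℝ) < K := by exact_mod_cast hK
  have hT' : (0 : ℝ) < T := by exact_mod_cast (by omega : 0 < T)
  rw [eps_sq (by linarith)]
  have : 2 * ((2 ^ p ^ c : ℕ) : ℝ) * (radiusLog n K T / 2 ^ (1 + p ^ c)) = radiusLog n K T := by
    rw [pow_add]
    push_cast
    field_simp
  rw [this, radiusLog, Real.exp_neg, Real.exp_log (by positivity), mul_inv, ← mul_assoc]
  norm_num

end Radii

/-! ## From the run to the regret -/

section GoodRun

variable {K N : ℕ}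

theorem weight_comp_perm {n : ℕ} (μ : Fin n → Fin K → ℝ) (σ : Equiv.Perm (Fin n))
    (π : Fin n → Fin K) :
    weight (fun r => μ (σ r)) π = weight μ fun m => π (σ.symm m) := by
  unfold weight
  exact Fintype.sum_equiv σ _ _ fun r => by simp

theorem meanReward_comp_perm {n : ℕ} (μ : Fin n → Fin K → ℝ) (σ : Equiv.Perm (Fin n))
    (a : Fin n → Fin K) :
    meanReward (fun r => μ (σ r)) (fun r => a (σ r)) = meanReward μ a := by
  unfold meanReward
  refine Fintype.sum_equiv σ _ _ fun r => ?_
  simp only [rewards, collides_comp_equiv a σ r]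

/-- The cost of a run in which the musical chairs and the estimates succeed. -/
theorem sum_loss_le [NeZero K] (hN : N + 1 ≤ K) {y : ℕ → Fin (N + 1) → Fin K → ℝ}
    {u : ℕ → Fin (N + 1) → Fin K} {T c lag : ℕ} (hT : 2 ≤ T) (hc : 1 ≤ c)
    (hlag : lag = 1 ∨ lag = 0 ∧ c = 1) {μ : Fin (N + 1) → Fin K → ℝ} {Us : ℝ} {a ρ : ℕ → ℝ}
    {e' : ℝ} {P : ℕ}
    (hμ : ∀ m k, μ m k ∈ Set.Icc (0 : ℝ) 1) (hy : ∀ t m k, y t m k ∈ Set.Icc (0 : ℝ) 1)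
    (hwell : WellEstimated μ (eps (N + 1) K T c) c T y (arms (metcElim K T c lag) y u))
    (hchairs : ∀ m, chairs u ⌈(K : ℝ) * Real.log (K / (1 / ((K : ℝ) * T)))⌉₊ m ≠ none)
    (hUs : Us ≤ (N + 1 : ℕ))
    (hle : ∀ π, Function.Injective π → weight μ π ≤ Us)
    (hopt : ∃ π, Function.Injective π ∧ weight μ π = Us)
    (he' : 0 ≤ e') (ha : ∀ q, 0 ≤ a q) (hρ : ∀ q, 0 ≤ ρ q)
    (H1 : ∀ q, 1 ≤ q → ∀ π, Function.Injective π →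
      Us - weight μ π ≤ 8 * (N + 1 : ℕ) * eps (N + 1) K T c (q - 1) →
      Us - weight μ π ≤ e' + a q)
    (H2 : ∀ q, 1 ≤ q → ∀ π, Function.Injective π →
      Us - weight μ π ≤ 8 * (N + 1 : ℕ) * eps (N + 1) K T c (q - 2) →
      2 + (Us - weight μ π) ≤ e' + ρ q)
    (HP : T ≤ 2 ^ P ^ c ∨ ∃ π₀, ∀ π, Function.Injective π →
      Us - weight μ π ≤ 8 * (N + 1 : ℕ) * eps (N + 1) K T c (P - 1) → π = π₀) (hP : 1 ≤ P) :
    ∑ t ∈ Finset.range T, (Us - meanReward μ (arms (metcElim K T c lag) y u t)) ≤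
      (⌈(K : ℝ) * Real.log (K / (1 / ((K : ℝ) * T)))⌉₊ + (2 * K - 2) : ℕ) * ((N + 1 : ℕ) : ℝ) +
        T * e' + epochsCost N K c a ρ (Finset.Ico 1 (P + 1)) := by
  have hK : 1 ≤ K := by omega
  have hL := two_le_radiusLog (n := N + 1) (by omega) hK hT
  set Q := programs (metcElim K T c lag) y u with hQdef
  have hrun : IsRun y u Q := isRun_programs _ y u
  obtain ⟨σ, hσ⟩ := hrun.init (1 / ((K : ℝ) * T))
    (fun z => if z.1 = 0 then leader T c lag z.2 else follower T c z.2 z.1)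
    (fun m => metcElim_eq T c lag) hchairs
  set t₀ := ⌈(K : ℝ) * Real.log (K / (1 / ((K : ℝ) * T)))⌉₊ + (2 * K - 2) with ht₀
  set f : (Fin (N + 1) → Fin K) → ℝ := fun b => Us - meanReward μ b - e' with hf
  have hsum : ∑ t ∈ Finset.range T, (Us - meanReward μ (arms (metcElim K T c lag) y u t)) =
      tailCost f u Q T 0 + T * e' := by
    have : (T : ℝ) * e' = ∑ t ∈ Finset.range T, e' := by simp
    rw [tailCost, Nat.Ico_zero_eq_range, this, ← Finset.sum_add_distrib]
    refine Finset.sum_congr rfl fun t _ => ?_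
    simp only [hf, sub_add_cancel]
    rfl
  have hfirst := tailCost_le_add f u Q T 0 t₀ (Nat.cast_nonneg (N + 1)) fun i _ => by
    have h1 : 0 ≤ meanReward μ (runArms u Q (0 + i)) :=
      Finset.sum_nonneg fun m _ => (rewards_mem_Icc hμ _ m).1
    simp only [hf]
    linarith
  rw [Nat.zero_add] at hfirst
  -- From here on the players are identified with their ranks; utilities, draws, means and matchings
  -- are renamed accordingly.
  set μ' : Fin (N + 1) → Fin K → ℝ := fun r => μ (σ r) with hμ'
  have hrun' := hrun.relabel σ
  have hsymm : ∀ π : Fin (N + 1) → Fin K, Function.Injective π →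
      Function.Injective fun m => π (σ.symm m) := fun π h => h.comp σ.symm.injective
  have hw := weight_comp_perm μ σ
  have htail : tailCost f u Q T t₀ = tailCost (fun b => Us - meanReward μ' b - e')
      (fun t r => u t (σ r)) (fun t r => Q t (σ r)) T t₀ := by
    unfold tailCost
    refine Finset.sum_congr rfl fun t _ => ?_
    have := meanReward_comp_perm μ σ (runArms u Q t)
    simp only [hf]
    rw [← this]
    rfl
  have hmain := tailCost_epochState_le hN hrun' (T := T) (c := c) (lag := lag) (μ := μ')
    (Us := Us) (τ := fun p => ((2 : ℝ) ^ valueBits c p)⁻¹) (a := a) (ρ := ρ) (e' := e') (P := P)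
    (fun r k => hμ (σ r) k) (fun t r k => hy t (σ r) k)
    (fun p t L r k => hwell p t L (σ r) k)
    (fun π h => by
      rw [hw]
      exact hle _ (hsymm π h))
    (by
      obtain ⟨π, h1, h2⟩ := hopt
      refine ⟨fun r => π (σ r), h1.comp σ.injective, ?_⟩
      rw [hw]
      simpa using h2)
    (eps_nonneg c) (eps_antitone (by linarith) c) (fun p _ => le_rfl)
    (fun p hp => eps_pred_add_truncation_le hL hlag hp)
    (fun p hp => by
      rcases hlag with rfl | ⟨rfl, rfl⟩
      · exact le_rfl
      · exact eps_antitone (by linarith) _ (by omega))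
    he' ha hρ
    (fun q hq π h => by
      rw [hw]
      exact H1 q hq _ (hsymm π h))
    (fun q hq π h => by
      rw [hw]
      exact H2 q hq _ (hsymm π h))
    (HP.imp_right fun ⟨π₀, h₀⟩ => ⟨fun r => π₀ (σ r), fun π h => by
      rw [hw]
      intro h2
      have := h₀ _ (hsymm π h) h2
      rw [← this]
      funext r
      simp⟩)
    T 1 t₀ Finset.univ (fun _ _ => 0) (fun i => Fin.ofNat K i.val) le_rfl (by omega)
    (by
      funext r
      refine (hσ r).trans ?_
      refine Fin.cases ?_ (fun j => ?_) r
      · simp [epochState, leader]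
      · simp [epochState, follower])
    fun _ => ⟨epochInv_one (fun r k => hμ (σ r) k) hUs (one_le_eps_zero hL hc) (by positivity)
      (fin_ofNat_injective hN), hP⟩
  rw [hsum]
  rw [htail] at hfirst
  linarith

end GoodRun

namespace Environment

variable {N K : ℕ} {Ω : Type*} [MeasurableSpace Ω] {P : Measure Ω} (B : Environment (N + 1) K P)

/-- `S` is not assumed measurable, so it is replaced by its measurable hull, on which a round loses
at most `N + 1`. -/
theorem regret_le_of_measure [NeZero K] [IsProbabilityMeasure P] {prog : Prog K Unit}
    (hN : N + 1 ≤ K)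
    (hprog : MeasurableProg fun _ : Unit => prog) (T : ℕ) {S : Set Ω} {b p : ℝ} (hb : 0 ≤ b)
    (hp : 0 ≤ p) (hS : P S ≤ ENNReal.ofReal p)
    (h : ∀ ω ∉ S, ∑ t ∈ Finset.range T,
      (B.maxUtility - meanReward B.mean (B.armsAt prog t ω)) ≤ b) :
    B.regret prog T ≤ b + T * (N + 1 : ℕ) * p := by
  rw [B.regret_eq hprog T]
  set S' := toMeasurable P S with hS'
  have hS'm : MeasurableSet S' := measurableSet_toMeasurable P S
  have hS'p : P.real S' ≤ p := by
    rw [Measure.real, hS', measure_toMeasurable]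
    exact ENNReal.toReal_le_of_le_ofReal hp hS
  have hint : Integrable (fun ω => b + S'.indicator (fun _ => (T : ℝ) * (N + 1 : ℕ)) ω) P :=
    (integrable_const b).add ((integrable_const _).indicator hS'm)
  have hle : ∀ ω, ∑ t ∈ Finset.range T,
      (B.maxUtility - meanReward B.mean (B.armsAt prog t ω)) ≤
      b + S'.indicator (fun _ => (T : ℝ) * (N + 1 : ℕ)) ω := by
    intro ω
    by_cases hω : ω ∈ S'
    · rw [Set.indicator_of_mem hω]
      refine le_trans ?_ (le_add_of_nonneg_left hb)
      calc ∑ t ∈ Finset.range T, (B.maxUtility - meanReward B.mean (B.armsAt prog t ω))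
          ≤ ∑ t ∈ Finset.range T, ((N + 1 : ℕ) : ℝ) := Finset.sum_le_sum fun t _ => by
            have h1 : 0 ≤ meanReward B.mean (B.armsAt prog t ω) :=
              Finset.sum_nonneg fun m _ => (rewards_mem_Icc B.mean_mem_Icc _ m).1
            have h2 := B.maxUtility_le hN
            linarith
        _ = T * (N + 1 : ℕ) := by rw [Finset.sum_const, Finset.card_range, nsmul_eq_mul]
    · rw [Set.indicator_of_notMem hω, add_zero]
      exact h ω fun h' => hω (subset_toMeasurable P S h')
  have hval : ∫ ω, (b + S'.indicator (fun _ => (T : ℝ) * (N + 1 : ℕ)) ω) ∂P =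
      b + P.real S' * (T * (N + 1 : ℕ)) := by
    rw [integral_add (integrable_const b) ((integrable_const _).indicator hS'm),
      integral_indicator_const _ hS'm]
    simp
  have hfin : b + P.real S' * (T * (N + 1 : ℕ)) ≤ b + T * (N + 1 : ℕ) * p := by
    have := mul_le_mul_of_nonneg_right hS'p
      (mul_nonneg (Nat.cast_nonneg T) (Nat.cast_nonneg (α := ℝ) (N + 1)))
    linarith
  refine le_trans ?_ hfin
  rw [← hval]
  by_cases hi : Integrable (fun ω => ∑ t ∈ Finset.range T,
      (B.maxUtility - meanReward B.mean (B.armsAt prog t ω))) P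
  · exact integral_mono hi hint hle
  -- The integral of a non-integrable function is `0` by convention, and the bound is nonnegative.
  · rw [integral_undef hi]
    refine integral_nonneg fun ω => add_nonneg hb ?_
    exact Set.indicator_nonneg (fun _ _ => by positivity) ω

/-- The regret in terms of the losses allowed in each epoch. -/
theorem regret_metcElim_le [NeZero K] [IsProbabilityMeasure P] (hN : N + 1 ≤ K)
    {T c lag : ℕ} (hT : 2 ≤ T) (hc : 1 ≤ c)
    (hlag : lag = 1 ∨ lag = 0 ∧ c = 1) {a ρ : ℕ → ℝ} {e' : ℝ} {q₁ : ℕ}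
    (he' : 0 ≤ e') (ha : ∀ q, 0 ≤ a q) (hρ : ∀ q, 0 ≤ ρ q)
    (H1 : ∀ q, 1 ≤ q → ∀ π, Function.Injective π →
      B.maxUtility - weight B.mean π ≤ 8 * (N + 1 : ℕ) * eps (N + 1) K T c (q - 1) →
      B.maxUtility - weight B.mean π ≤ e' + a q)
    (H2 : ∀ q, 1 ≤ q → ∀ π, Function.Injective π →
      B.maxUtility - weight B.mean π ≤ 8 * (N + 1 : ℕ) * eps (N + 1) K T c (q - 2) →
      2 + (B.maxUtility - weight B.mean π) ≤ e' + ρ q)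
    (HP : T ≤ 2 ^ q₁ ^ c ∨ ∃ π₀, ∀ π, Function.Injective π →
      B.maxUtility - weight B.mean π ≤ 8 * (N + 1 : ℕ) * eps (N + 1) K T c (q₁ - 1) → π = π₀)
    (hq₁ : 1 ≤ q₁) :
    B.regret (metcElim K T c lag) T ≤
      (N + 1 : ℕ) * K * (2 * Real.log K + 10 * Real.log T) + T * e' +
        epochsCost N K c a ρ (Finset.Ico 1 (q₁ + 1)) := by
  have hK : 1 ≤ K := by omega
  have hK1 : (1 : ℝ) ≤ K := by exact_mod_cast hK
  have hT2 : (2 : ℝ) ≤ T := by exact_mod_cast hT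
  have hNK : ((N + 1 : ℕ) : ℝ) ≤ K := by exact_mod_cast hN
  have hN1 : (1 : ℝ) ≤ (N + 1 : ℕ) := by exact_mod_cast Nat.succ_pos N
  set n : ℝ := ((N + 1 : ℕ) : ℝ) with hn
  set d : ℝ := 1 / (n ^ 2 * K * (T : ℝ) ^ 2) with hd
  have hx : (K : ℝ) / (1 / ((K : ℝ) * T)) = K ^ 2 * T := by
    field_simp
  have hx0 : (0 : ℝ) < (K : ℝ) ^ 2 * T := by positivity
  set S : Set Ω := {ω | ¬ WellEstimated B.mean (eps (N + 1) K T c) c T (fun s => B.Y s ω)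
      fun s => B.armsAt (metcElim K T c lag) s ω} ∪
    {ω | ∃ m, chairs (fun t => B.U t ω) ⌈(K : ℝ) * Real.log ((K : ℝ) ^ 2 * T)⌉₊ m = none} with hS
  have h1 := B.measure_not_wellEstimated_le (measurableProg_metcElim (K := K) T c lag)
    (fun p => eps_nonneg (n := N + 1) (K := K) (T := T) c p) (T := T) hc
    (two_mul_exp_le (by omega) hK hT c)
  have h2 := B.measureReal_exists_chairs_le hN hx0
  have hmeas : P S ≤ ENNReal.ofReal
      (Nat.log 2 T * T * (n * K) * (n * K) * d + n / ((K : ℝ) ^ 2 * T)) := by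
    refine (measure_union_le _ _).trans ?_
    rw [ENNReal.ofReal_add (by positivity) (by positivity)]
    refine add_le_add h1 ?_
    rw [← ENNReal.ofReal_toReal (measure_ne_top P _)]
    exact ENNReal.ofReal_le_ofReal h2
  have hcost0 := epochsCost_nonneg (N := N) (K := K) (c := c) ha hρ (Finset.Ico 1 (q₁ + 1))
  have key := B.regret_le_of_measure hN (measurableProg_metcElim (K := K) T c lag) T
    (b := (⌈(K : ℝ) * Real.log ((K : ℝ) ^ 2 * T)⌉₊ + (2 * K - 2) : ℕ) * n +
        T * e' + epochsCost N K c a ρ (Finset.Ico 1 (q₁ + 1)))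
    (by positivity) (by positivity) hmeas fun ω hω => by
      rw [hS, Set.mem_union, not_or] at hω
      obtain ⟨hω1, hω2⟩ := hω
      have := sum_loss_le hN hT hc hlag (y := fun s => B.Y s ω) (u := fun s => B.U s ω)
        B.mean_mem_Icc (fun t => B.mem_Icc t ω) (not_not.1 hω1)
        (fun m hm => hω2 ⟨m, by rw [← hx]; exact hm⟩) (B.maxUtility_le hN)
        (fun π h => B.weight_le_maxUtility h) (B.exists_weight_eq_maxUtility hN) he' ha hρ
        H1 H2 HP hq₁
      rw [hx] at this
      exact this
  have hlogT : Real.log 2 ≤ Real.log T := Real.log_le_log (by norm_num) hT2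
  have hlog2 := Real.log_two_gt_d9
  have hlogK : 0 ≤ Real.log K := Real.log_nonneg hK1
  have hlog : (Nat.log 2 T : ℝ) ≤ 2 * Real.log T := by
    have h3 : (2 : ℝ) ^ Nat.log 2 T ≤ T := by exact_mod_cast Nat.pow_log_le_self 2 (by omega)
    have h4 := Real.log_le_log (by positivity) h3
    rw [Real.log_pow] at h4
    nlinarith [(Nat.cast_nonneg (Nat.log 2 T) : (0 : ℝ) ≤ _)]
  -- The factor `d = δ` cancels `T ^ 2` and most of `n` and `K`: failures of the estimates cost `n K
  -- log₂ T`, those of the musical chairs at most `1`.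
  have e1 : (T : ℝ) * n * (Nat.log 2 T * T * (n * K) * (n * K) * d + n / ((K : ℝ) ^ 2 * T)) =
      Nat.log 2 T * (n * K) + n ^ 2 / (K : ℝ) ^ 2 := by
    rw [hd]
    field_simp
  have e2 : n ^ 2 / (K : ℝ) ^ 2 ≤ 1 := by
    rw [div_le_one (by positivity)]
    gcongr
  have hnK : (1 : ℝ) ≤ n * K := one_le_mul_of_one_le_of_one_le hN1 hK1
  have e3 : ((⌈(K : ℝ) * Real.log ((K : ℝ) ^ 2 * T)⌉₊ + (2 * K - 2) : ℕ) : ℝ) ≤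
      K * (2 * Real.log K + Real.log T) + 2 * K := by
    have h5 : Real.log ((K : ℝ) ^ 2 * T) = 2 * Real.log K + Real.log T := by
      rw [Real.log_mul (by positivity) (by positivity), Real.log_pow]
      norm_num
    rw [h5]
    have h6 := Nat.ceil_lt_add_one (a := (K : ℝ) * (2 * Real.log K + Real.log T))
      (by have : 0 ≤ Real.log T := by linarith
          positivity)
    rw [Nat.cast_add, Nat.cast_sub (by omega)]
    push_cast
    linarith
  have e4 := mul_le_mul_of_nonneg_right e3 (zero_le_one.trans hN1)
  have e5 := mul_le_mul_of_nonneg_right hlog (zero_le_one.trans hnK)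
  have e6 : n * K * (1 / 2) ≤ n * K * Real.log T :=
    mul_le_mul_of_nonneg_left (by linarith) (by linarith)
  rw [e1] at key
  nlinarith

end Environment

/-! ## Bounds on the costs of communication and exploration -/

section Costs

variable {K N : ℕ}

/-- The crude bound `n K` for the length of the size message is absorbed since `log K ≥ log 2`. When
`K = 1` the logarithm vanishes, but then there is no follower and nothing is sent. -/
theorem announceBits_le (hN : N + 1 ≤ K) :
    (announceBits N K ((N + 1) * K) : ℝ) ≤ 8 * ((N + 1 : ℕ) : ℝ) ^ 2 * K * Real.log K := by
  have hK1 : (1 : ℝ) ≤ K := by exact_mod_cast (by omega : 1 ≤ K)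
  have hlogK : 0 ≤ Real.log K := Real.log_nonneg hK1
  rcases Nat.eq_zero_or_pos N with rfl | hNpos
  · simp only [announceBits, Nat.zero_mul, Nat.add_zero, Nat.cast_zero]
    positivity
  have hK2 : 2 ≤ K := by omega
  have hK2' : (2 : ℝ) ≤ K := by exact_mod_cast hK2
  have hlog2 := Real.log_two_gt_d9
  have hlogK2 : Real.log 2 ≤ Real.log K := Real.log_le_log (by norm_num) hK2'
  have hN1 : (1 : ℝ) ≤ ((N + 1 : ℕ) : ℝ) := by exact_mod_cast Nat.succ_pos N
  have hNle : (N : ℝ) ≤ ((N + 1 : ℕ) : ℝ) := by exact_mod_cast Nat.le_succ N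
  set n : ℝ := ((N + 1 : ℕ) : ℝ) with hn
  have hsize : (sizeBits (N + 1) K : ℝ) ≤ n * K := by
    have : sizeBits (N + 1) K ≤ (N + 1) * K := Nat.size_le.2 Nat.lt_two_pow_self
    rw [hn]
    exact_mod_cast this
  have harm : (armBits K : ℝ) ≤ 3 * Real.log K := by
    have h1 : 2 ^ (armBits K - 1) < K := by
      have h2 : 1 ≤ armBits K := Nat.clog_pos (by norm_num) hK2
      exact (Nat.lt_clog_iff_pow_lt (by norm_num)).1 (by unfold armBits at *; omega)
    have h3 : ((2 : ℝ) ^ (armBits K - 1)) ≤ K := by exact_mod_cast h1.le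
    have h4 := Real.log_le_log (by positivity) h3
    rw [Real.log_pow] at h4
    have h5 : (armBits K : ℝ) ≤ (armBits K - 1 : ℕ) + 1 := by
      exact_mod_cast (by omega : armBits K ≤ armBits K - 1 + 1)
    have h6 : (0 : ℝ) ≤ (armBits K - 1 : ℕ) := Nat.cast_nonneg _
    nlinarith
  have hnK : 2 ≤ n * K := by nlinarith
  have e1 : (N : ℝ) * sizeBits (N + 1) K ≤ n * (n * K) :=
    mul_le_mul hNle hsize (Nat.cast_nonneg _) (by linarith)
  have e2 : (N : ℝ) * ((n * K + 2) * armBits K) ≤ n * ((2 * (n * K)) * (3 * Real.log K)) := by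
    refine mul_le_mul hNle ?_ (by positivity) (by linarith)
    exact mul_le_mul (by linarith) harm (Nat.cast_nonneg _) (by positivity)
  have e3 : n * (n * K) * 1 ≤ n * (n * K) * (2 * Real.log K) :=
    mul_le_mul_of_nonneg_left (by linarith) (by positivity)
  have e4 : (announceBits N K ((N + 1) * K) : ℝ) =
      N * sizeBits (N + 1) K + N * ((n * K + 2) * armBits K) := by
    rw [announceBits, hn]
    push_cast
    ring
  rw [e4]
  linarith

/-- Number of bits exchanged in epoch `q`. -/
theorem epochBits_le (hN : N + 1 ≤ K) {c q : ℕ} (hq : 1 ≤ q) :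
    ((announceBits N K ((N + 1) * K) + N * (K * valueBits c q) : ℕ) : ℝ) ≤
      8 * ((N + 1 : ℕ) : ℝ) ^ 2 * K * Real.log K + 2 * (N + 1 : ℕ) * K * (q : ℝ) ^ c := by
  have h1 := announceBits_le hN
  have h2 : N * (K * valueBits c q) ≤ 2 * (N + 1) * K * q ^ c := by
    have h3 : valueBits c q ≤ 2 * q ^ c := by
      have : 1 ≤ q ^ c := Nat.one_le_pow _ _ hq
      unfold valueBits
      omega
    calc N * (K * valueBits c q) ≤ (N + 1) * (K * (2 * q ^ c)) := by gcongr; omega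
      _ = _ := by ring
  have h4 : ((N * (K * valueBits c q) : ℕ) : ℝ) ≤ 2 * (N + 1 : ℕ) * K * (q : ℝ) ^ c := by
    exact_mod_cast h2
  rw [Nat.cast_add]
  linarith

/-- Total number of bits exchanged in epochs `q` such that `q ^ c ≤ W`. -/
theorem sum_epochBits_le (hN : N + 1 ≤ K) {c : ℕ} (hc : 1 ≤ c) {s : Finset ℕ} {W : ℝ}
    (hW : 0 ≤ W) (hs : ∀ q ∈ s, 1 ≤ q ∧ (q : ℝ) ^ c ≤ W) :
    ∑ q ∈ s, ((announceBits N K ((N + 1) * K) + N * (K * valueBits c q) : ℕ) : ℝ) ≤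
      W ^ (1 / (c : ℝ)) *
        (8 * ((N + 1 : ℕ) : ℝ) ^ 2 * K * Real.log K + 2 * (N + 1 : ℕ) * K * W) := by
  have hc0 : (c : ℝ) ≠ 0 := by exact_mod_cast (by omega : c ≠ 0)
  have hK1 : (1 : ℝ) ≤ K := by exact_mod_cast (by omega : 1 ≤ K)
  have hlogK : 0 ≤ Real.log K := Real.log_nonneg hK1
  have hcard : (s.card : ℝ) ≤ W ^ (1 / (c : ℝ)) := by
    have hsub : s ⊆ Finset.Icc 1 ⌊W ^ (1 / (c : ℝ))⌋₊ := by
      intro q hq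
      refine Finset.mem_Icc.2 ⟨(hs q hq).1, Nat.le_floor ?_⟩
      calc (q : ℝ) = ((q : ℝ) ^ c) ^ (1 / (c : ℝ)) := by
            rw [one_div, Real.pow_rpow_inv_natCast (Nat.cast_nonneg q) (by omega)]
        _ ≤ W ^ (1 / (c : ℝ)) := Real.rpow_le_rpow (by positivity) (hs q hq).2 (by positivity)
    have h1 := Finset.card_le_card hsub
    rw [Nat.card_Icc, Nat.add_sub_cancel] at h1
    exact (Nat.cast_le.2 h1).trans (Nat.floor_le (by positivity))
  have hb : ∀ q ∈ s, ((announceBits N K ((N + 1) * K) + N * (K * valueBits c q) : ℕ) : ℝ) ≤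
      8 * ((N + 1 : ℕ) : ℝ) ^ 2 * K * Real.log K + 2 * (N + 1 : ℕ) * K * W := by
    intro q hq
    refine (epochBits_le hN (hs q hq).1).trans ?_
    have := mul_le_mul_of_nonneg_left (hs q hq).2
      (by positivity : (0 : ℝ) ≤ 2 * (N + 1 : ℕ) * K)
    linarith
  calc _ ≤ s.card • (8 * ((N + 1 : ℕ) : ℝ) ^ 2 * K * Real.log K + 2 * (N + 1 : ℕ) * K * W) :=
        Finset.sum_le_card_nsmul _ _ _ hb
    _ = s.card * (8 * ((N + 1 : ℕ) : ℝ) ^ 2 * K * Real.log K + 2 * (N + 1 : ℕ) * K * W) :=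
        nsmul_eq_mul _ _
    _ ≤ _ := mul_le_mul_of_nonneg_right hcard (by positivity)

theorem epochsCost_eq (c : ℕ) (a ρ : ℕ → ℝ) (s : Finset ℕ) : epochsCost N K c a ρ s =
    ∑ q ∈ s, ((N + 1 : ℕ) : ℝ) * K * 2 ^ q ^ c * a q +
    ∑ q ∈ s, ((announceBits N K ((N + 1) * K) + N * (K * valueBits c q) : ℕ) : ℝ) * ρ q := by
  rw [epochsCost, ← Finset.sum_add_distrib]
  refine Finset.sum_congr rfl fun q _ => ?_
  push_cast
  ring

theorem add_two_pow_le (c r : ℕ) {A : ℝ} (h : (r : ℝ) ^ c ≤ A) :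
    ((r + 2 : ℕ) : ℝ) ^ c ≤ 3 ^ c * (A + 1) := by
  rcases Nat.eq_zero_or_pos r with rfl | hr
  · have hA : 0 ≤ A := le_trans (by positivity) h
    calc (((0 + 2 : ℕ)) : ℝ) ^ c ≤ 3 ^ c := by gcongr; norm_num
      _ ≤ 3 ^ c * (A + 1) := le_mul_of_one_le_right (by positivity) (by linarith)
  · have hr' : ((r + 2 : ℕ) : ℝ) ≤ 3 * r := by exact_mod_cast (by omega : r + 2 ≤ 3 * r)
    calc ((r + 2 : ℕ) : ℝ) ^ c ≤ (3 * r) ^ c := by gcongr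
      _ = 3 ^ c * (r : ℝ) ^ c := mul_pow _ _ _
      _ ≤ 3 ^ c * (A + 1) := by gcongr; linarith

/-- The exponents of the exploration costs grow at most like `r ^ c * (1 + 1 / (2 c))`. -/
theorem exists_succ_pow_le {c : ℕ} (hc : 1 ≤ c) : ∃ D : ℝ, 0 ≤ D ∧ ∀ r : ℕ,
    ((r + 1 : ℕ) : ℝ) ^ c + r / 4 ≤ D + (r : ℝ) ^ c * (1 + 1 / (2 * c)) := by
  have hc0 : (0 : ℝ) < c := by exact_mod_cast hc
  -- As `(1 + 1 / r) ^ c` tends to `1`, for large `r` the power `(r + 1) ^ c` exceeds `r ^ c` by at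
  -- most a fraction `1 / (4 c)`. A second such fraction pays for `r / 4`, because `c r ≤ r ^ c`.
  -- The finitely many small `r` are put into `D`.
  have ht : Filter.Tendsto (fun r : ℕ => (1 + 1 / (r : ℝ)) ^ c) Filter.atTop (nhds 1) := by
    have h1 : Filter.Tendsto (fun r : ℕ => 1 + 1 / (r : ℝ)) Filter.atTop (nhds (1 + 0)) :=
      tendsto_const_nhds.add tendsto_one_div_atTop_nhds_zero_nat
    simpa using h1.pow c
  have hlt : (1 : ℝ) < 1 + 1 / (4 * c) := by
    have : (0 : ℝ) < 1 / (4 * c) := by positivity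
    linarith
  obtain ⟨r₀, hr₀⟩ := Filter.eventually_atTop.1 (ht.eventually (gt_mem_nhds hlt))
  refine ⟨∑ r ∈ Finset.range (r₀ + c + 1), (((r + 1 : ℕ) : ℝ) ^ c + r / 4),
    Finset.sum_nonneg fun r _ => by positivity, fun r => ?_⟩
  by_cases hr : r < r₀ + c + 1
  · have h1 := Finset.single_le_sum (f := fun r : ℕ => (((r + 1 : ℕ) : ℝ) ^ c + r / 4))
      (fun i _ => by positivity) (Finset.mem_range.2 hr)
    refine h1.trans (le_add_of_nonneg_right (by positivity))
  · refine le_trans ?_ (le_add_of_nonneg_left (Finset.sum_nonneg fun r _ => by positivity))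
    have hrpos : (0 : ℝ) < r := by exact_mod_cast (by omega : 0 < r)
    have h1 : ((r + 1 : ℕ) : ℝ) ^ c ≤ (r : ℝ) ^ c * (1 + 1 / (4 * c)) := by
      calc ((r + 1 : ℕ) : ℝ) ^ c = (r : ℝ) ^ c * (1 + 1 / (r : ℝ)) ^ c := by
            rw [← mul_pow]
            congr 1
            push_cast
            field_simp
        _ ≤ _ := by gcongr; exact (hr₀ r (by omega)).le
    have h2 : (c : ℝ) * r ≤ (r : ℝ) ^ c := by
      have : c * r ≤ r ^ c := by
        rcases Nat.lt_or_ge 1 c with h | h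
        · calc c * r ≤ r * r := Nat.mul_le_mul_right _ (by omega)
            _ = r ^ 2 := (sq r).symm
            _ ≤ r ^ c := Nat.pow_le_pow_right (by omega) h
        · have : c = 1 := by omega
          subst this
          simp
      exact_mod_cast this
    have h3 : (r : ℝ) / 4 ≤ (r : ℝ) ^ c * (1 / (4 * c)) := by
      rw [mul_one_div, div_le_div_iff₀ (by norm_num) (by positivity)]
      nlinarith
    have h4 : (r : ℝ) ^ c * (1 + 1 / (2 * c)) =
        (r : ℝ) ^ c * (1 + 1 / (4 * c)) + (r : ℝ) ^ c * (1 / (4 * c)) := by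
      field_simp
      ring
    linarith

/-- This is the cost of exploring `2 ^ (r + 1) ^ c` rounds with the precision left by the previous
epoch. Subtracting `r ^ c / 2` from `hD` leaves the exponent `r ^ c (1 + 1 / c) / 2`, and the
reserve `r / 4` becomes a geometric factor that makes the sum over epochs converge. -/
theorem two_pow_succ_div_sqrt_le {c : ℕ} (hc : 1 ≤ c) {D : ℝ}
    (hD : ∀ r : ℕ, ((r + 1 : ℕ) : ℝ) ^ c + r / 4 ≤ D + (r : ℝ) ^ c * (1 + 1 / (2 * c)))
    {r : ℕ} {x : ℝ} (hx : (2 : ℝ) ^ r ^ c ≤ x) :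
    (2 : ℝ) ^ (r + 1) ^ c / Real.sqrt (2 ^ r ^ c) ≤
      2 ^ D * x ^ ((1 + 1 / (c : ℝ)) / 2) * ((2 : ℝ) ^ (-(1 / 4) : ℝ)) ^ r := by
  have hc0 : (0 : ℝ) < c := by exact_mod_cast hc
  have h2 : (0 : ℝ) < 2 := by norm_num
  have e1 : (2 : ℝ) ^ (r + 1) ^ c / Real.sqrt (2 ^ r ^ c) =
      (2 : ℝ) ^ (((r + 1 : ℕ) : ℝ) ^ c - (r : ℝ) ^ c / 2) := by
    rw [Real.rpow_sub h2, Real.sqrt_eq_rpow, ← Real.rpow_natCast, ← Real.rpow_natCast 2 (r ^ c),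
      ← Real.rpow_mul h2.le]
    push_cast
    rw [mul_one_div]
  have e2 : ((2 : ℝ) ^ r ^ c) ^ ((1 + 1 / (c : ℝ)) / 2) =
      (2 : ℝ) ^ ((r : ℝ) ^ c * ((1 + 1 / (c : ℝ)) / 2)) := by
    rw [← Real.rpow_natCast, ← Real.rpow_mul h2.le]
    push_cast
    rfl
  have e3 : ((2 : ℝ) ^ (-(1 / 4) : ℝ)) ^ r = (2 : ℝ) ^ (-(r / 4) : ℝ) := by
    rw [← Real.rpow_natCast, ← Real.rpow_mul h2.le]
    congr 1
    ring
  have e4 : ((2 : ℝ) ^ r ^ c) ^ ((1 + 1 / (c : ℝ)) / 2) ≤ x ^ ((1 + 1 / (c : ℝ)) / 2) :=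
    Real.rpow_le_rpow (by positivity) hx (by positivity)
  calc _ = (2 : ℝ) ^ (((r + 1 : ℕ) : ℝ) ^ c - (r : ℝ) ^ c / 2) := e1
    _ ≤ (2 : ℝ) ^ (D + (r : ℝ) ^ c * ((1 + 1 / (c : ℝ)) / 2) + -(r / 4) : ℝ) := by
      refine Real.rpow_le_rpow_of_exponent_le (by norm_num) ?_
      have := hD r
      have e : (r : ℝ) ^ c * (1 + 1 / (2 * c)) =
          (r : ℝ) ^ c * ((1 + 1 / (c : ℝ)) / 2) + (r : ℝ) ^ c / 2 := by
        field_simp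
        ring
      linarith
    _ = 2 ^ D * ((2 : ℝ) ^ r ^ c) ^ ((1 + 1 / (c : ℝ)) / 2) *
          ((2 : ℝ) ^ (-(1 / 4) : ℝ)) ^ r := by
      rw [Real.rpow_add h2, Real.rpow_add h2, e2, e3]
    _ ≤ _ := by gcongr

theorem sq_le_four_mul_two_pow (k : ℕ) : k ^ 2 ≤ 4 * 2 ^ k := by
  induction k with
  | zero => norm_num
  | succ k ih =>
    rcases Nat.lt_or_ge k 3 with h | h
    · interval_cases k <;> norm_num
    · rw [pow_succ 2 k]
      nlinarith

end Costs

/-! ## The bounds for an arbitrary parameter -/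

section Horizon

variable {K N T : ℕ}

theorem half_le_log (hT : 2 ≤ T) : 1 / 2 ≤ Real.log T := by
  have hT2 : (2 : ℝ) ≤ T := by exact_mod_cast hT
  have := Real.log_le_log (by norm_num) hT2
  have := Real.log_two_gt_d9
  linarith

theorem radiusLog_le {n : ℕ} (hn : 1 ≤ n) (hnK : n ≤ K) (hKT : K ≤ T) (hT : 2 ≤ T) :
    radiusLog n K T ≤ 6 * Real.log T := by
  have h1 : (1 : ℝ) ≤ n := by exact_mod_cast hn
  have h2 : (n : ℝ) ≤ T := by exact_mod_cast hnK.trans hKT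
  have h3 : (K : ℝ) ≤ T := by exact_mod_cast hKT
  have h4 : (2 : ℝ) ≤ T := by exact_mod_cast hT
  have hK : (1 : ℝ) ≤ K := by exact_mod_cast (by omega : 1 ≤ K)
  rw [radiusLog, ← Nat.cast_ofNat (R := ℝ) (n := 6), ← Real.log_pow]
  refine Real.log_le_log (by positivity) ?_
  calc 2 * ((n : ℝ) ^ 2 * K * (T : ℝ) ^ 2) ≤ T * ((T : ℝ) ^ 2 * T * (T : ℝ) ^ 2) := by gcongr
    _ = (T : ℝ) ^ 6 := by ring

/-- An epoch whose exploration alone exceeds the horizon. The least one is taken, so that its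
predecessor bounds `q ^ c` by a multiple of `ln T`. -/
theorem exists_two_pow_pow_ge {c : ℕ} (hc : 1 ≤ c) (hT : 2 ≤ T) :
    ∃ q : ℕ, 1 ≤ q ∧ T ≤ 2 ^ q ^ c ∧ (q : ℝ) ^ c ≤ 3 ^ c * 4 * Real.log T := by
  classical
  have hex : ∃ q : ℕ, T ≤ 2 ^ q ^ c := ⟨T, Nat.lt_two_pow_self.le.trans
    (Nat.pow_le_pow_right (by norm_num) (Nat.le_self_pow (by omega) T))⟩
  have hfind := Nat.find_spec hex
  have hpos : 1 ≤ Nat.find hex := by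
    by_contra h
    have h0 : Nat.find hex = 0 := by omega
    rw [h0, zero_pow (by omega)] at hfind
    omega
  refine ⟨Nat.find hex, hpos, hfind, ?_⟩
  set r := Nat.find hex - 1 with hr
  have hlt : 2 ^ r ^ c < T := not_le.1 (Nat.find_min hex (by omega))
  have hl := half_le_log hT
  have h1 : ((r : ℝ)) ^ c ≤ 2 * Real.log T := by
    have h2 : (2 : ℝ) ^ r ^ c ≤ T := by exact_mod_cast hlt.le
    have h3 := Real.log_le_log (by positivity) h2
    rw [Real.log_pow] at h3
    push_cast at h3
    have := Real.log_two_gt_d9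
    have h4 : (0 : ℝ) ≤ (r : ℝ) ^ c := by positivity
    nlinarith
  have h2 := add_two_pow_le c r h1
  calc ((Nat.find hex : ℕ) : ℝ) ^ c ≤ ((r + 2 : ℕ) : ℝ) ^ c := by
        gcongr
        omega
    _ ≤ 3 ^ c * (2 * Real.log T + 1) := h2
    _ ≤ 3 ^ c * (4 * Real.log T) := by gcongr; linarith
    _ = _ := by ring

theorem rpow_one_div_le_self_mul {c : ℕ} (hc : 1 ≤ c) {α l : ℝ} (hα : 1 ≤ α) (hl : 0 ≤ l) :
    (α * l) ^ (1 / (c : ℝ)) ≤ α * l ^ (1 / (c : ℝ)) := by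
  rw [Real.mul_rpow (by linarith) hl]
  refine mul_le_mul_of_nonneg_right ?_ (by positivity)
  have : 1 / (c : ℝ) ≤ 1 := by
    have : (1 : ℝ) ≤ c := by exact_mod_cast hc
    rw [div_le_one (by linarith)]
    exact this
  simpa using Real.rpow_le_rpow_of_exponent_le hα this

/-- Total number of bits exchanged before the horizon. -/
theorem sum_epochBits_le_log (hN : N + 1 ≤ K) {c : ℕ} (hc : 1 ≤ c) (hKT : K ≤ T) (hT : 2 ≤ T)
    {s : Finset ℕ} (hs : ∀ q ∈ s, 1 ≤ q ∧ (q : ℝ) ^ c ≤ 3 ^ c * 4 * Real.log T) :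
    ∑ q ∈ s, ((announceBits N K ((N + 1) * K) + N * (K * valueBits c q) : ℕ) : ℝ) ≤
      10 * (3 ^ c * 4) ^ 2 *
        (((N + 1 : ℕ) : ℝ) ^ 2 * K * Real.log T ^ (1 + 1 / (c : ℝ))) := by
  have hl := half_le_log hT
  have hK1 : (1 : ℝ) ≤ K := by exact_mod_cast (by omega : 1 ≤ K)
  have hn1 : (1 : ℝ) ≤ (N + 1 : ℕ) := by exact_mod_cast Nat.succ_pos N
  have hlogK : Real.log K ≤ Real.log T := Real.log_le_log (by linarith) (by exact_mod_cast hKT)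
  have hlogK0 : 0 ≤ Real.log K := Real.log_nonneg hK1
  have hα : (1 : ℝ) ≤ 3 ^ c * 4 := by
    have : (1 : ℝ) ≤ 3 ^ c := one_le_pow₀ (by norm_num)
    linarith
  refine (sum_epochBits_le hN hc (by positivity) hs).trans ?_
  set n : ℝ := ((N + 1 : ℕ) : ℝ)
  set α : ℝ := 3 ^ c * 4
  set l := Real.log T
  have hsplit : l ^ (1 + 1 / (c : ℝ)) = l * l ^ (1 / (c : ℝ)) := by
    rw [Real.rpow_add (by linarith), Real.rpow_one]
  have h1 := rpow_one_div_le_self_mul hc hα (by linarith : 0 ≤ l)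
  have h2 : 8 * n ^ 2 * K * Real.log K + 2 * n * K * (α * l) ≤ 10 * α * (n ^ 2 * K * l) := by
    have e1 : n ^ 2 * K * Real.log K ≤ α * (n ^ 2 * K * l) := by
      calc n ^ 2 * K * Real.log K ≤ 1 * (n ^ 2 * K * l) := by rw [one_mul]; gcongr
        _ ≤ _ := by gcongr
    have e2 : n * K * (α * l) ≤ n ^ 2 * K * (α * l) := by
      gcongr
      nlinarith
    nlinarith
  calc _ ≤ (α * l ^ (1 / (c : ℝ))) * (10 * α * (n ^ 2 * K * l)) := by gcongr
    _ = _ := by rw [hsplit]; ring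

end Horizon

namespace Environment

variable {N K : ℕ} {Ω : Type*} [MeasurableSpace Ω] {P : Measure Ω} (B : Environment (N + 1) K P)

theorem regret_le_mul [NeZero K] [IsProbabilityMeasure P] (hN : N + 1 ≤ K) (T c lag : ℕ) :
    B.regret (metcElim K T c lag) T ≤ T * (N + 1 : ℕ) := by
  have := B.regret_le_of_measure hN (measurableProg_metcElim (K := K) T c lag) T
    (S := Set.univ) (b := 0) (p := 1) le_rfl zero_le_one (by simp) fun ω hω => absurd trivial hω
  linarith

/-- All matchings are maximum, so beyond the initialization and the exceptional event only the
collisions that transmit bits cost anything: `a = 0` and `ρ = 2`. For `T < K` the trivial bound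
suffices. -/
theorem regret_le_of_gap_eq_top [NeZero K] [IsProbabilityMeasure P] (hN : N + 1 ≤ K)
    {T c lag : ℕ} (hT : 2 ≤ T) (hc : 1 ≤ c) (hlag : lag = 1 ∨ lag = 0 ∧ c = 1)
    (hgap : B.gap = ⊤) :
    B.regret (metcElim K T c lag) T ≤ (24 + 20 * (3 ^ c * 4) ^ 2) *
      (((N + 1 : ℕ) : ℝ) ^ 2 * K * Real.log T ^ (1 + 1 / (c : ℝ))) := by
  have hl := half_le_log hT
  have hK1 : (1 : ℝ) ≤ K := by exact_mod_cast (by omega : 1 ≤ K)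
  have hn1 : (1 : ℝ) ≤ (N + 1 : ℕ) := by exact_mod_cast Nat.succ_pos N
  have hc1 : (1 : ℝ) ≤ c := by exact_mod_cast hc
  have hlc : 1 / 2 ≤ Real.log T ^ (1 / (c : ℝ)) := by
    calc (1 / 2 : ℝ) = (1 / 2) ^ (1 : ℝ) := (Real.rpow_one _).symm
      _ ≤ (1 / 2) ^ (1 / (c : ℝ)) := by
        refine Real.rpow_le_rpow_of_exponent_ge (by norm_num) (by norm_num) ?_
        rw [div_le_one (by linarith)]
        exact hc1
      _ ≤ _ := Real.rpow_le_rpow (by norm_num) hl (by positivity)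
  have hsplit : Real.log T ^ (1 + 1 / (c : ℝ)) = Real.log T * Real.log T ^ (1 / (c : ℝ)) := by
    rw [Real.rpow_add (by linarith), Real.rpow_one]
  have hle : Real.log T ≤ 2 * Real.log T ^ (1 + 1 / (c : ℝ)) := by
    rw [hsplit]
    nlinarith
  have hquarter : 1 / 4 ≤ Real.log T ^ (1 + 1 / (c : ℝ)) := by linarith
  set n : ℝ := ((N + 1 : ℕ) : ℝ) with hn
  set Λ : ℝ := Real.log T ^ (1 + 1 / (c : ℝ)) with hΛ
  have hnn : n * K ≤ n ^ 2 * K := by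
    gcongr
    nlinarith
  have hnnΛ : n * K * Λ ≤ n ^ 2 * K * Λ := mul_le_mul_of_nonneg_right hnn (by linarith)
  rcases Nat.lt_or_ge T K with hTK | hKT
  · refine (B.regret_le_mul hN T c lag).trans ?_
    have h1 : (T : ℝ) * n ≤ K * n := by
      gcongr
    have h2 : n * K * (1 / 4) ≤ n * K * Λ := by gcongr
    have h3 : (0 : ℝ) ≤ 20 * (3 ^ c * 4) ^ 2 * (n ^ 2 * K * Λ) := by
      have : 0 ≤ Λ := by linarith
      positivity
    nlinarith
  · obtain ⟨q, hq1, hq2, hq3⟩ := exists_two_pow_pow_ge hc hT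
    have hlogK : Real.log K ≤ Real.log T := Real.log_le_log (by linarith) (by exact_mod_cast hKT)
    have h := B.regret_metcElim_le hN hT hc hlag (a := fun _ => 0) (ρ := fun _ => 2) (e' := 0)
      le_rfl (fun _ => le_rfl) (fun _ => by norm_num)
      (fun q _ π hπ _ => by rw [B.weight_eq_of_gap_eq_top hgap hπ]; simp)
      (fun q _ π hπ _ => by rw [B.weight_eq_of_gap_eq_top hgap hπ]; simp)
      (Or.inl hq2) hq1
    have hbits := sum_epochBits_le_log hN hc hKT hT (s := Finset.Ico 1 (q + 1)) fun r hr => by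
      rw [Finset.mem_Ico] at hr
      refine ⟨hr.1, le_trans ?_ hq3⟩
      gcongr
      omega
    rw [epochsCost_eq] at h
    simp only [mul_zero, Finset.sum_const_zero, zero_add, add_zero] at h
    rw [← Finset.sum_mul, ← hn] at h
    rw [← hn, ← hΛ] at hbits
    have h1 : n * K * (2 * Real.log K + 10 * Real.log T) ≤ n * K * (24 * Λ) := by
      gcongr
      linarith
    linarith

/-- The bound of the theorem for a finite gap, in terms of `v = M ln T / Δ`. -/
theorem regret_le_of_gap_ne_top [NeZero K] [IsProbabilityMeasure P] (hN : N + 1 ≤ K)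
    {T c lag : ℕ} (hT : 2 ≤ T) (hKT : K ≤ T) (hc : 1 ≤ c) (hlag : lag = 1 ∨ lag = 0 ∧ c = 1)
    (hgap : B.gap ≠ ⊤) {D : ℝ}
    (hD : ∀ r : ℕ, ((r + 1 : ℕ) : ℝ) ^ c + r / 4 ≤ D + (r : ℝ) ^ c * (1 + 1 / (2 * c)))
    {x : ℝ} (hx : x = 192 * ((N + 1 : ℕ) : ℝ) ^ 2 * Real.log T / B.gap.toReal ^ 2)
    {W : ℝ} (hW0 : 0 ≤ W) (hW : ∀ r : ℕ, (2 : ℝ) ^ r ^ c ≤ x → ((r + 2 : ℕ) : ℝ) ^ c ≤ W) :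
    B.regret (metcElim K T c lag) T ≤
      24 * ((N + 1 : ℕ) * K * Real.log T) +
      8 * ((N + 1 : ℕ) : ℝ) ^ 2 * K * Real.sqrt (3 * Real.log T) *
        (2 ^ D * x ^ ((1 + 1 / (c : ℝ)) / 2) * (1 - (2 : ℝ) ^ (-(1 / 4) : ℝ))⁻¹) +
      20 * (3 ^ c * 4) ^ 2 *
        (((N + 1 : ℕ) : ℝ) ^ 2 * K * Real.log T ^ (1 + 1 / (c : ℝ))) +
      3 * (N + 1 : ℕ) * (W ^ (1 / (c : ℝ)) *
        (8 * ((N + 1 : ℕ) : ℝ) ^ 2 * K * Real.log K + 2 * (N + 1 : ℕ) * K * W)) := by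
  classical
  have hl := half_le_log hT
  have hK : 1 ≤ K := by omega
  have hK1 : (1 : ℝ) ≤ K := by exact_mod_cast hK
  have hn1 : (1 : ℝ) ≤ (N + 1 : ℕ) := by exact_mod_cast Nat.succ_pos N
  have hΔ := B.gap_toReal_pos hgap
  have hL2 := two_le_radiusLog (n := N + 1) (by omega) hK hT
  have hL := radiusLog_le (n := N + 1) (by omega) hN hKT hT
  have hε0 : ∀ p, 0 ≤ eps (N + 1) K T c p := eps_nonneg c
  have hεsq := eps_sq (n := N + 1) (K := K) (T := T) (by linarith) c
  set n : ℝ := ((N + 1 : ℕ) : ℝ) with hn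
  set l := Real.log T with hldef
  set Δ := B.gap.toReal with hΔdef
  set ε := eps (N + 1) K T c with hε
  obtain ⟨q₁, hq1, hq2, hq3⟩ := exists_two_pow_pow_ge hc hT
  -- The epochs that do not resolve the gap. Squaring gives `64 / 2 = 32`, and `radiusLog ≤ 6 ln T`
  -- turns it into the constant `192` of `x`.
  have hnear : ∀ r, Δ ≤ 8 * n * ε r → (2 : ℝ) ^ r ^ c ≤ x := by
    intro r hr
    have h1 : Δ ^ 2 ≤ (8 * n * ε r) ^ 2 := pow_le_pow_left₀ hΔ.le hr 2
    rw [mul_pow, hεsq, pow_add, pow_one] at h1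
    rw [hx, le_div_iff₀ (by positivity)]
    have h2 : (0 : ℝ) < 2 ^ r ^ c := by positivity
    have h3 : (8 * n) ^ 2 * (radiusLog (N + 1) K T / (2 * 2 ^ r ^ c)) * 2 ^ r ^ c =
        32 * n ^ 2 * radiusLog (N + 1) K T := by
      field_simp
      ring
    have h4 := mul_le_mul_of_nonneg_right h1 h2.le
    rw [h3] at h4
    have h5 : 32 * n ^ 2 * radiusLog (N + 1) K T ≤ 32 * n ^ 2 * (6 * l) := by gcongr
    linarith
  have hgapc : ∀ π : Fin (N + 1) → Fin K, Function.Injective π → ∀ θ : ℝ,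
      B.maxUtility - weight B.mean π ≤ θ → B.maxUtility - weight B.mean π = 0 ∨ Δ ≤ θ := by
    intro π hπ θ h
    by_cases he : weight B.mean π = B.maxUtility
    · left
      linarith
    · right
      exact (B.gap_toReal_le hπ he).trans h
  -- A loss smaller than the gap is zero. So explorations cost nothing once `8 n ε (q - 1) < Δ`, and
  -- a bit costs only its collision once `8 n ε (q - 2) < Δ`; the communication arms may come from
  -- the preceding epoch.
  have hreg := B.regret_metcElim_le hN hT hc hlag (e' := 0) (q₁ := q₁)
    (a := fun q => if Δ ≤ 8 * n * ε (q - 1) then 8 * n * ε (q - 1) else 0)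
    (ρ := fun q => 2 + if Δ ≤ 8 * n * ε (q - 2) then 3 * n else 0)
    le_rfl (fun q => by
      have := hε0 (q - 1)
      split_ifs <;> positivity) (fun q => by split_ifs <;> positivity)
    (fun q _ π hπ h => by
      rw [zero_add]
      split_ifs with h'
      · exact h
      · rcases hgapc π hπ _ h with h1 | h1
        · rw [h1]
        · exact absurd h1 h')
    (fun q _ π hπ h => by
      rw [zero_add]
      split_ifs with h'
      · have h1 := B.maxUtility_le hN
        have h2 : 0 ≤ weight B.mean π := Finset.sum_nonneg fun m _ => (B.mean_mem_Icc m _).1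
        have h3 : B.maxUtility ≤ n := h1
        linarith
      · rcases hgapc π hπ _ h with h1 | h1
        · rw [h1]
        · exact absurd h1 h')
    (Or.inl hq2) hq1
  rw [epochsCost_eq] at hreg
  have hexpl : ∑ q ∈ Finset.Ico 1 (q₁ + 1), n * K * 2 ^ q ^ c *
      (if Δ ≤ 8 * n * ε (q - 1) then 8 * n * ε (q - 1) else 0) ≤
      8 * n ^ 2 * K * Real.sqrt (3 * l) *
        (2 ^ D * x ^ ((1 + 1 / (c : ℝ)) / 2) * (1 - (2 : ℝ) ^ (-(1 / 4) : ℝ))⁻¹) := by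
    have hx0 : 0 ≤ x := by
      rw [hx]
      positivity
    set A := 8 * n ^ 2 * K * Real.sqrt (3 * l) * (2 ^ D * x ^ ((1 + 1 / (c : ℝ)) / 2)) with hA
    have hA0 : 0 ≤ A := by positivity
    set b : ℝ := (2 : ℝ) ^ (-(1 / 4) : ℝ) with hb
    have hb0 : 0 ≤ b := by positivity
    have hb1 : b < 1 := Real.rpow_lt_one_of_one_lt_of_neg (by norm_num) (by norm_num)
    have hterm : ∀ r : ℕ, n * K * 2 ^ (1 + r) ^ c *
        (if Δ ≤ 8 * n * ε (1 + r - 1) then 8 * n * ε (1 + r - 1) else 0) ≤ A * b ^ r := by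
      intro r
      rw [Nat.add_sub_cancel_left]
      split_ifs with h
      · have h1 := two_pow_succ_div_sqrt_le hc hD (hnear r h)
        have h2 : ε r ≤ Real.sqrt (3 * l) / Real.sqrt (2 ^ r ^ c) := by
          rw [← Real.sqrt_div' _ (by positivity), hε, eps_eq, pow_add, pow_one, ← div_div]
          gcongr
          linarith
        rw [Nat.add_comm 1 r]
        calc n * K * 2 ^ (r + 1) ^ c * (8 * n * ε r)
            ≤ n * K * 2 ^ (r + 1) ^ c *
              (8 * n * (Real.sqrt (3 * l) / Real.sqrt (2 ^ r ^ c))) := by gcongr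
          _ = 8 * n ^ 2 * K * Real.sqrt (3 * l) *
              ((2 : ℝ) ^ (r + 1) ^ c / Real.sqrt (2 ^ r ^ c)) := by ring
          _ ≤ 8 * n ^ 2 * K * Real.sqrt (3 * l) *
              (2 ^ D * x ^ ((1 + 1 / (c : ℝ)) / 2) * b ^ r) := by gcongr
          _ = A * b ^ r := by rw [hA]; ring
      · rw [mul_zero]
        positivity
    rw [Finset.sum_Ico_eq_sum_range, Nat.add_sub_cancel]
    calc _ ≤ ∑ r ∈ Finset.range q₁, A * b ^ r := Finset.sum_le_sum fun r _ => hterm r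
      _ = A * ∑ r ∈ Finset.range q₁, b ^ r := (Finset.mul_sum _ _ _).symm
      _ ≤ A * (1 - b)⁻¹ := by
        gcongr
        rw [← tsum_geometric_of_lt_one hb0 hb1]
        exact (summable_geometric_of_lt_one hb0 hb1).sum_le_tsum _ fun r _ => by positivity
      _ = _ := by rw [hA]; ring
  -- The collision cost `2` is paid for all bits until the horizon. The extra `3 n` is paid only in
  -- epochs that do not yet resolve the gap, and these satisfy `q ^ c ≤ W`.
  have hcomm : ∑ q ∈ Finset.Ico 1 (q₁ + 1),
      ((announceBits N K ((N + 1) * K) + N * (K * valueBits c q) : ℕ) : ℝ) *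
        (2 + if Δ ≤ 8 * n * ε (q - 2) then 3 * n else 0) ≤
      20 * (3 ^ c * 4) ^ 2 * (n ^ 2 * K * l ^ (1 + 1 / (c : ℝ))) +
      3 * n * (W ^ (1 / (c : ℝ)) * (8 * n ^ 2 * K * Real.log K + 2 * n * K * W)) := by
    simp only [mul_add]
    rw [Finset.sum_add_distrib, ← Finset.sum_mul]
    refine add_le_add ?_ ?_
    · have := sum_epochBits_le_log hN hc hKT hT (s := Finset.Ico 1 (q₁ + 1)) fun r hr => by
        rw [Finset.mem_Ico] at hr
        refine ⟨hr.1, le_trans ?_ hq3⟩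
        gcongr
        omega
      linarith
    · simp only [mul_ite, mul_zero]
      rw [← Finset.sum_filter, ← Finset.sum_mul]
      have := sum_epochBits_le hN hc hW0
        (s := (Finset.Ico 1 (q₁ + 1)).filter fun q => Δ ≤ 8 * n * ε (q - 2)) fun q hq => by
          rw [Finset.mem_filter, Finset.mem_Ico] at hq
          refine ⟨hq.1.1, le_trans ?_ (hW (q - 2) (hnear _ hq.2))⟩
          gcongr
          omega
      have h3 := mul_le_mul_of_nonneg_right this (by positivity : (0 : ℝ) ≤ 3 * n)
      linarith
  have hlogK : Real.log K ≤ l := Real.log_le_log (by linarith) (by exact_mod_cast hKT)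
  have hbase : n * K * (2 * Real.log K + 10 * l) ≤ n * K * (24 * l) := by
    gcongr
    linarith
  linarith

end Environment

/-! ### Elementary inequalities for real powers -/

section Powers

theorem one_quarter_pow_le {c : ℕ} (hc : 1 ≤ c) {v : ℝ} (hv : 1 / 4 ≤ v) :
    1 / 4 ≤ v ^ (1 / (c : ℝ)) := by
  have hc1 : (1 : ℝ) ≤ c := by exact_mod_cast hc
  calc (1 / 4 : ℝ) = (1 / 4) ^ (1 : ℝ) := (Real.rpow_one _).symm
    _ ≤ (1 / 4) ^ (1 / (c : ℝ)) := by
      refine Real.rpow_le_rpow_of_exponent_ge (by norm_num) (by norm_num) ?_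
      rw [div_le_one (by linarith)]
      exact hc1
    _ ≤ _ := Real.rpow_le_rpow (by norm_num) hv (by positivity)

theorem le_four_mul_rpow {c : ℕ} (hc : 1 ≤ c) {v : ℝ} (hv : 1 / 4 ≤ v) :
    v ≤ 4 * v ^ (1 + 1 / (c : ℝ)) := by
  have := one_quarter_pow_le hc hv
  rw [Real.rpow_add (by linarith), Real.rpow_one]
  nlinarith

/-- The powers of `l` combine to `l ^ (-1 / (2 c))`, which is at most `4` as `l ≥ 1 / 4`; the
constant is `2 * 192 * 4`. -/
theorem sqrt_mul_rpow_le {c : ℕ} (hc : 1 ≤ c) {v l : ℝ} (hv : 0 ≤ v) (hl : 1 / 4 ≤ l) :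
    Real.sqrt (3 * l) * (192 * v ^ 2 / l) ^ ((1 + 1 / (c : ℝ)) / 2) ≤
      1536 * v ^ (1 + 1 / (c : ℝ)) := by
  have hc1 : (1 : ℝ) ≤ c := by exact_mod_cast hc
  have hl0 : 0 < l := by linarith
  have h1 : (192 * v ^ 2 / l) ^ ((1 + 1 / (c : ℝ)) / 2) =
      192 ^ ((1 + 1 / (c : ℝ)) / 2) * v ^ (1 + 1 / (c : ℝ)) /
        (Real.sqrt l * l ^ (1 / ((2 * c : ℕ) : ℝ))) := by
    rw [Real.div_rpow (by positivity) hl0.le, Real.mul_rpow (by norm_num) (by positivity),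
      ← Real.rpow_natCast, ← Real.rpow_mul hv, Real.sqrt_eq_rpow, ← Real.rpow_add hl0]
    congr 3
    · push_cast
      ring
    · push_cast
      field_simp
  have h2 : (192 : ℝ) ^ ((1 + 1 / (c : ℝ)) / 2) ≤ 192 := by
    have h3 : 1 / (c : ℝ) ≤ 1 := by
      rw [div_le_one (by linarith)]
      exact hc1
    simpa using Real.rpow_le_rpow_of_exponent_le (by norm_num : (1 : ℝ) ≤ 192)
      (by linarith : (1 + 1 / (c : ℝ)) / 2 ≤ 1)
  have h3 := one_quarter_pow_le (c := 2 * c) (by omega) hl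
  have h4 : Real.sqrt (3 * l) ≤ 2 * Real.sqrt l := by
    rw [Real.sqrt_mul (by norm_num)]
    gcongr
    rw [Real.sqrt_le_left (by norm_num)]
    norm_num
  have hs : 0 < Real.sqrt l := Real.sqrt_pos.2 hl0
  have hve : 0 ≤ v ^ (1 + 1 / (c : ℝ)) := by positivity
  rw [h1, mul_div_assoc', div_le_iff₀ (by positivity)]
  calc Real.sqrt (3 * l) * (192 ^ ((1 + 1 / (c : ℝ)) / 2) * v ^ (1 + 1 / (c : ℝ)))
      ≤ 2 * Real.sqrt l * (192 * v ^ (1 + 1 / (c : ℝ))) := by gcongr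
    _ = 1536 * v ^ (1 + 1 / (c : ℝ)) * (Real.sqrt l * (1 / 4)) := by ring
    _ ≤ _ := by gcongr

end Powers

namespace Environment

variable {N K : ℕ} {Ω : Type*} [MeasurableSpace Ω] {P : Measure Ω} (B : Environment (N + 1) K P)

/-- With `v = n ln T / Δ` and `e = 1 + 1 / c`, every contribution is at most a constant times `n ^ 2
K v ^ e`. The stated form follows from `n v ^ e ≤ (n v) ^ e`. -/
theorem regret_le_rpow_of_gap_ne_top [NeZero K] [IsProbabilityMeasure P] (hN : N + 1 ≤ K)
    {T c lag : ℕ} (hT : 2 ≤ T) (hc : 1 ≤ c) (hlag : lag = 1 ∨ lag = 0 ∧ c = 1)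
    (hgap : B.gap ≠ ⊤) {D : ℝ}
    (hD : ∀ r : ℕ, ((r + 1 : ℕ) : ℝ) ^ c + r / 4 ≤ D + (r : ℝ) ^ c * (1 + 1 / (2 * c))) :
    B.regret (metcElim K T c lag) T ≤
      (192 + 12288 * 2 ^ D * (1 - (2 : ℝ) ^ (-(1 / 4) : ℝ))⁻¹ + 80 * (3 ^ c * 4) ^ 2 +
        54 * (3 ^ c * 44) ^ 2) *
      ((N + 1 : ℕ) * K *
        (((N + 1 : ℕ) : ℝ) ^ 2 * Real.log T / B.gap.toReal) ^ (1 + 1 / (c : ℝ))) := by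
  have hl := half_le_log hT
  have hK1 : (1 : ℝ) ≤ K := by exact_mod_cast (by omega : 1 ≤ K)
  have hn1 : (1 : ℝ) ≤ (N + 1 : ℕ) := by exact_mod_cast Nat.succ_pos N
  have hc1 : (1 : ℝ) ≤ c := by exact_mod_cast hc
  have hΔ := B.gap_toReal_pos hgap
  have hΔ2 := B.gap_toReal_le_two hN hgap
  have hb1 : (2 : ℝ) ^ (-(1 / 4) : ℝ) < 1 :=
    Real.rpow_lt_one_of_one_lt_of_neg (by norm_num) (by norm_num)
  have hS : 0 ≤ (1 - (2 : ℝ) ^ (-(1 / 4) : ℝ))⁻¹ := inv_nonneg.2 (by linarith)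
  have htriv := B.regret_le_mul hN T c lag
  have hbig := fun hKT x (hx : x = _) (W : ℝ) => B.regret_le_of_gap_ne_top hN hT hKT hc hlag
    hgap hD (x := x) hx (W := W)
  generalize (1 - (2 : ℝ) ^ (-(1 / 4) : ℝ))⁻¹ = S at *
  set n : ℝ := ((N + 1 : ℕ) : ℝ) with hn
  set l := Real.log T with hldef
  set Δ := B.gap.toReal with hΔdef
  set R := B.regret (metcElim K T c lag) T
  set v := n * l / Δ with hv
  set e := 1 + 1 / (c : ℝ) with he
  have he1 : 1 ≤ e := by
    have : 0 ≤ 1 / (c : ℝ) := by positivity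
    linarith
  have he2 : e ≤ 2 := by
    have : 1 / (c : ℝ) ≤ 1 := by
      rw [div_le_one (by linarith)]
      exact hc1
    linarith
  -- This uses `Δ ≤ 2`; it keeps `v` away from `0` and lets terms without the gap be absorbed.
  have hlv : l ≤ 2 * v := by
    rw [hv, mul_div_assoc', le_div_iff₀ hΔ]
    nlinarith
  have hv4 : 1 / 4 ≤ v := by linarith
  have hve := le_four_mul_rpow hc hv4
  rw [← he] at hve
  have hve0 : 0 ≤ v ^ e := by positivity
  have hz : n ^ 2 * l / Δ = n * v := by
    rw [hv]
    ring
  have hzv : n * v ^ e ≤ (n * v) ^ e := by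
    rw [Real.mul_rpow (by linarith) (by linarith)]
    gcongr
    simpa using Real.rpow_le_rpow_of_exponent_le hn1 he1
  have hfin : n ^ 2 * K * v ^ e ≤ n * K * (n * v) ^ e := by
    calc n ^ 2 * K * v ^ e = n * K * (n * v ^ e) := by ring
      _ ≤ _ := by gcongr
  rw [hz]
  have hD0 : (0 : ℝ) < 2 ^ D := by positivity
  refine le_trans ?_ (mul_le_mul_of_nonneg_left hfin (by positivity))
  have hnK : n * K ≤ n ^ 2 * K := by
    gcongr
    nlinarith
  have hnKv : n * K * v ≤ 4 * (n ^ 2 * K * v ^ e) := by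
    calc n * K * v ≤ n ^ 2 * K * (4 * v ^ e) := by gcongr
      _ = _ := by ring
  rcases Nat.lt_or_ge T K with hTK | hKT
  · have h1 : (T : ℝ) * n ≤ K * n := by gcongr
    have h2 : n * K * (1 / 4) ≤ n * K * v := by gcongr
    have h3 : 0 ≤ (12288 * 2 ^ D * S + 80 * (3 ^ c * 4) ^ 2 + 54 * (3 ^ c * 44) ^ 2) *
      (n ^ 2 * K * v ^ e) := by positivity
    have h4 : 0 ≤ n ^ 2 * K * v ^ e := by positivity
    linarith
  · have hlogK : Real.log K ≤ l := Real.log_le_log (by linarith) (by exact_mod_cast hKT)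
    have hxv : 192 * n ^ 2 * l / Δ ^ 2 = 192 * v ^ 2 / l := by
      rw [hv]
      field_simp
    set β : ℝ := 3 ^ c * 44 with hβ
    have hβ1 : 1 ≤ β := by
      have : (1 : ℝ) ≤ 3 ^ c := one_le_pow₀ (by norm_num)
      linarith
    -- As `k ^ 2 ≤ 4 * 2 ^ k`, the condition on `r` gives `(r ^ c) ^ 2 ≤ 768 v ^ 2 / l ≤ (40 v) ^
    -- 2`. Passing to `r + 2` costs `3 ^ c` and an additive `1 ≤ 4 v`, whence `β`.
    have h := hbig hKT _ rfl (β * v) (by positivity) fun r hr => by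
      rw [hxv, le_div_iff₀ (by linarith)] at hr
      have h1 : ((r : ℝ) ^ c) ^ 2 ≤ 4 * 2 ^ r ^ c := by
        exact_mod_cast sq_le_four_mul_two_pow (r ^ c)
      have h2 : (r : ℝ) ^ c ≤ 40 * v := by
        refine le_of_sq_le_sq ?_ (by positivity)
        have h3 : (0 : ℝ) < 2 ^ r ^ c := by positivity
        nlinarith
      calc ((r + 2 : ℕ) : ℝ) ^ c ≤ 3 ^ c * (40 * v + 1) := add_two_pow_le c r h2
        _ ≤ 3 ^ c * (44 * v) := by gcongr; linarith
        _ = β * v := by rw [hβ]; ring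
    have t1 : 24 * (n * K * l) ≤ 192 * (n ^ 2 * K * v ^ e) := by
      have : n * K * l ≤ n * K * (2 * v) := by gcongr
      linarith
    have t2 : 8 * n ^ 2 * K * Real.sqrt (3 * l) *
        (2 ^ D * (192 * n ^ 2 * l / Δ ^ 2) ^ (e / 2) * S) ≤
        12288 * 2 ^ D * S * (n ^ 2 * K * v ^ e) := by
      rw [hxv]
      calc _ = 8 * n ^ 2 * K * 2 ^ D * S *
            (Real.sqrt (3 * l) * (192 * v ^ 2 / l) ^ (e / 2)) := by ring
        _ ≤ 8 * n ^ 2 * K * 2 ^ D * S * (1536 * v ^ e) := by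
          have := sqrt_mul_rpow_le (v := v) (l := l) hc (by linarith) (by linarith)
          gcongr
        _ = _ := by ring
    have t3 : 20 * (3 ^ c * 4) ^ 2 * (n ^ 2 * K * l ^ e) ≤
        80 * (3 ^ c * 4) ^ 2 * (n ^ 2 * K * v ^ e) := by
      have h1 : l ^ e ≤ 4 * v ^ e := by
        calc l ^ e ≤ (2 * v) ^ e := Real.rpow_le_rpow (by linarith) hlv (by linarith)
          _ = 2 ^ e * v ^ e := Real.mul_rpow (by norm_num) (by linarith)
          _ ≤ 4 * v ^ e := by
            gcongr
            calc (2 : ℝ) ^ e ≤ 2 ^ (2 : ℝ) :=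
                  Real.rpow_le_rpow_of_exponent_le (by norm_num) he2
              _ = 4 := by norm_num
      calc _ ≤ 20 * (3 ^ c * 4) ^ 2 * (n ^ 2 * K * (4 * v ^ e)) := by gcongr
        _ = _ := by ring
    have t4 : 3 * n * ((β * v) ^ (1 / (c : ℝ)) *
        (8 * n ^ 2 * K * Real.log K + 2 * n * K * (β * v))) ≤
        54 * β ^ 2 * (n ^ 2 * K * v ^ e) := by
      have h1 := rpow_one_div_le_self_mul hc hβ1 (by linarith : 0 ≤ v)
      have h2 : n * l = v * Δ := by
        rw [hv]
        field_simp
      -- Trading `n ln K ≤ n ln T = v Δ ≤ 2 v` saves a factor `n`, which pays for the loss `3 n` per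
      -- bit.
      have h3 : 8 * n ^ 2 * K * Real.log K ≤ 16 * (n * K * (β * v)) := by
        calc 8 * n ^ 2 * K * Real.log K ≤ 8 * n ^ 2 * K * l := by gcongr
          _ = 8 * n * K * (n * l) := by ring
          _ = 8 * n * K * (v * Δ) := by rw [h2]
          _ ≤ 8 * n * K * (v * 2) := by gcongr
          _ = 16 * (n * K * (1 * v)) := by ring
          _ ≤ _ := by gcongr
      have h4 : v ^ e = v * v ^ (1 / (c : ℝ)) := by
        rw [he, Real.rpow_add (by linarith), Real.rpow_one]
      calc _ ≤ 3 * n * ((β * v ^ (1 / (c : ℝ))) *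
            (16 * (n * K * (β * v)) + 2 * n * K * (β * v))) := by gcongr
        _ = _ := by rw [h4]; ring
    linarith

end Environment

/-! ## The bounds for `c = 1` and a large horizon -/

section LargeHorizon

variable {K N T : ℕ}

theorem pow_four_le_mul_two_pow (k : ℕ) : k ^ 4 ≤ 32 * 2 ^ k := by
  induction k with
  | zero => norm_num
  | succ k ih =>
    rcases Nat.lt_or_ge k 6 with h | h
    · interval_cases k <;> norm_num
    · have h1 : (k + 1) ^ 4 ≤ 2 * k ^ 4 := by
        obtain ⟨j, rfl⟩ := Nat.exists_eq_add_of_le h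
        ring_nf
        nlinarith [sq_nonneg j, pow_nonneg (Nat.zero_le j) 3, pow_nonneg (Nat.zero_le j) 4]
      rw [pow_succ 2 k]
      linarith

/-- A geometric sum of ratio `√2` is dominated by its last term; the induction only needs `√2 ≥ 4 /
3`. -/
theorem sum_sqrt_two_pow_le (m : ℕ) :
    ∑ i ∈ Finset.range (m + 1), Real.sqrt (2 ^ i) ≤ 4 * Real.sqrt (2 ^ m) := by
  induction m with
  | zero => simp
  | succ m ih =>
    rw [Finset.sum_range_succ]
    have h1 : (4 : ℝ) / 3 ≤ Real.sqrt 2 := Real.le_sqrt_of_sq_le (by norm_num)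
    have h2 : Real.sqrt (2 ^ (m + 1)) = Real.sqrt (2 ^ m) * Real.sqrt 2 := by
      rw [pow_succ, Real.sqrt_mul (by positivity)]
    have h3 := Real.sqrt_nonneg ((2 : ℝ) ^ m)
    nlinarith

/-- For `c = 1` and `q = i + 1`, the product `2 ^ q * ε (q - 1)` equals `√(2 L 2 ^ i)`, so the last
epoch dominates. -/
theorem sum_explore_le (m : ℕ) : ∑ q ∈ Finset.Ico 1 (m + 2), ((N + 1 : ℕ) : ℝ) * K * 2 ^ q ^ 1 *
      (8 * (N + 1 : ℕ) * eps (N + 1) K T 1 (q - 1)) ≤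
    32 * (((N + 1 : ℕ) : ℝ) ^ 2 * K) * Real.sqrt (2 * radiusLog (N + 1) K T * 2 ^ m) := by
  set n : ℝ := ((N + 1 : ℕ) : ℝ)
  set L := radiusLog (N + 1) K T
  have hterm : ∀ i : ℕ, n * K * 2 ^ (1 + i) ^ 1 * (8 * n * eps (N + 1) K T 1 (1 + i - 1)) =
      8 * (n ^ 2 * K) * Real.sqrt (2 * L) * Real.sqrt (2 ^ i) := by
    intro i
    rw [Nat.add_sub_cancel_left, eps_eq, pow_one, pow_one]
    have h1 : Real.sqrt (L / 2 ^ (1 + i)) * 2 ^ (1 + i) = Real.sqrt (2 * L) * Real.sqrt (2 ^ i) := by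
      rw [← Real.sqrt_mul' _ (by positivity)]
      have h2 : (2 : ℝ) ^ (1 + i) = Real.sqrt ((2 ^ (1 + i)) ^ 2) :=
        (Real.sqrt_sq (by positivity)).symm
      rw [h2, ← Real.sqrt_mul' _ (by positivity), Real.sqrt_sq (by positivity)]
      congr 1
      rw [pow_add, pow_one]
      field_simp
    calc _ = 8 * (n ^ 2 * K) * (Real.sqrt (L / 2 ^ (1 + i)) * 2 ^ (1 + i)) := by ring
      _ = _ := by rw [h1]; ring
  rw [Finset.sum_Ico_eq_sum_range, show m + 2 - 1 = m + 1 by omega,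
    Finset.sum_congr rfl fun i _ => hterm i, ← Finset.mul_sum,
    Real.sqrt_mul' (2 * L) (by positivity : (0 : ℝ) ≤ 2 ^ m)]
  have := mul_le_mul_of_nonneg_left (sum_sqrt_two_pow_le m)
    (by positivity : 0 ≤ 8 * (n ^ 2 * K) * Real.sqrt (2 * L))
  linarith

/-- The dependence on `N` and `K` is crude, with `ln K ≤ K` and the full loss `3 n` per bit; a large
horizon will absorb it. -/
theorem sum_communication_le (hN : N + 1 ≤ K) (q : ℕ) :
    ∑ r ∈ Finset.Ico 1 (q + 1),
      ((announceBits N K ((N + 1) * K) + N * (K * valueBits 1 r) : ℕ) : ℝ) * (3 * (N + 1 : ℕ)) ≤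
    30 * (((N + 1 : ℕ) : ℝ) ^ 3 * (K : ℝ) ^ 2) * (q : ℝ) ^ 2 := by
  have hK1 : (1 : ℝ) ≤ K := by exact_mod_cast (by omega : 1 ≤ K)
  have hn1 : (1 : ℝ) ≤ (N + 1 : ℕ) := by exact_mod_cast Nat.succ_pos N
  have hlogK : Real.log K ≤ K := by linarith [Real.log_le_sub_one_of_pos (by linarith : (0 : ℝ) < K)]
  rcases Nat.eq_zero_or_pos q with rfl | hq
  · simp
  have hq1 : (1 : ℝ) ≤ q := by exact_mod_cast hq
  have h := sum_epochBits_le hN le_rfl (W := q) (by positivity) (s := Finset.Ico 1 (q + 1))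
    fun r hr => by
      rw [Finset.mem_Ico] at hr
      rw [pow_one]
      exact ⟨hr.1, by exact_mod_cast (by omega : r ≤ q)⟩
  rw [← Finset.sum_mul]
  set n : ℝ := ((N + 1 : ℕ) : ℝ)
  have h1 : 8 * n ^ 2 * K * Real.log K + 2 * n * K * q ≤ 10 * (n ^ 2 * (K : ℝ) ^ 2) * q := by
    have e1 : n ^ 2 * K * Real.log K ≤ n ^ 2 * K * (K * q) := by
      gcongr
      nlinarith
    have e2 : n * K * q ≤ n ^ 2 * (K : ℝ) ^ 2 * q := by
      gcongr <;> nlinarith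
    linarith
  rw [Nat.cast_one, div_one, Real.rpow_one] at h
  calc _ ≤ (q * (8 * n ^ 2 * K * Real.log K + 2 * n * K * q)) * (3 * n) := by gcongr
    _ ≤ (q * (10 * (n ^ 2 * (K : ℝ) ^ 2) * q)) * (3 * n) := by gcongr
    _ = _ := by ring

end LargeHorizon

namespace Environment

variable {N K : ℕ} {Ω : Type*} [MeasurableSpace Ω] {P : Measure Ω} (B : Environment (N + 1) K P)

theorem two_add_loss_le [IsProbabilityMeasure P] (hN : N + 1 ≤ K) (π : Fin (N + 1) → Fin K) :
    2 + (B.maxUtility - weight B.mean π) ≤ 3 * (N + 1 : ℕ) := by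
  have h1 := B.maxUtility_le hN
  have h2 : 0 ≤ weight B.mean π := Finset.sum_nonneg fun m _ => (B.mean_mem_Icc m _).1
  have hn1 : (1 : ℝ) ≤ (N + 1 : ℕ) := by exact_mod_cast Nat.succ_pos N
  linarith

/-- Equal utilities and a unique maximum leave only one matching, hence a single arm and a single
player. -/
theorem regret_nonpos_of_unique_of_gap_eq_top [NeZero K] [IsProbabilityMeasure P] (hN : N + 1 ≤ K)
    (T c lag : ℕ) (hgap : B.gap = ⊤) (hu : ∃! π, B.IsOptimal π) :
    B.regret (metcElim K T c lag) T ≤ 0 := by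
  have hK : K = 1 := by
    by_contra hK
    have hK2 : 1 < K := by omega
    obtain ⟨π, h1, h2⟩ := exists_injective_apply_eq hN 0 (⟨0, by omega⟩ : Fin K)
    obtain ⟨π', h1', h2'⟩ := exists_injective_apply_eq hN 0 (⟨1, hK2⟩ : Fin K)
    rw [B.eq_of_gap_eq_top hgap hu h1 h1', h2'] at h2
    simp at h2
  have hN0 : N = 0 := by omega
  subst hN0
  have := B.regret_le_of_measure hN (measurableProg_metcElim (K := K) T c lag) T
    (S := ∅) (b := 0) (p := 0) le_rfl le_rfl (by simp) fun ω _ =>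
      Finset.sum_nonpos fun t _ => by
        have hinj : Function.Injective (B.armsAt (metcElim K T c lag) t ω) :=
          fun i j _ => Fin.ext (by omega)
        rw [meanReward_of_injective _ hinj, B.weight_eq_of_gap_eq_top hgap hinj, sub_self]
  simpa using this

/-- The bound for a unique maximum matching. -/
theorem regret_le_of_unique [NeZero K] [IsProbabilityMeasure P] (hN : N + 1 ≤ K)
    {T lag : ℕ} (hT : 2 ≤ T) (hKT : K ≤ T) (hlag : lag = 1 ∨ lag = 0)
    (hbig : (((N + 1 : ℕ) : ℝ) * K) ^ 2 ≤ Real.log T) (hu : ∃! π, B.IsOptimal π) :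
    B.regret (metcElim K T 1 lag) T ≤
      8000 * (((N + 1 : ℕ) : ℝ) ^ 3 * K * Real.log T / B.gap.toReal) := by
  have hl := half_le_log hT
  by_cases hgap : B.gap = ⊤
  -- `toReal` sends `∞` to `0` and division by `0` gives `0`, so the regret has to be shown
  -- nonpositive here.
  · rw [hgap]
    simpa using B.regret_nonpos_of_unique_of_gap_eq_top hN T 1 lag hgap hu
  have hK : 1 ≤ K := by omega
  have hK1 : (1 : ℝ) ≤ K := by exact_mod_cast hK
  have hn1 : (1 : ℝ) ≤ (N + 1 : ℕ) := by exact_mod_cast Nat.succ_pos N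
  have hΔ := B.gap_toReal_pos hgap
  have hΔ2 := B.gap_toReal_le_two hN hgap
  have hL2 := two_le_radiusLog (n := N + 1) (by omega) hK hT
  have hL := radiusLog_le (n := N + 1) (by omega) hN hKT hT
  have hεsq := eps_sq (n := N + 1) (K := K) (T := T) (by linarith) 1
  have hε0 : ∀ p, 0 ≤ eps (N + 1) K T 1 p := eps_nonneg 1
  have hloss := B.two_add_loss_le hN
  obtain ⟨π₀, ho, huniq⟩ := hu
  set n : ℝ := ((N + 1 : ℕ) : ℝ) with hn
  set l := Real.log T with hldef
  set Δ := B.gap.toReal with hΔdef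
  set L := radiusLog (N + 1) K T with hLdef
  set x := 32 * n ^ 2 * L / Δ ^ 2 with hx
  have hx1 : 1 ≤ x := by
    rw [hx, le_div_iff₀ (by positivity)]
    have h1 : (1 : ℝ) ≤ n ^ 2 := one_le_pow₀ hn1
    have h2 : Δ ^ 2 ≤ 4 := by nlinarith
    nlinarith
  -- `x` is such that `x < 2 ^ (r + 1)` means `8 n ε (r + 1) < Δ`. By epoch `r + 2` only the maximum
  -- matching can be a candidate, and `2 ^ r ≤ x` bounds the cost of getting there.
  obtain ⟨r, hr1, hr2⟩ := exists_nat_pow_near hx1 (by norm_num : (1 : ℝ) < 2)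
  have hsmall : 8 * n * eps (N + 1) K T 1 (r + 1) < Δ := by
    refine lt_of_pow_lt_pow_left₀ 2 hΔ.le ?_
    rw [mul_pow, hεsq, pow_one, pow_add, pow_one]
    rw [hx, div_lt_iff₀ (by positivity)] at hr2
    rw [mul_div_assoc', div_lt_iff₀ (by positivity)]
    linarith
  have hreg := B.regret_metcElim_le hN hT le_rfl (hlag.imp_right fun h => ⟨h, rfl⟩)
    (e' := 0) (q₁ := r + 2)
    (a := fun q => 8 * n * eps (N + 1) K T 1 (q - 1)) (ρ := fun _ => 3 * n) le_rfl
    (fun q => by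
      have := hε0 (q - 1)
      positivity) (fun q => by positivity)
    (fun q _ π _ h => by
      rw [zero_add]
      exact h)
    (fun q _ π _ _ => by
      rw [zero_add]
      exact hloss π)
    (Or.inr ⟨π₀, fun π hπ h => by
      by_cases he : weight B.mean π = B.maxUtility
      · have h1 : B.IsOptimal ⟨π, hπ⟩ := he
        exact congrArg DFunLike.coe (huniq _ h1)
      · have h1 := B.gap_toReal_le hπ he
        exact absurd (h1.trans h) (not_le.2 hsmall)⟩) (by omega)
  rw [epochsCost_eq] at hreg
  have hexpl := sum_explore_le (N := N) (K := K) (T := T) (r + 1)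
  have hcomm := sum_communication_le hN (r + 2)
  rw [← hn] at hexpl hcomm
  have hpow : (2 : ℝ) ^ (r + 1) ≤ 2 * x := by
    rw [pow_succ]
    linarith
  have t1 : Real.sqrt (2 * L * 2 ^ (r + 1)) ≤ 72 * (n * l / Δ) := by
    refine Real.sqrt_le_iff.2 ⟨by positivity, ?_⟩
    calc 2 * L * 2 ^ (r + 1) ≤ 2 * L * (2 * x) := by gcongr
      _ = 128 * (n * L / Δ) ^ 2 := by
        rw [hx]
        field_simp
        ring
      _ ≤ 144 * (n * (6 * l) / Δ) ^ 2 := by gcongr; norm_num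
      _ = _ := by ring
  -- Fourth powers give `(r + 2) ^ 2 = O(√x)`, where `√x` is of order `n √(ln T) / Δ`. The missing
  -- `√(ln T)` pays for the factor `n K`, by `hbig`.
  have t2 : n * K * ((r + 2 : ℕ) : ℝ) ^ 2 ≤ 180 * (n * l / Δ) := by
    have h1 : (((r + 2 : ℕ) : ℝ) ^ 2) ^ 2 ≤ 128 * x := by
      calc (((r + 2 : ℕ) : ℝ) ^ 2) ^ 2 = ((r + 2 : ℕ) : ℝ) ^ 4 := by ring
        _ ≤ 32 * 2 ^ (r + 2) := by exact_mod_cast pow_four_le_mul_two_pow (r + 2)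
        _ = 128 * 2 ^ r := by ring
        _ ≤ _ := by gcongr
    refine le_of_sq_le_sq ?_ (by positivity)
    calc (n * K * ((r + 2 : ℕ) : ℝ) ^ 2) ^ 2 = (n * K) ^ 2 * (((r + 2 : ℕ) : ℝ) ^ 2) ^ 2 := by ring
      _ ≤ l * (128 * (32 * n ^ 2 * (6 * l) / Δ ^ 2)) := by
        gcongr
        refine h1.trans ?_
        rw [hx]
        gcongr
      _ = 24576 * (n * l / Δ) ^ 2 := by ring
      _ ≤ (180 * (n * l / Δ)) ^ 2 := by nlinarith [sq_nonneg (n * l / Δ)]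
  have hlogK : Real.log K ≤ l := Real.log_le_log (by linarith) (by exact_mod_cast hKT)
  have t3 : n * K * (2 * Real.log K + 10 * l) ≤ 24 * (n ^ 3 * K * l / Δ) := by
    have h1 : n ≤ n ^ 3 := le_self_pow₀ hn1 (by norm_num)
    have h2 : l ≤ 2 * (l / Δ) := by
      rw [mul_div_assoc', le_div_iff₀ hΔ]
      nlinarith
    calc n * K * (2 * Real.log K + 10 * l) ≤ n * K * (12 * l) := by gcongr; linarith
      _ ≤ n ^ 3 * K * (12 * (2 * (l / Δ))) := by gcongr
      _ = _ := by ring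
  have t4 : 32 * (n ^ 2 * K) * Real.sqrt (2 * L * 2 ^ (r + 1)) ≤ 2304 * (n ^ 3 * K * l / Δ) := by
    calc _ ≤ 32 * (n ^ 2 * K) * (72 * (n * l / Δ)) := by gcongr
      _ = _ := by ring
  have t5 : 30 * (n ^ 3 * (K : ℝ) ^ 2) * ((r + 2 : ℕ) : ℝ) ^ 2 ≤ 5400 * (n ^ 3 * K * l / Δ) := by
    calc _ = 30 * (n ^ 2 * K) * (n * K * ((r + 2 : ℕ) : ℝ) ^ 2) := by ring
      _ ≤ 30 * (n ^ 2 * K) * (180 * (n * l / Δ)) := by gcongr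
      _ = _ := by ring
  have h0 : 0 ≤ n ^ 3 * K * l / Δ := by positivity
  linarith

/-- The minimax bound. -/
theorem regret_le_sqrt [NeZero K] [IsProbabilityMeasure P] (hN : N + 1 ≤ K)
    {T lag : ℕ} (hT : 2 ≤ T) (hlag : lag = 1 ∨ lag = 0)
    (hbig : ((N + 1) ^ 3 * K ^ 2) ^ 4 ≤ T) :
    B.regret (metcElim K T 1 lag) T ≤
      500000 * (((N + 1 : ℕ) : ℝ) ^ (3 / 2 : ℝ) * Real.sqrt (K * T * Real.log T)) := by
  have hl := half_le_log hT
  have hK : 1 ≤ K := by omega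
  have hb1 : (N + 1) * K ≤ (N + 1) ^ 3 * K ^ 2 :=
    Nat.mul_le_mul (Nat.le_self_pow (by norm_num) _) (Nat.le_self_pow (by norm_num) _)
  have hnKT : (N + 1) * K ≤ T := (hb1.trans (Nat.le_self_pow (by norm_num) _)).trans hbig
  have hKT : K ≤ T := (Nat.le_mul_of_pos_left K (Nat.succ_pos N)).trans hnKT
  have hK1 : (1 : ℝ) ≤ K := by exact_mod_cast hK
  have hn1 : (1 : ℝ) ≤ (N + 1 : ℕ) := by exact_mod_cast Nat.succ_pos N
  have hT0 : (0 : ℝ) < T := by exact_mod_cast (by omega : 0 < T)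
  have hL2 := two_le_radiusLog (n := N + 1) (by omega) hK hT
  have hL := radiusLog_le (n := N + 1) (by omega) hN hKT hT
  have hε0 : ∀ p, 0 ≤ eps (N + 1) K T 1 p := eps_nonneg 1
  have hεa := eps_antitone (n := N + 1) (K := K) (T := T) (by linarith) 1
  have hloss := B.two_add_loss_le hN
  have hbig' : ((((N + 1 : ℕ) : ℝ)) ^ 3 * (K : ℝ) ^ 2) ^ 4 ≤ T := by exact_mod_cast hbig
  have hnKT' : ((N + 1 : ℕ) : ℝ) * K ≤ T := by exact_mod_cast hnKT
  set n : ℝ := ((N + 1 : ℕ) : ℝ) with hn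
  set l := Real.log T with hldef
  set L := radiusLog (N + 1) K T with hLdef
  have htarget : n ^ (3 / 2 : ℝ) * Real.sqrt (K * T * l) = Real.sqrt (n ^ 3 * K * T * l) := by
    have h1 : n ^ (3 / 2 : ℝ) = Real.sqrt (n ^ 3) := by
      rw [Real.sqrt_eq_rpow, ← Real.rpow_natCast, ← Real.rpow_mul (by linarith)]
      norm_num
    rw [h1, ← Real.sqrt_mul (by positivity)]
    congr 1
    ring
  rw [htarget]
  set S := Real.sqrt (n ^ 3 * K * T * l) with hS
  have hSsq : S ^ 2 = n ^ 3 * K * T * l := Real.sq_sqrt (by positivity)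
  have hS0 : 0 ≤ S := Real.sqrt_nonneg _
  -- With `2 ^ m` of order `T / (n K)`, accepting the loss `8 n ε m` in all `T` rounds costs about
  -- as much as exploring up to epoch `m + 1`.
  obtain ⟨m, hm1, hm2⟩ := exists_nat_pow_near (x := (T : ℝ) / (n * K))
    (by rw [le_div_iff₀ (by positivity)]; linarith) (by norm_num : (1 : ℝ) < 2)
  rw [le_div_iff₀ (by positivity)] at hm1
  rw [div_lt_iff₀ (by positivity)] at hm2
  obtain ⟨q₁, hq1, hq2, hq3⟩ := exists_two_pow_pow_ge (c := 1) le_rfl hT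
  -- From epoch `m + 2` on, candidates lose at most `e'` because the radii decrease; before that,
  -- the full loss is charged to `a`.
  have hreg := B.regret_metcElim_le hN hT le_rfl (hlag.imp_right fun h => ⟨h, rfl⟩)
    (e' := 8 * n * eps (N + 1) K T 1 m) (q₁ := q₁)
    (a := fun q => if q < m + 2 then 8 * n * eps (N + 1) K T 1 (q - 1) else 0)
    (ρ := fun _ => 3 * n)
    (by
      have := hε0 m
      positivity)
    (fun q => by
      have := hε0 (q - 1)
      split_ifs <;> positivity) (fun q => by positivity)
    (fun q _ π _ h => by
      have h0 := hε0 m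
      have h1 : 0 ≤ 8 * n * eps (N + 1) K T 1 m := by positivity
      split_ifs with hq
      · linarith
      · rw [add_zero]
        refine h.trans ?_
        gcongr
        exact hεa (by omega))
    (fun q _ π _ _ => by
      have h0 := hε0 m
      have h1 : 0 ≤ 8 * n * eps (N + 1) K T 1 m := by positivity
      have := hloss π
      linarith)
    (Or.inl hq2) hq1
  rw [epochsCost_eq] at hreg
  have hexpl := sum_explore_le (N := N) (K := K) (T := T) m
  have hcomm := sum_communication_le hN q₁
  rw [← hn] at hexpl hcomm
  have hexpl' : ∑ q ∈ Finset.Ico 1 (q₁ + 1), n * K * 2 ^ q ^ 1 *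
      (if q < m + 2 then 8 * n * eps (N + 1) K T 1 (q - 1) else 0) ≤
      ∑ q ∈ Finset.Ico 1 (m + 2), n * K * 2 ^ q ^ 1 *
        (8 * n * eps (N + 1) K T 1 (q - 1)) := by
    simp only [mul_ite, mul_zero]
    rw [← Finset.sum_filter]
    refine Finset.sum_le_sum_of_subset_of_nonneg ?_ fun q _ _ => ?_
    · intro q hq
      rw [Finset.mem_filter, Finset.mem_Ico] at hq
      exact Finset.mem_Ico.2 ⟨hq.1.1, hq.2⟩
    · have := hε0 (q - 1)
      positivity
  have t1 : 32 * (n ^ 2 * K) * Real.sqrt (2 * L * 2 ^ m) ≤ 128 * S := by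
    have h1 : n ^ 2 * K * Real.sqrt (2 * L * 2 ^ m) ≤ 4 * S := by
      refine le_of_sq_le_sq ?_ (by positivity)
      rw [mul_pow, Real.sq_sqrt (by positivity), mul_pow 4 S, hSsq]
      calc (n ^ 2 * K) ^ 2 * (2 * L * 2 ^ m) = n ^ 3 * K * (2 * L) * (2 ^ m * (n * K)) := by ring
        _ ≤ n ^ 3 * K * (2 * (6 * l)) * T := by gcongr
        _ ≤ 4 ^ 2 * (n ^ 3 * K * T * l) := by
          have : 0 ≤ n ^ 3 * K * T * l := by positivity
          linarith
    linarith
  have t2 : T * (8 * n * eps (N + 1) K T 1 m) ≤ 24 * S := by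
    have h1 : T * (n * eps (N + 1) K T 1 m) ≤ 3 * S := by
      refine le_of_sq_le_sq ?_ (by positivity)
      have h2 : 0 < (2 : ℝ) ^ (1 + m) := by positivity
      rw [mul_pow, mul_pow, eps_sq (by linarith), pow_one, mul_pow, hSsq, mul_div_assoc',
        mul_div_assoc', div_le_iff₀ h2, Nat.add_comm 1 m]
      calc (T : ℝ) ^ 2 * (n ^ 2 * L) = T * n ^ 2 * L * T := by ring
        _ ≤ T * n ^ 2 * (6 * l) * (2 ^ (m + 1) * (n * K)) := by gcongr
        _ = 6 * (n ^ 3 * K * T * l) * 2 ^ (m + 1) := by ring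
        _ ≤ 3 ^ 2 * (n ^ 3 * K * T * l) * 2 ^ (m + 1) := by gcongr; norm_num
    linarith
  -- Bounds the lower-order terms: `hbig` gives `n ^ 3 K ^ 2 ≤ T ^ (1 / 4)`, and `ln T ≤ 8 T ^ (1 /
  -- 8)`, so the product is at most `64 √T`.
  have t3 : n ^ 3 * (K : ℝ) ^ 2 * l ^ 2 ≤ 96 * S := by
    have h1 : n ^ 3 * (K : ℝ) ^ 2 ≤ (T : ℝ) ^ (1 / 4 : ℝ) := by
      calc n ^ 3 * (K : ℝ) ^ 2 = ((n ^ 3 * (K : ℝ) ^ 2) ^ 4) ^ (((4 : ℕ) : ℝ)⁻¹) :=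
            (Real.pow_rpow_inv_natCast (by positivity) (by norm_num)).symm
        _ ≤ (T : ℝ) ^ (((4 : ℕ) : ℝ)⁻¹) :=
            Real.rpow_le_rpow (by positivity) hbig' (by positivity)
        _ = _ := by norm_num
    have h2 : l ≤ 8 * (T : ℝ) ^ (1 / 8 : ℝ) := by
      have := Real.log_le_rpow_div hT0.le (by norm_num : (0 : ℝ) < 1 / 8)
      linarith
    have h3 : ((T : ℝ) ^ (1 / 8 : ℝ)) ^ 2 = (T : ℝ) ^ (1 / 4 : ℝ) := by
      rw [← Real.rpow_natCast, ← Real.rpow_mul hT0.le]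
      norm_num
    have h4 : (T : ℝ) ^ (1 / 4 : ℝ) * (T : ℝ) ^ (1 / 4 : ℝ) = Real.sqrt T := by
      rw [← Real.rpow_add hT0, Real.sqrt_eq_rpow]
      norm_num
    have h5 : Real.sqrt T ≤ 3 / 2 * S := by
      refine le_of_sq_le_sq ?_ (by positivity)
      rw [Real.sq_sqrt hT0.le, mul_pow, hSsq]
      have h6 : (1 : ℝ) ≤ n ^ 3 * K := one_le_mul_of_one_le_of_one_le (one_le_pow₀ hn1) hK1
      have h7 : 1 * (T : ℝ) * (1 / 2) ≤ n ^ 3 * K * T * l := by gcongr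
      linarith
    calc n ^ 3 * (K : ℝ) ^ 2 * l ^ 2
        ≤ (T : ℝ) ^ (1 / 4 : ℝ) * (8 * (T : ℝ) ^ (1 / 8 : ℝ)) ^ 2 := by gcongr
      _ = 64 * Real.sqrt T := by rw [mul_pow, h3, ← h4]; ring
      _ ≤ 96 * S := by linarith
  have t4 : 30 * (n ^ 3 * (K : ℝ) ^ 2) * (q₁ : ℝ) ^ 2 ≤ 30 * 144 * (96 * S) := by
    have h1 : (q₁ : ℝ) ≤ 12 * l := by
      rw [pow_one, pow_one] at hq3
      linarith
    calc _ ≤ 30 * (n ^ 3 * (K : ℝ) ^ 2) * (12 * l) ^ 2 := by gcongr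
      _ = 30 * 144 * (n ^ 3 * (K : ℝ) ^ 2 * l ^ 2) := by ring
      _ ≤ _ := by gcongr
  have hlogK : Real.log K ≤ l := Real.log_le_log (by linarith) (by exact_mod_cast hKT)
  have t5 : n * K * (2 * Real.log K + 10 * l) ≤ 24 * (96 * S) := by
    have h1 : n ≤ n ^ 3 := le_self_pow₀ hn1 (by norm_num)
    have h2 : (K : ℝ) ≤ (K : ℝ) ^ 2 := le_self_pow₀ hK1 (by norm_num)
    calc n * K * (2 * Real.log K + 10 * l) ≤ n ^ 3 * (K : ℝ) ^ 2 * (24 * l ^ 2) := by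
          gcongr
          nlinarith
      _ = 24 * (n ^ 3 * (K : ℝ) ^ 2 * l ^ 2) := by ring
      _ ≤ _ := by gcongr
  linarith

end Environment

end MultiplayerBandit

/-! ### Assembly of the three bounds -/

theorem theorem1 :
    -- (a): the constant depends on `c` only
    (∀ c : ℕ, 1 ≤ c → ∃ C : ℝ, 0 < C ∧
      ∀ lag : ℕ, (lag = 1 ∨ (lag = 0 ∧ c = 1)) →
      ∀ (M K T : ℕ) [NeZero K], 1 ≤ M → M ≤ K → 2 ≤ T →
      ∀ (Ω : Type*) [MeasurableSpace Ω] (P : Measure Ω) [IsProbabilityMeasure P]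
        (B : Environment M K P),
        (B.gap ≠ ⊤ → B.regret (metcElim K T c lag) T ≤
          C * (M * K * ((M : ℝ) ^ 2 * Real.log T / B.gap.toReal) ^ (1 + 1 / (c : ℝ)))) ∧
        (B.gap = ⊤ → B.regret (metcElim K T c lag) T ≤
          C * ((M : ℝ) ^ 3 * K * Real.log K * Real.sqrt (Real.log T)
            + (M : ℝ) ^ 2 * K * Real.log T ^ (1 + 1 / (c : ℝ))))) ∧
    -- (b): unique maximum matching, `c = 1`
    (∃ C : ℝ, 0 < C ∧
      ∀ lag : ℕ, (lag = 1 ∨ lag = 0) →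
      ∀ (M K : ℕ) [NeZero K], 1 ≤ M → M ≤ K → ∃ T₀ : ℕ, ∀ T : ℕ, T₀ ≤ T →
      ∀ (Ω : Type*) [MeasurableSpace Ω] (P : Measure Ω) [IsProbabilityMeasure P]
        (B : Environment M K P), (∃! π, B.IsOptimal π) →
        B.regret (metcElim K T 1 lag) T ≤
          C * ((M : ℝ) ^ 3 * K * Real.log T / B.gap.toReal)) ∧
    -- (c): minimax bound, `c = 1`
    (∃ C : ℝ, 0 < C ∧
      ∀ lag : ℕ, (lag = 1 ∨ lag = 0) →
      ∀ (M K : ℕ) [NeZero K], 1 ≤ M → M ≤ K → ∃ T₀ : ℕ, ∀ T : ℕ, T₀ ≤ T →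
      ∀ (Ω : Type*) [MeasurableSpace Ω] (P : Measure Ω) [IsProbabilityMeasure P]
        (B : Environment M K P),
        B.regret (metcElim K T 1 lag) T ≤
          C * ((M : ℝ) ^ (3 / 2 : ℝ) * Real.sqrt (K * T * Real.log T))) := by
  refine ⟨fun c hc => ?_, ⟨8000, by norm_num, ?_⟩, ⟨500000, by norm_num, ?_⟩⟩
  · obtain ⟨D, -, hD⟩ := exists_succ_pow_le hc
    have hb1 : (2 : ℝ) ^ (-(1 / 4) : ℝ) < 1 :=
      Real.rpow_lt_one_of_one_lt_of_neg (by norm_num) (by norm_num)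
    have hS : 0 ≤ (1 - (2 : ℝ) ^ (-(1 / 4) : ℝ))⁻¹ := inv_nonneg.2 (by linarith)
    have hD0 : (0 : ℝ) < 2 ^ D := by positivity
    have hmain := fun (N K : ℕ) [NeZero K] (T lag : ℕ) (Ω : Type _) [MeasurableSpace Ω]
      (P : Measure Ω) [IsProbabilityMeasure P] (B : Environment (N + 1) K P) hN hT hlag hgap =>
      B.regret_le_rpow_of_gap_ne_top (T := T) (lag := lag) hN hT hc hlag hgap hD
    generalize (1 - (2 : ℝ) ^ (-(1 / 4) : ℝ))⁻¹ = S at hS hmain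
    set C₁ : ℝ := 192 + 12288 * 2 ^ D * S + 80 * (3 ^ c * 4) ^ 2 + 54 * (3 ^ c * 44) ^ 2
    have hC₁ : 0 < C₁ := by positivity
    refine ⟨C₁ + (24 + 20 * (3 ^ c * 4) ^ 2), by positivity, ?_⟩
    intro lag hlag M K T _ hM hMK hT Ω _ P _ B
    obtain ⟨N, rfl⟩ : ∃ N, M = N + 1 := ⟨M - 1, by omega⟩
    have hl := half_le_log hT
    have hK1 : (1 : ℝ) ≤ K := by exact_mod_cast (by omega : 1 ≤ K)
    have hlogK : 0 ≤ Real.log K := Real.log_nonneg hK1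
    refine ⟨fun hgap => ?_, fun hgap => ?_⟩
    · refine (hmain N K T lag Ω P B hMK hT hlag hgap).trans ?_
      gcongr
      exact le_add_of_nonneg_right (by positivity)
    -- The second summand of the bound suffices; the first one is only added.
    · refine (B.regret_le_of_gap_eq_top hMK hT hc hlag hgap).trans ?_
      exact mul_le_mul (le_add_of_nonneg_left hC₁.le) (le_add_of_nonneg_left (by positivity))
        (by positivity) (by positivity)
  · intro lag hlag M K _ hM hMK
    obtain ⟨N, rfl⟩ : ∃ N, M = N + 1 := ⟨M - 1, by omega⟩
    obtain ⟨T₀, hT₀⟩ := Filter.eventually_atTop.1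
      ((Real.tendsto_log_atTop.comp tendsto_natCast_atTop_atTop).eventually_ge_atTop
        ((((N + 1 : ℕ) : ℝ) * K) ^ 2))
    refine ⟨max T₀ (max 2 K), fun T hT Ω _ P _ B hu => ?_⟩
    exact B.regret_le_of_unique hMK (by omega) (by omega) hlag (hT₀ T (by omega)) hu
  · intro lag hlag M K _ hM hMK
    obtain ⟨N, rfl⟩ : ∃ N, M = N + 1 := ⟨M - 1, by omega⟩
    refine ⟨max (((N + 1) ^ 3 * K ^ 2) ^ 4) 2, fun T hT Ω _ P _ B => ?_⟩
    exact B.regret_le_sqrt hMK (le_of_max_le_right hT) hlag (le_of_max_le_left hT)
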